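/- Let $d\ge 1$. Let $\mathcal S_d$ be the space of symmetric real $d\times d$ matrices with the Frobenius norm, $\mathcal P_d\subset\mathcal S_d$ the set of strictly positive definite ones, and let a law on $\mathbb R^d$ be a Borel probability measure. Let $BL(\mathbb R^d)$ be the space of bounded Lipschitz $f:\mathbb R^d\to\mathbb R$ with $\|f\|_{BL}=\sup|f|+\sup_{x\ne y}|f(x)-f(y)|/|x-y|$, let $X=BL^*(\mathbb R^d)$ be its dual Banach space, and for a law $Q$ let $\phi_Q(f)=\int f\,dQ$. For $\phi\in X$ and a bounded Lipschitz $\mathcal S_d$-valued function $g$, $\phi^*g$ is the matrix with entries $\phi(g_{ij})$. For $\nu>0$, $y\in\mathbb R^d$, $A\in\mathcal P_d$ put $$L_\nu(y,A)=\tfrac12\log\det A+\tfrac{\nu+d}{2}\log\bigl(1+\nu^{-1}y'A^{-1}y\bigr),\qquad H_\nu(y,A)=L_\nu(y,A)-L_\nu(y,I),$$ $$G_\nu(y,A)=-\frac A2+\frac{(\nu+d)\,yy'}{2(\nu+y'A^{-1}y)}.$$ For fixed $y$, $G_\nu(y,A)$ is the gradient of $H_\nu(y,A)$ with respect to $C=A^{-1}$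 for the inner product $\operatorname{tr}(BD)$ on $\mathcal S_d$, and for fixed $A\in\mathcal P_d$ the function $G_\nu(\cdot,A)$ is bounded and Lipschitz, so that $F(\phi,A)=\phi^*(G_\nu(\cdot,A))$ is a well-defined map from $X\times\mathcal P_d$ to $\mathcal S_d$. For $a>0$ let $\mathcal U_{d,a}$ be the set of laws $Q$ on $\mathbb R^d$ with $Q(H)<1-(d-q)/a$ for every linear subspace $H$ of dimension $q\le d-1$, and $\mathcal V_{d,a}$ the set of laws $P$ on $\mathbb R^d$ with $P(J)<1-(d-q)/a$ for every nonempty affine subspace $J$ of dimension $q\le d-1$. For $Q\in\mathcal U_{d,\nu+d}$ let $A_\nu(Q)$ be the unique critical point in $\mathcal P_d$ of $A\mapsto\int H_\nu(y,A)\,dQ(y)$; it exists, and it is also the strict absolute minimum on $\mathcal P_d$. For $\nu>1$ and $P\in\mathcal V_{d,\nu+d}$ let $(\mu_\nu,\Sigma_\nu)(P)$ be the unique minimizer over $\mathbb R^d\times\mathcal P_d$ of $(\mu,\Sigma)\mapsto\int [L_\nu(y-\mu,\Sigma)-L_\nu(y,I)]\,dP(y)$; it exists, and if $Q$ is the image of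 $P$ under $y\mapsto(y',1)'\in\mathbb R^{d+1}$, then $$A_{\nu-1}(Q)=\begin{pmatrix}\Sigma_\nu+\mu_\nu\mu_\nu'&\mu_\nu\\ \mu_\nu'&1\end{pmatrix}.$$ Let laws be placed in a normed space by an injection $P\mapsto\Phi(P)$. A functional $T$ on a set $D$ of laws is called analytic for the norm of that space if there are an open set $O$ of the space, containing $\Phi(P)$ for a law $P$ exactly when $P\in D$, and an analytic map $g$ on $O$ with $g(\Phi(P))=T(P)$ for all $P\in D$. Let $\nu>0$ in (a)–(c) and $\nu>1$ in (d), (e). (a) $F$ is analytic from $X\times\mathcal P_d$ into $\mathcal S_d$. (b) For each $Q\in\mathcal U_{d,\nu+d}$, the map $C\mapsto F(\phi_Q,C^{-1})$ is Fréchet differentiable at $C=A_\nu(Q)^{-1}$ and its derivative there, a linear map from $\mathcal S_d$ to $\mathcal S_d$, is invertible. (c) $Q\mapsto A_\nu(Q)$ is analytic on $\mathcal U_{d,\nu+d}$ for the $BL^*$ norm (with $\Phi(Q)=\phi_Q\in X$), and $\mathcal U_{d,\nu+d}$ is open for the topology of weak convergence of laws. (d) $P\mapsto(\mu_\nu,\Sigma_\nu)(P)$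 is analytic on $\mathcal V_{d,\nu+d}$ for the $BL^*$ norm (with $\Phi(P)=\phi_P\in X$). (e) For $d=1$, $P\mapsto(\mu_\nu,\sigma_\nu^2)(P)$, where $\Sigma_\nu=(\sigma_\nu^2)$, is analytic on $\mathcal V_{1,\nu+1}$ for the Kolmogorov norm $\|\tau\|_{\mathcal K}=\sup_x|\tau((-\infty,x])|$ on the space of finite signed Borel measures on $\mathbb R$ (with $\Phi(P)=P$). -/

import Mathlib

open MeasureTheory Set
open scoped Matrix Matrix.Norms.Frobenius

noncomputable section

/-- `ℝ^d` with its Euclidean norm. -/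
abbrev Rd (d : ℕ) : Type := EuclideanSpace ℝ (Fin d)

/-- A law on `ℝ^d`; this type carries the topology of weak convergence. -/
abbrev Law (d : ℕ) : Type := ProbabilityMeasure (Rd d)

/-! ### Symmetric and positive definite matrices -/

/-- The space `𝒮_d` of symmetric real matrices, with the Frobenius norm. -/
abbrev SymMat (d : ℕ) : Submodule ℝ (Matrix (Fin d) (Fin d) ℝ) where
  carrier := {A | A.IsSymm}
  add_mem' ha hb := Matrix.IsSymm.add ha hb
  zero_mem' := Matrix.isSymm_zero
  smul_mem' c _ ha := Matrix.IsSymm.smul ha c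

/-- The set `𝒫_d ⊆ 𝒮_d` of strictly positive definite matrices. -/
def PosMat (d : ℕ) : Set (SymMat d) := {A | (A : Matrix (Fin d) (Fin d) ℝ).PosDef}

/-- Matrix inversion on `𝒮_d` (used on `𝒫_d` only). -/
def symInv {d : ℕ} (A : SymMat d) : SymMat d :=
  ⟨(A : Matrix (Fin d) (Fin d) ℝ)⁻¹, by
    have h : (A : Matrix (Fin d) (Fin d) ℝ)ᵀ = A := A.2
    change ((A : Matrix (Fin d) (Fin d) ℝ)⁻¹)ᵀ = (A : Matrix (Fin d) (Fin d) ℝ)⁻¹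
    rw [Matrix.transpose_nonsing_inv, h]⟩

/-- The quadratic form `y' C y`. -/
def quadForm {d : ℕ} (C : Matrix (Fin d) (Fin d) ℝ) (y : Rd d) : ℝ := y.ofLp ⬝ᵥ (C *ᵥ y.ofLp)

/-! ### Bounded Lipschitz functions and their dual -/

/-- `f` is bounded and Lipschitz. -/
def IsBL {E : Type*} [PseudoMetricSpace E] (f : E → ℝ) : Prop :=
  (∃ M : ℝ, ∀ x, |f x| ≤ M) ∧ ∃ K : ℝ, ∀ x y, |f x - f y| ≤ K * dist x y

/-- The vector space of bounded Lipschitz functions. -/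
def blSubmodule (E : Type*) [PseudoMetricSpace E] : Submodule ℝ (E → ℝ) where
  carrier := {f | IsBL f}
  add_mem' := by
    rintro f g ⟨⟨M, hM⟩, K, hK⟩ ⟨⟨N, hN⟩, L, hL⟩
    refine ⟨⟨M + N, fun x => (abs_add_le _ _).trans (add_le_add (hM x) (hN x))⟩, K + L,
      fun x y => ?_⟩
    have : (f + g) x - (f + g) y = (f x - f y) + (g x - g y) := by simp; ring
    rw [this, add_mul]
    exact (abs_add_le _ _).trans (add_le_add (hK x y) (hL x y))
  zero_mem' := ⟨⟨0, by simp⟩, 0, by simp⟩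
  smul_mem' := by
    rintro c f ⟨⟨M, hM⟩, K, hK⟩
    refine ⟨⟨|c| * M, fun x => ?_⟩, |c| * K, fun x y => ?_⟩
    · simpa [abs_mul] using mul_le_mul_of_nonneg_left (hM x) (abs_nonneg c)
    · have : (c • f) x - (c • f) y = c * (f x - f y) := by simp; ring
      rw [this, abs_mul, mul_assoc]
      exact mul_le_mul_of_nonneg_left (hK x y) (abs_nonneg c)

/-- The space `BL(E)` (a type of its own, so that it carries the bounded Lipschitz norm and not
the topology of pointwise convergence). -/
def BL (E : Type*) [PseudoMetricSpace E] : Type _ := blSubmodule E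

namespace BL

variable {E : Type*} [PseudoMetricSpace E]

instance : AddCommGroup (BL E) := inferInstanceAs (AddCommGroup (blSubmodule E))

instance : Module ℝ (BL E) := inferInstanceAs (Module ℝ (blSubmodule E))

/-- A bounded Lipschitz function as an element of `BL(E)`. -/
def mk (f : E → ℝ) (hf : IsBL f) : BL E := ⟨f, hf⟩

/-- The underlying function. -/
def toFun (f : BL E) : E → ℝ := f.1

theorem isBL (f : BL E) : IsBL f.toFun := f.2

theorem ext {f g : BL E} (h : ∀ x, f.toFun x = g.toFun x) : f = g := Subtype.ext (funext h)

theorem toFun_add (f g : BL E) (x : E) : (f + g).toFun x = f.toFun x + g.toFun x := rfl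

theorem toFun_smul (c : ℝ) (f : BL E) (x : E) : (c • f).toFun x = c * f.toFun x := rfl

theorem toFun_zero (x : E) : (0 : BL E).toFun x = 0 := rfl

/-- The sup norm. -/
def supNorm (f : BL E) : ℝ := ⨆ x, |f.toFun x|

/-- The Lipschitz seminorm; the pairs `x = y` contribute `0 / 0 = 0` and do not matter. -/
def lipNorm (f : BL E) : ℝ := ⨆ p : E × E, |f.toFun p.1 - f.toFun p.2| / dist p.1 p.2

theorem abs_le_supNorm (f : BL E) (x : E) : |f.toFun x| ≤ f.supNorm := by
  obtain ⟨M, hM⟩ := f.isBL.1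
  exact le_ciSup (f := fun x => |f.toFun x|) ⟨M, by rintro _ ⟨x, rfl⟩; exact hM x⟩ x

theorem quot_le_lipNorm (f : BL E) (p : E × E) :
    |f.toFun p.1 - f.toFun p.2| / dist p.1 p.2 ≤ f.lipNorm := by
  obtain ⟨K, hK⟩ := f.isBL.2
  refine le_ciSup (f := fun p : E × E => |f.toFun p.1 - f.toFun p.2| / dist p.1 p.2)
    ⟨max K 0, ?_⟩ p
  rintro _ ⟨p, rfl⟩
  refine div_le_of_le_mul₀ dist_nonneg (le_max_right _ _) ((hK _ _).trans ?_)
  exact mul_le_mul_of_nonneg_right (le_max_left _ _) dist_nonneg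

theorem supNorm_nonneg (f : BL E) : 0 ≤ f.supNorm := Real.iSup_nonneg fun _ => abs_nonneg _

theorem lipNorm_nonneg (f : BL E) : 0 ≤ f.lipNorm :=
  Real.iSup_nonneg fun _ => div_nonneg (abs_nonneg _) dist_nonneg

/-- The norm `‖f‖_BL = ‖f‖_sup + sup_{x ≠ y} |f x - f y| / |x - y|`. -/
instance : Norm (BL E) := ⟨fun f => f.supNorm + f.lipNorm⟩

theorem norm_def (f : BL E) : ‖f‖ = f.supNorm + f.lipNorm := rfl

theorem core : NormedSpace.Core ℝ (BL E) where
  norm_nonneg f := add_nonneg f.supNorm_nonneg f.lipNorm_nonneg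
  norm_smul c f := by
    have h1 : (c • f).supNorm = |c| * f.supNorm := by
      unfold supNorm
      rw [Real.mul_iSup_of_nonneg (abs_nonneg c)]
      simp only [toFun_smul, abs_mul]
    have h2 : (c • f).lipNorm = |c| * f.lipNorm := by
      unfold lipNorm
      rw [Real.mul_iSup_of_nonneg (abs_nonneg c)]
      simp only [toFun_smul, ← mul_sub, abs_mul, mul_div_assoc]
    rw [norm_def, norm_def, h1, h2, Real.norm_eq_abs, mul_add]
  norm_triangle f g := by
    have h1 : (f + g).supNorm ≤ f.supNorm + g.supNorm :=
      Real.iSup_le (fun x => (abs_add_le _ _).trans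
        (add_le_add (f.abs_le_supNorm x) (g.abs_le_supNorm x)))
        (add_nonneg f.supNorm_nonneg g.supNorm_nonneg)
    have h2 : (f + g).lipNorm ≤ f.lipNorm + g.lipNorm := by
      refine Real.iSup_le (fun p => ?_) (add_nonneg f.lipNorm_nonneg g.lipNorm_nonneg)
      refine le_trans ?_ (add_le_add (f.quot_le_lipNorm p) (g.quot_le_lipNorm p))
      rw [← add_div]
      refine div_le_div_of_nonneg_right ?_ dist_nonneg
      rw [toFun_add, toFun_add, add_sub_add_comm]
      exact abs_add_le _ _
    rw [norm_def, norm_def, norm_def]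
    linarith
  norm_eq_zero_iff f := by
    constructor
    · intro h
      have h0 : f.supNorm = 0 := by
        have := f.supNorm_nonneg
        have := f.lipNorm_nonneg
        rw [norm_def] at h
        linarith
      refine BL.ext fun x => ?_
      have := f.abs_le_supNorm x
      rw [h0] at this
      rw [toFun_zero]
      exact abs_nonpos_iff.1 this
    · rintro rfl
      simp [norm_def, supNorm, lipNorm, toFun_zero]

instance : NormedAddCommGroup (BL E) := NormedAddCommGroup.ofCore core

instance : NormedSpace ℝ (BL E) := NormedSpace.ofCore core

theorem continuous (f : BL E) : Continuous f.toFun := by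
  obtain ⟨K, hK⟩ := f.isBL.2
  exact (LipschitzWith.of_dist_le' (K := K) fun x y => by
    rw [Real.dist_eq]; exact hK x y).continuous

theorem integrable [MeasurableSpace E] [OpensMeasurableSpace E] (f : BL E) (Q : Measure E)
    [IsFiniteMeasure Q] : Integrable f.toFun Q := by
  obtain ⟨M, hM⟩ := f.isBL.1
  exact Integrable.of_bound f.continuous.measurable.aestronglyMeasurable M
    (Filter.Eventually.of_forall hM)

end BL

/-- The dual Banach space `X = BL*(ℝ^d)`. -/
abbrev BLDual (d : ℕ) : Type := StrongDual ℝ (BL (Rd d))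

/-- The functional `φ_Q(f) = ∫ f dQ`. -/
def lawToDual {d : ℕ} (Q : Law d) : BLDual d :=
  LinearMap.mkContinuous
    { toFun := fun f => ∫ y, f.toFun y ∂(Q : Measure (Rd d))
      map_add' := fun f g => by
        simp only [BL.toFun_add]
        exact integral_add (f.integrable _) (g.integrable _)
      map_smul' := fun c f => by
        simp only [BL.toFun_smul, RingHom.id_apply, smul_eq_mul]
        exact integral_const_mul _ _ }
    1 (fun f => by
      have h := norm_integral_le_of_norm_le_const (μ := (Q : Measure (Rd d))) (f := f.toFun)
        (C := f.supNorm) (Filter.Eventually.of_forall fun y => f.abs_le_supNorm y)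
      simp only [probReal_univ, mul_one] at h
      rw [one_mul, BL.norm_def]
      exact h.trans (le_add_of_nonneg_right f.lipNorm_nonneg))

/-- `φ` evaluated at a function that is bounded and Lipschitz (`0` for other functions). -/
def evalBL {d : ℕ} (φ : BLDual d) (f : Rd d → ℝ) : ℝ :=
  open Classical in if h : IsBL f then φ (BL.mk f h) else 0

/-! ### The pure scatter problem -/

/-- `L_ν(y, A) = (1/2) log det A + ((ν + d)/2) log (1 + y' A⁻¹ y / ν)`. -/
def tLoss {d : ℕ} (ν : ℝ) (y : Rd d) (A : Matrix (Fin d) (Fin d) ℝ) : ℝ :=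
  1 / 2 * Real.log A.det + (ν + d) / 2 * Real.log (1 + ν⁻¹ * quadForm A⁻¹ y)

/-- `H_ν(y, A) = L_ν(y, A) - L_ν(y, I)`. -/
def scatterH {d : ℕ} (ν : ℝ) (y : Rd d) (A : SymMat d) : ℝ :=
  tLoss ν y (A : Matrix (Fin d) (Fin d) ℝ) - tLoss ν y 1

/-- `Q H_ν(A) = ∫ H_ν(y, A) dQ(y)`. -/
def scatterObj {d : ℕ} (ν : ℝ) (Q : Law d) (A : SymMat d) : ℝ :=
  ∫ y, scatterH ν y A ∂(Q : Measure (Rd d))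

/-- `A ∈ 𝒫_d` is the unique critical point of `Q H_ν` on `𝒫_d` and its strict absolute minimum;
the integrals that define `Q H_ν` exist. -/
structure IsTScatter {d : ℕ} (ν : ℝ) (Q : Law d) (A : SymMat d) : Prop where
  posDef : A ∈ PosMat d
  integrable : ∀ B ∈ PosMat d, Integrable (fun y => scatterH ν y B) (Q : Measure (Rd d))
  critical : HasFDerivAt (scatterObj ν Q) (0 : SymMat d →L[ℝ] ℝ) A
  unique : ∀ B ∈ PosMat d, HasFDerivAt (scatterObj ν Q) (0 : SymMat d →L[ℝ] ℝ) B → B = A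
  minimal : ∀ B ∈ PosMat d, B ≠ A → scatterObj ν Q A < scatterObj ν Q B

/-- The `t_ν` scatter functional `A_ν(Q)`, with an arbitrary value where it does not exist. -/
def tScatter {d : ℕ} (ν : ℝ) (Q : Law d) : SymMat d := Classical.epsilon (IsTScatter ν Q)

/-- The set `𝒰_{d,a}`: `Q(H) < 1 - (d - q)/a` for each linear subspace `H` of dimension
`q ≤ d - 1`. -/
def scatterDomain (d : ℕ) (a : ℝ) : Set (Law d) :=
  {Q | ∀ H : Submodule ℝ (Rd d), Module.finrank ℝ H < d →
    (Q : Measure (Rd d)).real (H : Set (Rd d)) < 1 - ((d : ℝ) - Module.finrank ℝ H) / a}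

/-- The score `G_ν(y, A) = -A/2 + (ν + d) y y' / (2 (ν + y' A⁻¹ y))`. -/
def score {d : ℕ} (ν : ℝ) (y : Rd d) (A : SymMat d) : Matrix (Fin d) (Fin d) ℝ :=
  -((1 / 2 : ℝ) • (A : Matrix (Fin d) (Fin d) ℝ)) +
    ((ν + d) / (2 * (ν + quadForm (A : Matrix (Fin d) (Fin d) ℝ)⁻¹ y))) •
      Matrix.vecMulVec y.ofLp y.ofLp

theorem score_symm {d : ℕ} (ν : ℝ) (y : Rd d) (A : SymMat d) (i j : Fin d) :
    score ν y A i j = score ν y A j i := by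
  have h : (A : Matrix (Fin d) (Fin d) ℝ) i j = (A : Matrix (Fin d) (Fin d) ℝ) j i :=
    Matrix.IsSymm.apply (show (A : Matrix (Fin d) (Fin d) ℝ).IsSymm from A.2) j i
  simp [score, Matrix.vecMulVec_apply, h, mul_comm (y i)]

/-- `F(φ, A) = φ*(G_ν(·, A))`, where `φ*` acts on a matrix-valued function entry by entry. -/
def scoreMap {d : ℕ} (ν : ℝ) (p : BLDual d × SymMat d) : SymMat d :=
  ⟨Matrix.of fun i j => evalBL p.1 fun y => score ν y p.2 i j, by
    refine Matrix.IsSymm.ext fun i j => ?_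
    simp only [Matrix.of_apply, score_symm ν _ p.2 i j]⟩

/-! ### The location-scatter problem -/

/-- `h_ν(y, (μ, Σ)) = ρ_ν(y, (μ, Σ)) - ρ_ν(y, (0, I))`, where
`ρ_ν(y, (μ, Σ)) = (1/2) log det Σ + ((ν + d)/2) log (1 + (y - μ)' Σ⁻¹ (y - μ) / ν)`. -/
def locScatterH {d : ℕ} (ν : ℝ) (y : Rd d) (θ : Rd d × SymMat d) : ℝ :=
  tLoss ν (y - θ.1) (θ.2 : Matrix (Fin d) (Fin d) ℝ) - tLoss ν y 1

/-- `P h_ν(μ, Σ) = ∫ h_ν(y, (μ, Σ)) dP(y)`. -/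
def locScatterObj {d : ℕ} (ν : ℝ) (P : Law d) (θ : Rd d × SymMat d) : ℝ :=
  ∫ y, locScatterH ν y θ ∂(P : Measure (Rd d))

/-- `θ = (μ, Σ)` is the M-functional of `P`: the integrals `P h_ν` exist and are uniquely
minimized over `ℝ^d × 𝒫_d` at `θ`. -/
structure IsTLocScatter {d : ℕ} (ν : ℝ) (P : Law d) (θ : Rd d × SymMat d) : Prop where
  posDef : θ.2 ∈ PosMat d
  integrable : ∀ η : Rd d × SymMat d, η.2 ∈ PosMat d →
    Integrable (fun y => locScatterH ν y η) (P : Measure (Rd d))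
  minimal : ∀ η : Rd d × SymMat d, η.2 ∈ PosMat d → η ≠ θ →
    locScatterObj ν P θ < locScatterObj ν P η

/-- The `t_ν` location-scatter functional `(μ_ν, Σ_ν)(P)`, with an arbitrary value where it does
not exist. -/
def tLocScatter {d : ℕ} (ν : ℝ) (P : Law d) : Rd d × SymMat d :=
  Classical.epsilon (IsTLocScatter ν P)

/-- The set `𝒱_{d,a}`: `P(J) < 1 - (d - q)/a` for each (nonempty) affine subspace `J` of
dimension `q ≤ d - 1`. -/
def locScatterDomain (d : ℕ) (a : ℝ) : Set (Law d) :=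
  {P | ∀ J : AffineSubspace ℝ (Rd d), (J : Set (Rd d)).Nonempty →
    Module.finrank ℝ J.direction < d →
    (P : Measure (Rd d)).real (J : Set (Rd d)) < 1 - ((d : ℝ) - Module.finrank ℝ J.direction) / a}

/-- The map `T₁ y = (y, 1)` from `ℝ^d` to `ℝ^{d+1}`. -/
def liftOne {d : ℕ} (y : Rd d) : Rd (d + 1) := WithLp.toLp 2 (Fin.snoc y.ofLp (1 : ℝ))

theorem measurable_liftOne {d : ℕ} : Measurable (liftOne (d := d)) := by
  refine Continuous.measurable ?_
  refine (PiLp.continuous_toLp 2 _).comp ?_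
  exact Continuous.finSnoc (A := fun _ => ℝ) (PiLp.continuous_ofLp 2 _) continuous_const

/-- The law `P ∘ T₁⁻¹` on `ℝ^{d+1}`. -/
def liftLaw {d : ℕ} (P : Law d) : Law (d + 1) := P.map measurable_liftOne.aemeasurable

/-- The matrix `A(Σ, μ, 1)`, with blocks `Σ + μ μ'`, `μ`, `μ'` and `1`. -/
def locScatterBlock {d : ℕ} (θ : Rd d × SymMat d) : Matrix (Fin (d + 1)) (Fin (d + 1)) ℝ :=
  Matrix.reindex finSumFinEquiv finSumFinEquiv
    (Matrix.fromBlocks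
      ((θ.2 : Matrix (Fin d) (Fin d) ℝ) + Matrix.vecMulVec θ.1.ofLp θ.1.ofLp)
      (Matrix.replicateCol (Fin 1) θ.1.ofLp) (Matrix.replicateRow (Fin 1) θ.1.ofLp) 1)

/-! ### Signed measures on the line with the Kolmogorov norm -/

/-- Finite signed Borel measures on `ℝ`, with the norm `‖τ‖_𝒦 = sup_x |τ((-∞, x])|`. -/
def KMeas : Type := SignedMeasure ℝ

namespace KMeas

instance : AddCommGroup KMeas := inferInstanceAs (AddCommGroup (SignedMeasure ℝ))

instance : Module ℝ KMeas := inferInstanceAs (Module ℝ (SignedMeasure ℝ))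

/-- `τ((-∞, x])`. -/
def cdf (τ : KMeas) (x : ℝ) : ℝ := (show SignedMeasure ℝ from τ) (Iic x)

instance : Norm KMeas := ⟨fun τ => ⨆ x, |τ.cdf x|⟩

theorem norm_def (τ : KMeas) : ‖τ‖ = ⨆ x, |τ.cdf x| := rfl

theorem cdf_add (σ τ : KMeas) (x : ℝ) : (σ + τ).cdf x = σ.cdf x + τ.cdf x :=
  rfl

theorem cdf_smul (c : ℝ) (τ : KMeas) (x : ℝ) : (c • τ).cdf x = c * τ.cdf x :=
  rfl

theorem cdf_eq (τ : KMeas) (x : ℝ) :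
    τ.cdf x =
      (SignedMeasure.toJordanDecomposition (show SignedMeasure ℝ from τ)).posPart.real (Iic x) -
      (SignedMeasure.toJordanDecomposition (show SignedMeasure ℝ from τ)).negPart.real (Iic x) := by
  conv_lhs => rw [cdf, ← SignedMeasure.toSignedMeasure_toJordanDecomposition
    (show SignedMeasure ℝ from τ)]
  rw [JordanDecomposition.toSignedMeasure, sub_apply,
    Measure.toSignedMeasure_apply_measurable measurableSet_Iic,
    Measure.toSignedMeasure_apply_measurable measurableSet_Iic]

theorem abs_cdf_le (τ : KMeas) (x : ℝ) : |τ.cdf x| ≤ ‖τ‖ := by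
  refine le_ciSup (f := fun x => |τ.cdf x|)
    ⟨(SignedMeasure.toJordanDecomposition (show SignedMeasure ℝ from τ)).posPart.real univ +
      (SignedMeasure.toJordanDecomposition (show SignedMeasure ℝ from τ)).negPart.real univ, ?_⟩ x
  rintro _ ⟨x, rfl⟩
  change |τ.cdf x| ≤ _
  rw [cdf_eq]
  refine (abs_sub _ _).trans ?_
  rw [abs_of_nonneg measureReal_nonneg, abs_of_nonneg measureReal_nonneg]
  exact add_le_add (measureReal_mono (subset_univ _)) (measureReal_mono (subset_univ _))

theorem eq_zero_of_cdf (τ : KMeas) (h : ∀ x, τ.cdf x = 0) : τ = 0 := by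
  have key : (SignedMeasure.toJordanDecomposition (show SignedMeasure ℝ from τ)).posPart =
      (SignedMeasure.toJordanDecomposition (show SignedMeasure ℝ from τ)).negPart := by
    refine Measure.ext_of_Iic _ _ fun x => ?_
    have := h x
    rw [cdf_eq, sub_eq_zero, measureReal_def, measureReal_def,
      ENNReal.toReal_eq_toReal_iff' (measure_ne_top _ _) (measure_ne_top _ _)] at this
    exact this
  have h2 := SignedMeasure.toSignedMeasure_toJordanDecomposition (show SignedMeasure ℝ from τ)
  rw [JordanDecomposition.toSignedMeasure] at h2
  simp only [key, sub_self] at h2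
  exact h2.symm

theorem core : NormedSpace.Core ℝ KMeas where
  norm_nonneg τ := Real.iSup_nonneg fun _ => abs_nonneg _
  norm_smul c τ := by
    rw [norm_def, norm_def, Real.norm_eq_abs, Real.mul_iSup_of_nonneg (abs_nonneg c)]
    simp only [cdf_smul, abs_mul]
  norm_triangle σ τ :=
    Real.iSup_le (fun x => by
      rw [cdf_add]
      exact (abs_add_le _ _).trans (add_le_add (σ.abs_cdf_le x) (τ.abs_cdf_le x)))
      (add_nonneg (Real.iSup_nonneg fun _ => abs_nonneg _)
        (Real.iSup_nonneg fun _ => abs_nonneg _))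
  norm_eq_zero_iff τ := by
    constructor
    · intro h
      refine eq_zero_of_cdf τ fun x => ?_
      have := τ.abs_cdf_le x
      rw [h] at this
      exact abs_nonpos_iff.1 this
    · rintro rfl
      have h0 : ∀ x, (0 : KMeas).cdf x = 0 := fun x => rfl
      simp [norm_def, h0]

instance : NormedAddCommGroup KMeas := NormedAddCommGroup.ofCore core

instance : NormedSpace ℝ KMeas := NormedSpace.ofCore core

end KMeas

/-- A law on `ℝ` as a signed measure. -/
def lawToKMeas (P : ProbabilityMeasure ℝ) : KMeas := (P : Measure ℝ).toSignedMeasure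

/-- A law on `ℝ` as a law on the Euclidean space `ℝ^1`. -/
def lawOne (P : ProbabilityMeasure ℝ) : Law 1 :=
  P.map (f := fun x : ℝ => (WithLp.toLp 2 (fun _ : Fin 1 => x) : Rd 1))
    (((PiLp.continuous_toLp 2 _).comp
      (continuous_pi fun _ => continuous_id)).measurable.aemeasurable)

/-- The `t_ν` location and scatter functionals `(μ_ν, σ_ν²)` of a law on `ℝ`. -/
def tLocScatterOne (ν : ℝ) (P : ProbabilityMeasure ℝ) : ℝ × ℝ :=
  ((tLocScatter ν (lawOne P)).1 0,
    ((tLocScatter ν (lawOne P)).2 : Matrix (Fin 1) (Fin 1) ℝ) 0 0)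

/-! ### Analytic functionals of laws -/

/-- Let the laws of a set `Λ` be placed in a normed space `X` by `Φ`. The functional `T` is analytic
on the set `D` of laws, for the norm of `X`, if `D` is relatively open in `Λ` and `T` is on `D` the
restriction of an analytic map on an open subset of `X`. -/
def AnalyticOnLaws {Λ X W : Type*} [NormedAddCommGroup X] [NormedSpace ℝ X]
    [NormedAddCommGroup W] [NormedSpace ℝ W] (Φ : Λ → X) (T : Λ → W) (D : Set Λ) : Prop :=
  ∃ (O : Set X) (g : X → W), IsOpen O ∧ (∀ P : Λ, Φ P ∈ O ↔ P ∈ D) ∧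
    AnalyticOnNhd ℝ g O ∧ ∀ P ∈ D, g (Φ P) = T P

end

noncomputable section

/-! ### `BL E` is a commutative Banach algebra -/

namespace BL

variable {E : Type*} [PseudoMetricSpace E]

/-! Everything is written in the variable `C = A⁻¹`. With `r_kl = y_k y_l / (1 + |y|²)`, the
function `y_k y_l / (ν + y'Cy)` is `r_kl` times the inverse of `(ν + y'Cy) / (1 + |y|²)`. The latter
is affine in `C` and bounded below by a positive constant, hence a unit of the commutative Banach
algebra `BL`. Inversion of units is analytic and the pairing with `φ` is bilinear, so the score
equation `scoreEq` is jointly analytic in `(φ, C)`. Only the condition `BLRatio` on a map `y : E →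
ℝ^n` is needed, so one argument serves three cases: the identity of `ℝ^d`, the map `y ↦ (y, 1)`, and
the map `x ↦ (x, 1)` on the line with the arctan metric.

For a law, `scoreEq` is the gradient of the objective. If `C` is critical and `B` is another
positive definite matrix, both are diagonalized simultaneously, and Jensen's inequality for the
logarithm, integrated against the law, gives a strictly larger value at `B`
(`scatterObj_lt_of_critical`). Hence a critical point is unique and is the strict minimum. For
existence, matrices are written `U' diag(exp s) U` with `U` orthogonal. Along a ray `t s` the
objective has an asymptotic slope, positive exactly because the law puts little mass on subspaces
(`sum_lt_integral_supportMax`); a power mean inequality and compactness make the positivity uniform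
(`exists_scatterObj_pos_of_le_norm`), while the value at the identity is zero.

At a critical point the derivative of `scoreEq` in `C` is injective: its pairing with `Δ` is the
integral of a function that Cauchy–Schwarz makes nonnegative, with a margin proportional to `ν`
(`BLRatio.eq_zero_of_derivative_eq_zero`). The analytic implicit function theorem then gives local
analytic solutions near each law of the domain. They agree on overlaps by uniqueness and the
identity theorem, so they glue (`analyticOnLaws_of_local`). The domain is cut out by an open
condition, both in the dual norm and weakly, since the mass of a subspace is the decreasing limit of
integrals of powers of one `BL` function and orthonormal frames form a compact set.

Location and scatter in dimension `d` with parameter `ν` is pure scatter in dimension `d + 1` with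
parameter `ν - 1` for the image law under `y ↦ (y, 1)`; the critical equation forces the corner
entry of the solution to be 1. For the Kolmogorov norm the line is given the metric `|arctan x -
arctan y|`: a Lipschitz function then has variation at most `π` times its constant, so integration
is continuous from signed measures to the dual of `BL` (`KMeas.toDual`) and analyticity is pulled
back along this linear map. -/

theorem toFun_sub (f g : BL E) (x : E) : (f - g).toFun x = f.toFun x - g.toFun x := rfl

theorem toFun_mk (f : E → ℝ) (hf : IsBL f) (x : E) : (mk f hf).toFun x = f x := rfl

theorem abs_le_norm (f : BL E) (x : E) : |f.toFun x| ≤ ‖f‖ :=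
  (f.abs_le_supNorm x).trans (le_add_of_nonneg_right f.lipNorm_nonneg)

theorem abs_sub_le_lipNorm (f : BL E) (x y : E) :
    |f.toFun x - f.toFun y| ≤ f.lipNorm * dist x y := by
  rcases eq_or_lt_of_le (dist_nonneg (x := x) (y := y)) with h | h
  · obtain ⟨K, hK⟩ := f.isBL.2
    have := hK x y
    rw [← h, mul_zero] at this ⊢
    exact this
  · have := f.quot_le_lipNorm (x, y)
    rwa [div_le_iff₀ h] at this

theorem norm_le_of_bounds (f : BL E) {M K : ℝ} (hM0 : 0 ≤ M) (hK0 : 0 ≤ K)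
    (hM : ∀ x, |f.toFun x| ≤ M) (hK : ∀ x y, |f.toFun x - f.toFun y| ≤ K * dist x y) :
    ‖f‖ ≤ M + K :=
  add_le_add (Real.iSup_le hM hM0) (Real.iSup_le (fun p =>
    div_le_of_le_mul₀ dist_nonneg hK0 (hK p.1 p.2)) hK0)

end BL

theorem IsBL.mul {E : Type*} [PseudoMetricSpace E] {f g : E → ℝ} (hf : IsBL f) (hg : IsBL g) :
    IsBL fun x => f x * g x := by
  obtain ⟨⟨M, hM⟩, K, hK⟩ := hf
  obtain ⟨⟨N, hN⟩, L, hL⟩ := hg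
  refine ⟨⟨M * N, fun x => ?_⟩, M * L + K * N, fun x y => ?_⟩
  · rw [abs_mul]
    exact mul_le_mul (hM x) (hN x) (abs_nonneg _) ((abs_nonneg _).trans (hM x))
  · have h : f x * g x - f y * g y = f x * (g x - g y) + (f x - f y) * g y := by ring
    rw [h]
    refine (abs_add_le _ _).trans ?_
    rw [abs_mul, abs_mul]
    have h1 := mul_le_mul (hM x) (hL x y) (abs_nonneg _) ((abs_nonneg _).trans (hM x))
    have h2 := mul_le_mul (hK x y) (hN y) (abs_nonneg _) ((abs_nonneg _).trans (hK x y))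
    linarith

theorem isBL_const {E : Type*} [PseudoMetricSpace E] (c : ℝ) : IsBL fun _ : E => c :=
  ⟨⟨|c|, fun _ => le_rfl⟩, 0, fun _ _ => by simp⟩

namespace BL

variable {E : Type*} [PseudoMetricSpace E]

instance : Mul (BL E) := ⟨fun f g => mk (fun x => f.toFun x * g.toFun x) (f.isBL.mul g.isBL)⟩

instance : One (BL E) := ⟨mk (fun _ => 1) (isBL_const 1)⟩

theorem toFun_mul (f g : BL E) (x : E) : (f * g).toFun x = f.toFun x * g.toFun x := rfl

theorem toFun_one (x : E) : (1 : BL E).toFun x = 1 := rfl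

/-- The Leibniz rule bounds the Lipschitz part by `|f|_∞ Lip g + Lip f |g|_∞`; the product of the
norms exceeds the resulting bound by the nonnegative term `Lip f · Lip g`. -/
theorem norm_mul_le' (f g : BL E) : ‖f * g‖ ≤ ‖f‖ * ‖g‖ := by
  have hf := f.supNorm_nonneg
  have hg := g.supNorm_nonneg
  have hf' := f.lipNorm_nonneg
  have hg' := g.lipNorm_nonneg
  have h : ‖f * g‖ ≤ f.supNorm * g.supNorm + (f.supNorm * g.lipNorm + f.lipNorm * g.supNorm) := by
    refine norm_le_of_bounds _ (by positivity) (by positivity) (fun x => ?_) fun x y => ?_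
    · rw [toFun_mul, abs_mul]
      exact mul_le_mul (f.abs_le_supNorm x) (g.abs_le_supNorm x) (abs_nonneg _) hf
    · have h : (f * g).toFun x - (f * g).toFun y =
          f.toFun x * (g.toFun x - g.toFun y) + (f.toFun x - f.toFun y) * g.toFun y := by
        rw [toFun_mul, toFun_mul]; ring
      rw [h]
      refine (abs_add_le _ _).trans ?_
      rw [abs_mul, abs_mul]
      have h1 := mul_le_mul (f.abs_le_supNorm x) (g.abs_sub_le_lipNorm x y) (abs_nonneg _) hf
      have h2 := mul_le_mul (f.abs_sub_le_lipNorm x y) (g.abs_le_supNorm y) (abs_nonneg _)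
        ((abs_nonneg _).trans (f.abs_sub_le_lipNorm x y))
      linarith
  rw [norm_def f, norm_def g]
  nlinarith

-- The additive group and the norm are the given ones, so the dual of this algebra is the dual in
-- the theorem.
scoped instance : NormedCommRing (BL E) :=
  { (inferInstance : NormedAddCommGroup (BL E)) with
    mul := (· * ·)
    one := 1
    mul_assoc := fun f g h => BL.ext fun x => by simp only [toFun_mul]; ring
    one_mul := fun f => BL.ext fun x => by simp only [toFun_mul, toFun_one]; ring
    mul_one := fun f => BL.ext fun x => by simp only [toFun_mul, toFun_one]; ring
    mul_comm := fun f g => BL.ext fun x => by simp only [toFun_mul]; ring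
    left_distrib := fun f g h => BL.ext fun x => by simp only [toFun_mul, toFun_add]; ring
    right_distrib := fun f g h => BL.ext fun x => by simp only [toFun_mul, toFun_add]; ring
    zero_mul := fun f => BL.ext fun x => by simp only [toFun_mul, toFun_zero]; ring
    mul_zero := fun f => BL.ext fun x => by simp only [toFun_mul, toFun_zero]; ring
    norm_mul_le := norm_mul_le' }

scoped instance : NormedAlgebra ℝ (BL E) :=
  { Algebra.ofModule
      (fun c f g => BL.ext fun x => by simp only [toFun_mul, toFun_smul]; ring)
      (fun c f g => BL.ext fun x => by simp only [toFun_mul, toFun_smul]; ring) with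
    norm_smul_le := fun c f => norm_smul_le c f }

/-- Evaluation at a point. -/
def evalHom (x : E) : BL E →+* ℝ where
  toFun f := f.toFun x
  map_one' := rfl
  map_mul' _ _ := rfl
  map_zero' := rfl
  map_add' _ _ := rfl

theorem toFun_sum {ι : Type*} (s : Finset ι) (f : ι → BL E) (x : E) :
    (∑ i ∈ s, f i).toFun x = ∑ i ∈ s, (f i).toFun x := map_sum (evalHom x) f s

theorem toFun_pow (f : BL E) (k : ℕ) (x : E) : (f ^ k).toFun x = f.toFun x ^ k :=
  map_pow (evalHom x) f k

/-- Completeness makes inversion analytic at every unit. A Cauchy sequence converges pointwise, and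
the bounds on values and on increments pass to the pointwise limit. -/
instance : CompleteSpace (BL E) := by
  refine Metric.complete_of_cauchySeq_tendsto fun F hF => ?_
  have hpt : ∀ x, CauchySeq fun n => (F n).toFun x := fun x => by
    rw [Metric.cauchySeq_iff'] at hF ⊢
    intro ε hε
    obtain ⟨N, hN⟩ := hF ε hε
    refine ⟨N, fun n hn => lt_of_le_of_lt ?_ (hN n hn)⟩
    rw [Real.dist_eq, dist_eq_norm, ← toFun_sub]
    exact abs_le_norm _ _
  choose g hg using fun x => cauchySeq_tendsto_of_complete (hpt x)
  have hbd : ∀ ε > 0, ∃ N, ∀ n ≥ N, (∀ x, |(F n).toFun x - g x| ≤ ε) ∧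
      ∀ x y, |((F n).toFun x - g x) - ((F n).toFun y - g y)| ≤ ε * dist x y := by
    intro ε hε
    obtain ⟨N, hN⟩ := Metric.cauchySeq_iff.1 hF ε hε
    refine ⟨N, fun n hn => ⟨fun x => ?_, fun x y => ?_⟩⟩
    · refine le_of_tendsto ((hg x).const_sub _).abs (Filter.eventually_atTop.2 ⟨N, fun m hm => ?_⟩)
      rw [← toFun_sub]
      refine (abs_le_norm _ _).trans ?_
      rw [← dist_eq_norm]
      exact (hN n hn m hm).le
    · refine le_of_tendsto (((hg x).const_sub _).sub ((hg y).const_sub _)).abs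
        (Filter.eventually_atTop.2 ⟨N, fun m hm => ?_⟩)
      rw [← toFun_sub, ← toFun_sub]
      refine (abs_sub_le_lipNorm _ _ _).trans (mul_le_mul_of_nonneg_right ?_ dist_nonneg)
      have := (hN n hn m hm).le
      rw [dist_eq_norm, norm_def] at this
      linarith [(F n - F m).supNorm_nonneg]
  -- The limit is bounded Lipschitz as the difference of one term `F N` and of `F N - g`, which has
  -- both constants at most 1.
  obtain ⟨N, hN⟩ := hbd 1 one_pos
  have hgBL : IsBL g := by
    have h1 : IsBL fun x => (F N).toFun x - g x :=
      ⟨⟨1, (hN N le_rfl).1⟩, 1, (hN N le_rfl).2⟩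
    have h2 := (blSubmodule E).sub_mem (F N).isBL h1
    convert! h2 using 1
    ext x
    simp
  refine ⟨mk g hgBL, Metric.tendsto_atTop.2 fun ε hε => ?_⟩
  obtain ⟨N, hN⟩ := hbd (ε / 3) (by positivity)
  refine ⟨N, fun n hn => ?_⟩
  rw [dist_eq_norm]
  have := norm_le_of_bounds (F n - mk g hgBL) (M := ε / 3) (K := ε / 3) (by positivity)
    (by positivity) (hN n hn).1 (hN n hn).2
  linarith

/-- The reciprocal is bounded by `1/c`, and `1/u - 1/v = (v - u)/(uv)` gives it the Lipschitz
constant `Lip f / c²`. -/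
theorem isUnit_of_pos_le (f : BL E) {c : ℝ} (hc : 0 < c) (h : ∀ x, c ≤ f.toFun x) : IsUnit f := by
  have hpos : ∀ x, 0 < f.toFun x := fun x => hc.trans_le (h x)
  have hinv : IsBL fun x => (f.toFun x)⁻¹ := by
    refine ⟨⟨c⁻¹, fun x => ?_⟩, f.lipNorm / (c * c), fun x y => ?_⟩
    · rw [abs_of_pos (inv_pos.2 (hpos x))]
      exact inv_anti₀ hc (h x)
    · rw [inv_sub_inv (hpos x).ne' (hpos y).ne', abs_div, abs_mul, abs_of_pos (hpos x),
        abs_of_pos (hpos y), abs_sub_comm]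
      have h1 := f.abs_sub_le_lipNorm x y
      have h2 : c * c ≤ f.toFun x * f.toFun y := mul_le_mul (h x) (h y) hc.le (hpos x).le
      calc |f.toFun x - f.toFun y| / (f.toFun x * f.toFun y)
          ≤ (f.lipNorm * dist x y) / (c * c) :=
            div_le_div₀ ((abs_nonneg _).trans h1) h1 (by positivity) h2
        _ = _ := by ring
  exact IsUnit.of_mul_eq_one (mk _ hinv) (BL.ext fun x => by
    rw [toFun_mul, toFun_mk, toFun_one]; exact mul_inv_cancel₀ (hpos x).ne')

theorem toFun_inverse {f : BL E} (hf : IsUnit f) (x : E) :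
    (Ring.inverse f).toFun x = (f.toFun x)⁻¹ := by
  have h : (f * Ring.inverse f).toFun x = 1 := by rw [Ring.mul_inverse_cancel f hf]; rfl
  rw [toFun_mul] at h
  exact eq_inv_of_mul_eq_one_right h

end BL

open scoped BL

/-- The topology of the Frobenius norm on `𝒮_d`, in the form that the normed space library
expects. -/
abbrev symMatTopology (n : ℕ) : TopologicalSpace (SymMat n) :=
  (inferInstance : NormedAddCommGroup (SymMat n)).toMetricSpace.toPseudoMetricSpace.toUniformSpace.toTopologicalSpace

attribute [local instance] symMatTopology

/-! ### Symmetric matrices and quadratic forms -/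

namespace SymMat

variable {n : ℕ}

/-- The symmetric part of a matrix. -/
def symPart : Matrix (Fin n) (Fin n) ℝ →ₗ[ℝ] SymMat n where
  toFun M := ⟨(1 / 2 : ℝ) • (M + Mᵀ), by
    change ((1 / 2 : ℝ) • (M + Mᵀ))ᵀ = _
    rw [Matrix.transpose_smul, Matrix.transpose_add, Matrix.transpose_transpose, add_comm]⟩
  map_add' M N := by
    ext i j
    simp
    ring
  map_smul' c M := by
    ext i j
    simp
    ring

theorem apply_comm (A : SymMat n) (i j : Fin n) :
    (A : Matrix (Fin n) (Fin n) ℝ) i j = (A : Matrix (Fin n) (Fin n) ℝ) j i :=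
  Matrix.IsSymm.apply (show (A : Matrix (Fin n) (Fin n) ℝ).IsSymm from A.2) j i

theorem transpose_coe (A : SymMat n) :
    (A : Matrix (Fin n) (Fin n) ℝ)ᵀ = (A : Matrix (Fin n) (Fin n) ℝ) := A.2

theorem symPart_coe (A : SymMat n) : symPart (A : Matrix (Fin n) (Fin n) ℝ) = A := by
  ext i j
  change (1 / 2 : ℝ) * ((A : Matrix (Fin n) (Fin n) ℝ) i j +
    (A : Matrix (Fin n) (Fin n) ℝ) j i) = _
  rw [apply_comm A j i]
  ring

/-- The entry `A i j` as a continuous linear functional. -/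
def entryL (i j : Fin n) : SymMat n →L[ℝ] ℝ :=
  LinearMap.toContinuousLinearMap
    { toFun := fun A => (A : Matrix (Fin n) (Fin n) ℝ) i j
      map_add' := fun _ _ => rfl
      map_smul' := fun _ _ => rfl }

@[simp] theorem entryL_apply (i j : Fin n) (A : SymMat n) :
    entryL i j A = (A : Matrix (Fin n) (Fin n) ℝ) i j := rfl

/-- Since the sum runs over finitely many fixed vectors, analyticity and continuity of `𝒮_n`-valued
maps can be checked on entries. Elementary matrices are not symmetric, hence the symmetric parts. -/
theorem eq_sum_entries (A : SymMat n) :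
    A = ∑ i, ∑ j, (A : Matrix (Fin n) (Fin n) ℝ) i j • symPart (Matrix.single i j 1) := by
  conv_lhs => rw [← symPart_coe A, Matrix.matrix_eq_sum_single (A : Matrix (Fin n) (Fin n) ℝ)]
  simp only [map_sum]
  refine Finset.sum_congr rfl fun i _ => Finset.sum_congr rfl fun j _ => ?_
  rw [← map_smul, Matrix.smul_single, smul_eq_mul, mul_one]

theorem analyticAt_of_entries {Z : Type*} [NormedAddCommGroup Z] [NormedSpace ℝ Z]
    {f : Z → SymMat n} {z : Z}
    (h : ∀ i j, AnalyticAt ℝ (fun z => (f z : Matrix (Fin n) (Fin n) ℝ) i j) z) :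
    AnalyticAt ℝ f z := by
  have : f = fun z => ∑ i, ∑ j, (f z : Matrix (Fin n) (Fin n) ℝ) i j •
      symPart (Matrix.single i j 1) := funext fun z => eq_sum_entries (f z)
  rw [this]
  refine Finset.analyticAt_fun_sum _ fun i _ => Finset.analyticAt_fun_sum _ fun j _ => ?_
  exact (h i j).smul analyticAt_const

theorem continuous_of_entries {Z : Type*} [TopologicalSpace Z] {f : Z → SymMat n}
    (h : ∀ i j, Continuous fun z => (f z : Matrix (Fin n) (Fin n) ℝ) i j) : Continuous f := by
  have : f = fun z => ∑ i, ∑ j, (f z : Matrix (Fin n) (Fin n) ℝ) i j •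
      symPart (Matrix.single i j 1) := funext fun z => eq_sum_entries (f z)
  rw [this]
  exact continuous_finsetSum _ fun i _ => continuous_finsetSum _ fun j _ =>
    (h i j).smul continuous_const

theorem ext_entries {A B : SymMat n}
    (h : ∀ i j, (A : Matrix (Fin n) (Fin n) ℝ) i j = (B : Matrix (Fin n) (Fin n) ℝ) i j) :
    A = B := Subtype.ext (Matrix.ext h)

theorem abs_entry_le (A : SymMat n) (i j : Fin n) :
    |(A : Matrix (Fin n) (Fin n) ℝ) i j| ≤ ‖A‖ := by
  have h := Matrix.frobenius_norm_def (A : Matrix (Fin n) (Fin n) ℝ)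
  have h2 : ‖A‖ = Real.sqrt (∑ i, ∑ j, (A : Matrix (Fin n) (Fin n) ℝ) i j ^ 2) := by
    rw [Submodule.coe_norm, h, Real.sqrt_eq_rpow]
    simp
  rw [h2]
  refine Real.abs_le_sqrt ?_
  refine le_trans ?_ (Finset.single_le_sum (fun i _ => Finset.sum_nonneg fun j _ => sq_nonneg
    ((A : Matrix (Fin n) (Fin n) ℝ) i j)) (Finset.mem_univ i))
  exact Finset.single_le_sum (f := fun j => (A : Matrix (Fin n) (Fin n) ℝ) i j ^ 2)
    (fun j _ => sq_nonneg _) (Finset.mem_univ j)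

end SymMat

section QuadForm

variable {n : ℕ}

theorem quadForm_eq_sum (C : Matrix (Fin n) (Fin n) ℝ) (y : Rd n) :
    quadForm C y = ∑ i, ∑ j, C i j * (y i * y j) := by
  simp only [quadForm, dotProduct, Matrix.mulVec, Finset.mul_sum]
  exact Finset.sum_congr rfl fun i _ => Finset.sum_congr rfl fun j _ => by ring

theorem quadForm_add (C D : Matrix (Fin n) (Fin n) ℝ) (y : Rd n) :
    quadForm (C + D) y = quadForm C y + quadForm D y := by
  simp only [quadForm, Matrix.add_mulVec, dotProduct_add]

theorem quadForm_smul_right (c : ℝ) (C : Matrix (Fin n) (Fin n) ℝ) (y : Rd n) :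
    quadForm C (c • y) = c ^ 2 * quadForm C y := by
  simp only [quadForm_eq_sum, Finset.mul_sum, PiLp.smul_apply, smul_eq_mul]
  exact Finset.sum_congr rfl fun i _ => Finset.sum_congr rfl fun j _ => by ring

theorem quadForm_one (y : Rd n) : quadForm (1 : Matrix (Fin n) (Fin n) ℝ) y = ‖y‖ ^ 2 := by
  rw [EuclideanSpace.norm_sq_eq]
  simp [quadForm, dotProduct, pow_two]

theorem continuous_quadForm (C : Matrix (Fin n) (Fin n) ℝ) : Continuous (quadForm C) := by
  have : quadForm C = fun y : Rd n => ∑ i, ∑ j, C i j * (y i * y j) :=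
    funext fun y => quadForm_eq_sum C y
  rw [this]
  fun_prop

theorem sum_sq_eq_norm_sq (y : Rd n) : ∑ i, y i * y i = ‖y‖ ^ 2 := by
  rw [EuclideanSpace.norm_sq_eq]
  simp [pow_two]

theorem abs_coord_le (y : Rd n) (i : Fin n) : |y i| ≤ ‖y‖ := PiLp.norm_apply_le y i

theorem abs_quadForm_le (C : SymMat n) (y : Rd n) :
    |quadForm (C : Matrix (Fin n) (Fin n) ℝ) y| ≤ (n ^ 2 * ‖C‖) * ‖y‖ ^ 2 := by
  rw [quadForm_eq_sum]
  have h : ∀ i j, |(C : Matrix (Fin n) (Fin n) ℝ) i j * (y i * y j)| ≤ ‖C‖ * ‖y‖ ^ 2 := by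
    intro i j
    rw [abs_mul, abs_mul, pow_two]
    exact mul_le_mul (SymMat.abs_entry_le C i j) (mul_le_mul (abs_coord_le y i) (abs_coord_le y j)
      (abs_nonneg _) (norm_nonneg _)) (by positivity) (norm_nonneg _)
  calc _ ≤ ∑ i, ∑ j, |(C : Matrix (Fin n) (Fin n) ℝ) i j * (y i * y j)| :=
        (Finset.abs_sum_le_sum_abs _ _).trans
          (Finset.sum_le_sum fun i _ => Finset.abs_sum_le_sum_abs _ _)
    _ ≤ ∑ _i : Fin n, ∑ _j : Fin n, ‖C‖ * ‖y‖ ^ 2 :=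
        Finset.sum_le_sum fun i _ => Finset.sum_le_sum fun j _ => h i j
    _ = _ := by
        simp only [Finset.sum_const, Finset.card_univ, Fintype.card_fin, nsmul_eq_mul]
        ring

theorem quadForm_pos {C : Matrix (Fin n) (Fin n) ℝ} (hC : C.PosDef) {y : Rd n} (hy : y ≠ 0) :
    0 < quadForm C y := by
  have := hC.dotProduct_mulVec_pos (x := y.ofLp) (fun h => hy (by ext i; simp [h]))
  simpa [quadForm] using this

theorem quadForm_nonneg {C : Matrix (Fin n) (Fin n) ℝ} (hC : C.PosDef) (y : Rd n) :
    0 ≤ quadForm C y := by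
  rcases eq_or_ne y 0 with rfl | h
  · simp [quadForm]
  · exact (quadForm_pos hC h).le

theorem exists_quadForm_ge {C : Matrix (Fin n) (Fin n) ℝ} (hC : C.PosDef) :
    ∃ c > 0, ∀ y : Rd n, c * ‖y‖ ^ 2 ≤ quadForm C y := by
  by_cases hne : (Metric.sphere (0 : Rd n) 1).Nonempty
  · obtain ⟨x, hx, hmin⟩ := (isCompact_sphere (0 : Rd n) 1).exists_isMinOn hne
      (continuous_quadForm C).continuousOn
    have hx1 : ‖x‖ = 1 := by simpa using hx
    refine ⟨quadForm C x, quadForm_pos hC (by rintro rfl; simp at hx1), fun y => ?_⟩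
    rcases eq_or_ne y 0 with rfl | hy
    · simp [quadForm]
    have hy' : 0 < ‖y‖ := norm_pos_iff.2 hy
    have h := hmin (show ‖y‖⁻¹ • y ∈ Metric.sphere (0 : Rd n) 1 by
      simp [norm_smul, hy'.ne'])
    change quadForm C x ≤ quadForm C (‖y‖⁻¹ • y) at h
    rw [quadForm_smul_right] at h
    calc quadForm C x * ‖y‖ ^ 2 ≤ (‖y‖⁻¹ ^ 2 * quadForm C y) * ‖y‖ ^ 2 := by gcongr
      _ = quadForm C y := by field_simp
  -- An empty unit sphere means that the space is zero (`n = 0`), where any constant works.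
  · refine ⟨1, one_pos, fun y => ?_⟩
    have : y = 0 := by
      by_contra hy
      refine hne ⟨‖y‖⁻¹ • y, ?_⟩
      simp [norm_smul, hy]
    subst this
    simp [quadForm]

theorem posDef_of_quadForm_pos {C : SymMat n}
    (h : ∀ y : Rd n, y ≠ 0 → 0 < quadForm (C : Matrix (Fin n) (Fin n) ℝ) y) : C ∈ PosMat n := by
  refine Matrix.PosDef.of_dotProduct_mulVec_pos ?_ fun x hx => ?_
  · rw [Matrix.IsHermitian, Matrix.conjTranspose_eq_transpose_of_trivial]
    exact C.2
  · have := h (WithLp.toLp 2 x) (by simpa using hx)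
    simpa [quadForm] using this

/-- Near a positive definite matrix, the quadratic forms are uniformly bounded below. -/
theorem exists_ball_quadForm_ge {C : SymMat n} (hC : C ∈ PosMat n) :
    ∃ c > 0, ∃ r > 0, ∀ D ∈ Metric.ball C r, D ∈ PosMat n ∧
      ∀ y : Rd n, c * ‖y‖ ^ 2 ≤ quadForm (D : Matrix (Fin n) (Fin n) ℝ) y := by
  obtain ⟨c, hc, h⟩ := exists_quadForm_ge (show (C : Matrix (Fin n) (Fin n) ℝ).PosDef from hC)
  -- The radius is such that `n² ‖D - C‖ ≤ c/2`; the added 1 keeps it meaningful for `n = 0`.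
  refine ⟨c / 2, by positivity, c / (2 * (n ^ 2 + 1)), by positivity, fun D hD => ?_⟩
  have key : ∀ y : Rd n, c / 2 * ‖y‖ ^ 2 ≤ quadForm (D : Matrix (Fin n) (Fin n) ℝ) y := by
    intro y
    have h1 : quadForm (D : Matrix (Fin n) (Fin n) ℝ) y =
        quadForm (C : Matrix (Fin n) (Fin n) ℝ) y +
          quadForm ((D - C : SymMat n) : Matrix (Fin n) (Fin n) ℝ) y := by
      rw [← quadForm_add]
      congr 1
      simp
    have h2 := (abs_le.1 (abs_quadForm_le (D - C) y)).1
    have h3 : (n : ℝ) ^ 2 * ‖D - C‖ ≤ c / 2 := by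
      rw [mem_ball_iff_norm, lt_div_iff₀ (by positivity)] at hD
      nlinarith [norm_nonneg (D - C)]
    have h4 := mul_le_mul_of_nonneg_right h3 (sq_nonneg ‖y‖)
    have h5 := h y
    rw [h1]
    linarith
  refine ⟨posDef_of_quadForm_pos fun y hy => lt_of_lt_of_le ?_ (key y), key⟩
  have := norm_pos_iff.2 hy
  positivity

theorem isOpen_posMat : IsOpen (PosMat n) := by
  refine Metric.isOpen_iff.2 fun C hC => ?_
  obtain ⟨c, _, r, hr, h⟩ := exists_ball_quadForm_ge hC
  exact ⟨r, hr, fun D hD => (h D hD).1⟩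

theorem symInv_mem {C : SymMat n} (hC : C ∈ PosMat n) : symInv C ∈ PosMat n :=
  Matrix.PosDef.inv (show (C : Matrix (Fin n) (Fin n) ℝ).PosDef from hC)

theorem posMat_isUnit {C : SymMat n} (hC : C ∈ PosMat n) :
    IsUnit (C : Matrix (Fin n) (Fin n) ℝ) :=
  Matrix.PosDef.isUnit (show (C : Matrix (Fin n) (Fin n) ℝ).PosDef from hC)

theorem posMat_isUnit_det {C : SymMat n} (hC : C ∈ PosMat n) :
    IsUnit (C : Matrix (Fin n) (Fin n) ℝ).det :=
  (Matrix.isUnit_iff_isUnit_det _).1 (posMat_isUnit hC)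

theorem coe_symInv (C : SymMat n) :
    (symInv C : Matrix (Fin n) (Fin n) ℝ) = (C : Matrix (Fin n) (Fin n) ℝ)⁻¹ := rfl

theorem symInv_symInv {C : SymMat n} (hC : C ∈ PosMat n) : symInv (symInv C) = C :=
  Subtype.ext (Matrix.nonsing_inv_nonsing_inv _ (posMat_isUnit_det hC))

theorem hasFDerivAt_symInv_entry {C : SymMat n} (hC : C ∈ PosMat n) (i j : Fin n) :
    ∃ L : SymMat n →L[ℝ] ℝ, (∀ Δ : SymMat n, L Δ =
      -((C : Matrix (Fin n) (Fin n) ℝ)⁻¹ * (Δ : Matrix (Fin n) (Fin n) ℝ) *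
        (C : Matrix (Fin n) (Fin n) ℝ)⁻¹) i j) ∧
      HasFDerivAt (fun B : SymMat n => (symInv B : Matrix (Fin n) (Fin n) ℝ) i j) L C := by
  have h := hasFDerivAt_ringInverse (𝕜 := ℝ) (posMat_isUnit hC).unit
  have h2 : HasFDerivAt (fun B : SymMat n => Ring.inverse (B : Matrix (Fin n) (Fin n) ℝ)) _ C :=
    HasFDerivAt.comp C (f := (SymMat n).subtypeL) h (SymMat n).subtypeL.hasFDerivAt
  let e : Matrix (Fin n) (Fin n) ℝ →L[ℝ] ℝ :=
    LinearMap.toContinuousLinearMap (Matrix.entryLinearMap ℝ ℝ i j)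
  have h3 := e.hasFDerivAt.comp C h2
  have hfun : (fun B : SymMat n => (symInv B : Matrix (Fin n) (Fin n) ℝ) i j) =
      e ∘ fun B : SymMat n => Ring.inverse (B : Matrix (Fin n) (Fin n) ℝ) := by
    ext B
    rw [coe_symInv, Matrix.nonsing_inv_eq_ringInverse]
    rfl
  rw [hfun]
  refine ⟨_, fun Δ => ?_, h3⟩
  change -((((posMat_isUnit hC).unit⁻¹ : (Matrix (Fin n) (Fin n) ℝ)ˣ) :
    Matrix (Fin n) (Fin n) ℝ) * (Δ : Matrix (Fin n) (Fin n) ℝ) *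
    (((posMat_isUnit hC).unit⁻¹ : (Matrix (Fin n) (Fin n) ℝ)ˣ) : Matrix (Fin n) (Fin n) ℝ)) i j = _
  rw [Matrix.coe_units_inv]
  rfl

theorem analyticAt_symInv {C : SymMat n} (hC : C ∈ PosMat n) :
    AnalyticAt ℝ (symInv : SymMat n → SymMat n) C := by
  refine SymMat.analyticAt_of_entries fun i j => ?_
  have h : AnalyticAt ℝ (fun B : SymMat n => Ring.inverse (B : Matrix (Fin n) (Fin n) ℝ)) C :=
    (analyticAt_inverse (𝕜 := ℝ) (posMat_isUnit hC).unit).comp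
      (f := (SymMat n).subtypeL) ((SymMat n).subtypeL.analyticAt C)
  let e : Matrix (Fin n) (Fin n) ℝ →L[ℝ] ℝ :=
    LinearMap.toContinuousLinearMap (Matrix.entryLinearMap ℝ ℝ i j)
  have h3 := (e.analyticAt _).comp h
  convert! h3 using 1
  ext B
  rw [coe_symInv, Matrix.nonsing_inv_eq_ringInverse]
  rfl

end QuadForm

/-! ### The score equation in the algebra of bounded Lipschitz functions -/

/-- The functions `y_k y_l / (1 + |y|²)` are bounded and Lipschitz on `E`. -/
def BLRatio {E : Type*} [PseudoMetricSpace E] {n : ℕ} (y : E → Rd n) : Prop :=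
  ∀ k l, IsBL fun e => y e k * y e l / (1 + ‖y e‖ ^ 2)

namespace BLRatio

variable {E : Type*} [PseudoMetricSpace E] {n : ℕ} {y : E → Rd n}

/-- `y_k y_l / (1 + |y|²)` as an element of `BL E`. -/
def ratio (hy : BLRatio y) (k l : Fin n) : BL E := BL.mk _ (hy k l)

/-- `(ν + y' C y) / (1 + |y|²)` as an element of `BL E`. -/
def denom (hy : BLRatio y) (ν : ℝ) (C : SymMat n) : BL E :=
  ν • (1 - ∑ k, hy.ratio k k) +
    ∑ k, ∑ l, (C : Matrix (Fin n) (Fin n) ℝ) k l • hy.ratio k l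

/-- `y_k y_l / (ν + y' C y)` as an element of `BL E`. -/
def kernel (hy : BLRatio y) (ν : ℝ) (C : SymMat n) (k l : Fin n) : BL E :=
  hy.ratio k l * Ring.inverse (hy.denom ν C)

theorem toFun_ratio (hy : BLRatio y) (k l : Fin n) (e : E) :
    (hy.ratio k l).toFun e = y e k * y e l / (1 + ‖y e‖ ^ 2) := rfl

theorem ratio_comm (hy : BLRatio y) (k l : Fin n) : hy.ratio k l = hy.ratio l k :=
  BL.ext fun e => by rw [toFun_ratio, toFun_ratio, mul_comm (y e k)]

theorem kernel_comm (hy : BLRatio y) (ν : ℝ) (C : SymMat n) (k l : Fin n) :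
    hy.kernel ν C k l = hy.kernel ν C l k := by
  rw [kernel, kernel, hy.ratio_comm]

theorem toFun_linearCombination (hy : BLRatio y) (C : Matrix (Fin n) (Fin n) ℝ) (e : E) :
    (∑ k, ∑ l, C k l • hy.ratio k l).toFun e = quadForm C (y e) / (1 + ‖y e‖ ^ 2) := by
  simp only [BL.toFun_sum, BL.toFun_smul, toFun_ratio, quadForm_eq_sum, Finset.sum_div, mul_div]

/-- Because `∑ y_k² = |y|²`, the combination `1 - ∑ r_kk` equals `1 / (1 + |y|²)`. So this
reciprocal, which `BLRatio` does not list, is also available in `BL E`. -/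
theorem toFun_denom (hy : BLRatio y) (ν : ℝ) (C : SymMat n) (e : E) :
    (hy.denom ν C).toFun e =
      (ν + quadForm (C : Matrix (Fin n) (Fin n) ℝ) (y e)) / (1 + ‖y e‖ ^ 2) := by
  have h : (0 : ℝ) < 1 + ‖y e‖ ^ 2 := by positivity
  rw [denom, BL.toFun_add, toFun_linearCombination, BL.toFun_smul, BL.toFun_sub, BL.toFun_one,
    BL.toFun_sum]
  simp only [toFun_ratio]
  rw [← Finset.sum_div, sum_sq_eq_norm_sq]
  field_simp
  ring

/-- If `c |y|² ≤ y'Cy`, then the quotient is at least `min ν c`, uniformly in `y`. -/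
theorem isUnit_denom (hy : BLRatio y) {ν : ℝ} (hν : 0 < ν) {C : SymMat n} (hC : C ∈ PosMat n) :
    IsUnit (hy.denom ν C) := by
  obtain ⟨c, hc, h⟩ := exists_quadForm_ge (show (C : Matrix (Fin n) (Fin n) ℝ).PosDef from hC)
  refine BL.isUnit_of_pos_le _ (lt_min hν hc) fun e => ?_
  have h0 : (0 : ℝ) < 1 + ‖y e‖ ^ 2 := by positivity
  rw [toFun_denom, le_div_iff₀ h0]
  have h1 : min ν c * ‖y e‖ ^ 2 ≤ c * ‖y e‖ ^ 2 :=
    mul_le_mul_of_nonneg_right (min_le_right _ _) (sq_nonneg _)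
  linarith [h (y e), min_le_left ν c]

theorem toFun_kernel (hy : BLRatio y) {ν : ℝ} (hν : 0 < ν) {C : SymMat n} (hC : C ∈ PosMat n)
    (k l : Fin n) (e : E) : (hy.kernel ν C k l).toFun e =
      y e k * y e l / (ν + quadForm (C : Matrix (Fin n) (Fin n) ℝ) (y e)) := by
  have h0 : (1 : ℝ) + ‖y e‖ ^ 2 ≠ 0 := by positivity
  have h1 := quadForm_nonneg (show (C : Matrix (Fin n) (Fin n) ℝ).PosDef from hC) (y e)
  rw [kernel, BL.toFun_mul, BL.toFun_inverse (hy.isUnit_denom hν hC), toFun_denom, toFun_ratio]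
  field_simp

/-- The linear part of `denom`. -/
def denomL (hy : BLRatio y) : SymMat n →L[ℝ] BL E :=
  ∑ k, ∑ l, (SymMat.entryL k l).smulRight (hy.ratio k l)

theorem denomL_apply (hy : BLRatio y) (Δ : SymMat n) :
    hy.denomL Δ = ∑ k, ∑ l, (Δ : Matrix (Fin n) (Fin n) ℝ) k l • hy.ratio k l := by
  simp [denomL]

theorem denom_eq (hy : BLRatio y) (ν : ℝ) :
    hy.denom ν = fun C => ν • (1 - ∑ k, hy.ratio k k) + hy.denomL C := by
  ext1 C
  rw [denomL_apply, denom]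

/-- The kernel is a fixed element times the inverse of an affine function of `C`, so its analyticity
is that of inversion in the Banach algebra. -/
theorem analyticAt_kernel (hy : BLRatio y) {ν : ℝ} (hν : 0 < ν) {C : SymMat n}
    (hC : C ∈ PosMat n) (k l : Fin n) : AnalyticAt ℝ (fun B => hy.kernel ν B k l) C := by
  have h1 : AnalyticAt ℝ (hy.denom ν) C := by
    rw [denom_eq]
    exact analyticAt_const.add (hy.denomL.analyticAt C)
  have h2 : AnalyticAt ℝ (fun B => Ring.inverse (hy.denom ν B)) C :=
    AnalyticAt.comp (g := Ring.inverse) (f := hy.denom ν)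
      (analyticAt_inverse (𝕜 := ℝ) (hy.isUnit_denom hν hC).unit) h1
  exact analyticAt_const.mul h2

theorem hasFDerivAt_kernel (hy : BLRatio y) {ν : ℝ} (hν : 0 < ν) {C : SymMat n}
    (hC : C ∈ PosMat n) (k l : Fin n) : ∃ L : SymMat n →L[ℝ] BL E,
      (∀ Δ : SymMat n, L Δ = -(hy.kernel ν C k l *
        ∑ i, ∑ j, (Δ : Matrix (Fin n) (Fin n) ℝ) i j • hy.kernel ν C i j)) ∧
      HasFDerivAt (fun B => hy.kernel ν B k l) L C := by
  have hu := hy.isUnit_denom hν hC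
  have h1 : HasFDerivAt (hy.denom ν) hy.denomL C := by
    rw [denom_eq]
    exact hy.denomL.hasFDerivAt.const_add _
  have h2 := HasFDerivAt.comp C (f := hy.denom ν)
    (hasFDerivAt_ringInverse (𝕜 := ℝ) hu.unit) h1
  have h3 := h2.const_mul (hy.ratio k l)
  refine ⟨_, fun Δ => ?_, h3⟩
  have hinv : ((hu.unit⁻¹ : (BL E)ˣ) : BL E) = Ring.inverse (hy.denom ν C) := by
    rw [← Ring.inverse_unit]; rfl
  change hy.ratio k l * -(((hu.unit⁻¹ : (BL E)ˣ) : BL E) * hy.denomL Δ *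
    ((hu.unit⁻¹ : (BL E)ˣ) : BL E)) = _
  rw [hinv, denomL_apply]
  simp only [kernel]
  have : ∑ i, ∑ j, (Δ : Matrix (Fin n) (Fin n) ℝ) i j •
      (hy.ratio i j * Ring.inverse (hy.denom ν C)) =
      (∑ i, ∑ j, (Δ : Matrix (Fin n) (Fin n) ℝ) i j • hy.ratio i j) *
        Ring.inverse (hy.denom ν C) := by
    simp only [Finset.sum_mul, smul_mul_assoc]
  rw [this]
  ring

/-- The score equation as a function of the dual element and the inverse scatter matrix. -/
def scoreEq (hy : BLRatio y) (ν : ℝ) (p : StrongDual ℝ (BL E) × SymMat n) : SymMat n :=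
  -((p.1 1 / 2) • symInv p.2) + ((ν + n) / 2) •
    ⟨Matrix.of fun k l => p.1 (hy.kernel ν p.2 k l), Matrix.IsSymm.ext fun i j => by
      simp only [Matrix.of_apply, hy.kernel_comm ν p.2 i j]⟩

theorem scoreEq_apply (hy : BLRatio y) (ν : ℝ) (φ : StrongDual ℝ (BL E)) (C : SymMat n)
    (k l : Fin n) : (hy.scoreEq ν (φ, C) : Matrix (Fin n) (Fin n) ℝ) k l =
      -(φ 1 / 2 * (symInv C : Matrix (Fin n) (Fin n) ℝ) k l) +
        (ν + n) / 2 * φ (hy.kernel ν C k l) := rfl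

/-- Evaluation `(φ, f) ↦ φ f` is a continuous bilinear map, and the kernel and the matrix inverse
are analytic in `C` alone. -/
theorem analyticAt_scoreEq (hy : BLRatio y) {ν : ℝ} (hν : 0 < ν) (φ : StrongDual ℝ (BL E))
    {C : SymMat n} (hC : C ∈ PosMat n) : AnalyticAt ℝ (hy.scoreEq ν) (φ, C) := by
  refine SymMat.analyticAt_of_entries fun k l => ?_
  have e1 : AnalyticAt ℝ (fun p : StrongDual ℝ (BL E) × SymMat n => p.1 1) (φ, C) :=
    ((ContinuousLinearMap.apply ℝ ℝ (1 : BL E)).comp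
      (ContinuousLinearMap.fst ℝ (StrongDual ℝ (BL E)) (SymMat n))).analyticAt _
  have e2 : AnalyticAt ℝ (fun p : StrongDual ℝ (BL E) × SymMat n =>
      (symInv p.2 : Matrix (Fin n) (Fin n) ℝ) k l) (φ, C) :=
    ((SymMat.entryL k l).analyticAt _).comp
      (AnalyticAt.comp (g := symInv) (f := Prod.snd) (x := (φ, C)) (analyticAt_symInv hC)
        analyticAt_snd)
  have e3 : AnalyticAt ℝ (fun p : StrongDual ℝ (BL E) × SymMat n => hy.kernel ν p.2 k l) (φ, C) :=
    AnalyticAt.comp (g := fun B => hy.kernel ν B k l) (f := Prod.snd) (x := (φ, C))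
      (hy.analyticAt_kernel hν hC k l) analyticAt_snd
  have e4 : AnalyticAt ℝ (fun p : StrongDual ℝ (BL E) × SymMat n => p.1 (hy.kernel ν p.2 k l))
      (φ, C) := 
    AnalyticAt.comp (x := (φ, C))
      (g := fun q : StrongDual ℝ (BL E) × BL E => q.1 q.2)
      (f := fun p : StrongDual ℝ (BL E) × SymMat n => (p.1, hy.kernel ν p.2 k l))
      ((ContinuousLinearMap.id ℝ (StrongDual ℝ (BL E))).analyticAt_bilinear _)
      (analyticAt_fst.prod e3)
  exact ((e1.mul analyticAt_const).mul e2).neg.add (analyticAt_const.mul e4)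

theorem hasFDerivAt_scoreEq (hy : BLRatio y) {ν : ℝ} (hν : 0 < ν) (φ : StrongDual ℝ (BL E))
    {C : SymMat n} (hC : C ∈ PosMat n) : ∃ D : SymMat n →L[ℝ] SymMat n,
      (∀ Δ k l, (D Δ : Matrix (Fin n) (Fin n) ℝ) k l =
        φ 1 / 2 * ((C : Matrix (Fin n) (Fin n) ℝ)⁻¹ * (Δ : Matrix (Fin n) (Fin n) ℝ) *
          (C : Matrix (Fin n) (Fin n) ℝ)⁻¹) k l -
        (ν + n) / 2 * φ (hy.kernel ν C k l *
          ∑ i, ∑ j, (Δ : Matrix (Fin n) (Fin n) ℝ) i j • hy.kernel ν C i j)) ∧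
      HasFDerivAt (fun B => hy.scoreEq ν (φ, B)) D C := by
  have hd : HasFDerivAt (fun B => hy.scoreEq ν (φ, B)) _ C :=
    (AnalyticAt.comp (g := hy.scoreEq ν) (f := fun B : SymMat n => (φ, B)) (x := C)
      (hy.analyticAt_scoreEq hν φ hC)
      (analyticAt_const.prod analyticAt_id)).differentiableAt.hasFDerivAt
  refine ⟨_, fun Δ k l => ?_, hd⟩
  obtain ⟨L1, hL1, h1⟩ := hasFDerivAt_symInv_entry hC k l
  obtain ⟨L2, hL2, h2⟩ := hy.hasFDerivAt_kernel hν hC k l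
  have h3 := ((h1.const_mul (φ 1 / 2)).neg).add
    ((φ.hasFDerivAt.comp C h2).const_mul ((ν + n) / 2))
  have h4 := (SymMat.entryL k l).hasFDerivAt.comp C hd
  have h5 := congrArg (fun L : SymMat n →L[ℝ] ℝ => L Δ) (h4.unique h3)
  have h6 : (SymMat.entryL k l) ((fderiv ℝ (fun B => hy.scoreEq ν (φ, B)) C) Δ) =
      -(φ 1 / 2 * L1 Δ) + (ν + n) / 2 * φ (L2 Δ) := h5
  rw [hL1, hL2, map_neg] at h6
  rw [SymMat.entryL_apply] at h6
  change ((fderiv ℝ (fun B => hy.scoreEq ν (φ, B)) C) Δ : Matrix (Fin n) (Fin n) ℝ) k l = _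
  rw [h6]
  ring

end BLRatio

/-- Each ratio is the product of two functions `y_k / √(1 + |y|²)`, which are bounded by 1 and have
Lipschitz constant 2, since `√(1 + |y|²)` is at least 1 and is itself 1-Lipschitz. -/
theorem blRatio_id {n : ℕ} : BLRatio (fun y : Rd n => y) := by
  have hv : ∀ k, IsBL fun y : Rd n => y k / Real.sqrt (1 + ‖y‖ ^ 2) := by
    intro k
    have hN : ∀ y : Rd n, 0 < Real.sqrt (1 + ‖y‖ ^ 2) := fun y => Real.sqrt_pos.2 (by positivity)
    have hN2 : ∀ y : Rd n, Real.sqrt (1 + ‖y‖ ^ 2) ^ 2 = 1 + ‖y‖ ^ 2 := fun y =>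
      Real.sq_sqrt (by positivity)
    have hN1 : ∀ y : Rd n, 1 ≤ Real.sqrt (1 + ‖y‖ ^ 2) := fun y => by
      rw [Real.le_sqrt' one_pos]; nlinarith [norm_nonneg y]
    have hNn : ∀ y : Rd n, ‖y‖ ≤ Real.sqrt (1 + ‖y‖ ^ 2) := fun y =>
      Real.le_sqrt_of_sq_le (by linarith)
    have hb : ∀ y : Rd n, |y k / Real.sqrt (1 + ‖y‖ ^ 2)| ≤ 1 := fun y => by
      rw [abs_div, abs_of_pos (hN y), div_le_one (hN y)]
      exact (abs_coord_le y k).trans (hNn y)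
    refine ⟨⟨1, hb⟩, 2, fun y z => ?_⟩
    have hlip : |Real.sqrt (1 + ‖z‖ ^ 2) - Real.sqrt (1 + ‖y‖ ^ 2)| ≤ dist y z := by
      have h1 : (Real.sqrt (1 + ‖z‖ ^ 2) - Real.sqrt (1 + ‖y‖ ^ 2)) *
          (Real.sqrt (1 + ‖z‖ ^ 2) + Real.sqrt (1 + ‖y‖ ^ 2)) = (‖z‖ - ‖y‖) * (‖z‖ + ‖y‖) := by
        linear_combination hN2 z - hN2 y
      have h2 := congrArg abs h1
      rw [abs_mul, abs_mul, abs_of_pos (add_pos (hN z) (hN y)),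
        abs_of_nonneg (add_nonneg (norm_nonneg z) (norm_nonneg y))] at h2
      have h3 : |‖z‖ - ‖y‖| ≤ dist y z := by
        rw [dist_comm, dist_eq_norm]; exact abs_norm_sub_norm_le z y
      refine le_of_mul_le_mul_right ?_ (add_pos (hN z) (hN y))
      rw [h2]
      exact mul_le_mul h3 (add_le_add (hNn z) (hNn y)) (by positivity) dist_nonneg
    -- One term for the change of the numerator and one for the change of the square root; each is
    -- at most `dist y z`.
    have h1 : y k / Real.sqrt (1 + ‖y‖ ^ 2) - z k / Real.sqrt (1 + ‖z‖ ^ 2) =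
        (y k - z k) / Real.sqrt (1 + ‖y‖ ^ 2) + z k / Real.sqrt (1 + ‖z‖ ^ 2) *
          ((Real.sqrt (1 + ‖z‖ ^ 2) - Real.sqrt (1 + ‖y‖ ^ 2)) / Real.sqrt (1 + ‖y‖ ^ 2)) := by
      have := (hN y).ne'
      have := (hN z).ne'
      field_simp
      ring
    have h2 : |(y k - z k) / Real.sqrt (1 + ‖y‖ ^ 2)| ≤ dist y z := by
      rw [abs_div, abs_of_pos (hN y)]
      refine (div_le_self (abs_nonneg _) (hN1 y)).trans ?_
      rw [dist_eq_norm]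
      exact abs_coord_le (y - z) k
    have h3 : |(Real.sqrt (1 + ‖z‖ ^ 2) - Real.sqrt (1 + ‖y‖ ^ 2)) / Real.sqrt (1 + ‖y‖ ^ 2)| ≤
        dist y z := by
      rw [abs_div, abs_of_pos (hN y)]
      exact (div_le_self (abs_nonneg _) (hN1 y)).trans hlip
    rw [h1]
    refine (abs_add_le _ _).trans ?_
    rw [abs_mul]
    have h4 := mul_le_mul (hb z) h3 (abs_nonneg _) zero_le_one
    linarith
  intro k l
  convert! (hv k).mul (hv l) using 1
  ext y
  rw [div_mul_div_comm, Real.mul_self_sqrt (by positivity)]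

theorem score_apply_eq {d : ℕ} {ν : ℝ} (hν : 0 < ν) {A : SymMat d} (hA : A ∈ PosMat d)
    (y : Rd d) (i j : Fin d) : score ν y A i j =
      -(1 / 2 * (A : Matrix (Fin d) (Fin d) ℝ) i j) +
        (ν + d) / 2 * ((blRatio_id (n := d)).kernel ν (symInv A) i j).toFun y := by
  have h1 := quadForm_nonneg (show (A : Matrix (Fin d) (Fin d) ℝ)⁻¹.PosDef from symInv_mem hA) y
  rw [BLRatio.toFun_kernel _ hν (symInv_mem hA), coe_symInv]
  simp only [score, Matrix.add_apply, Matrix.neg_apply, Matrix.smul_apply, smul_eq_mul,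
    Matrix.vecMulVec_apply]
  have : ν + quadForm (A : Matrix (Fin d) (Fin d) ℝ)⁻¹ y ≠ 0 := by positivity
  field_simp

theorem score_eq_toFun {d : ℕ} {ν : ℝ} (hν : 0 < ν) {A : SymMat d} (hA : A ∈ PosMat d)
    (i j : Fin d) : (fun y => score ν y A i j) =
      ((-(1 / 2 * (A : Matrix (Fin d) (Fin d) ℝ) i j)) • (1 : BL (Rd d)) +
        ((ν + d) / 2) • (blRatio_id (n := d)).kernel ν (symInv A) i j).toFun := by
  ext y
  rw [score_apply_eq hν hA, BL.toFun_add, BL.toFun_smul, BL.toFun_smul, BL.toFun_one, mul_one]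

theorem isBL_score {d : ℕ} {ν : ℝ} (hν : 0 < ν) {A : SymMat d} (hA : A ∈ PosMat d)
    (i j : Fin d) : IsBL fun y : Rd d => score ν y A i j := by
  rw [score_eq_toFun hν hA]
  exact BL.isBL _

/-- The constant part `-A/2` of the score is paired with `φ` and becomes `-φ(1) A/2`. This is why
`scoreEq` carries the factor `φ 1`, which equals 1 on laws but not on all of the dual. -/
theorem scoreMap_eq_scoreEq {d : ℕ} {ν : ℝ} (hν : 0 < ν) (φ : BLDual d) {A : SymMat d}
    (hA : A ∈ PosMat d) : scoreMap ν (φ, A) = blRatio_id.scoreEq ν (φ, symInv A) := by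
  refine SymMat.ext_entries fun i j => ?_
  rw [BLRatio.scoreEq_apply, symInv_symInv hA]
  change evalBL φ (fun y => score ν y A i j) = _
  rw [evalBL, dif_pos (isBL_score hν hA i j)]
  have : BL.mk _ (isBL_score hν hA i j) =
      (-(1 / 2 * (A : Matrix (Fin d) (Fin d) ℝ) i j)) • (1 : BL (Rd d)) +
        ((ν + d) / 2) • (blRatio_id (n := d)).kernel ν (symInv A) i j :=
    BL.ext fun y => congrFun (score_eq_toFun hν hA i j) y
  rw [this, map_add, map_smul, map_smul]
  simp only [smul_eq_mul]
  ring

theorem analyticOnNhd_scoreMap {d : ℕ} {ν : ℝ} (hν : 0 < ν) :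
    AnalyticOnNhd ℝ (scoreMap (d := d) ν) (Set.univ ×ˢ PosMat d) := by
  rintro ⟨φ, A⟩ ⟨-, hA⟩
  have h1 : AnalyticAt ℝ (fun p : BLDual d × SymMat d => (p.1, symInv p.2)) (φ, A) :=
    analyticAt_fst.prod (AnalyticAt.comp (g := symInv) (f := Prod.snd) (x := (φ, A))
      (analyticAt_symInv hA) analyticAt_snd)
  have h2 := AnalyticAt.comp (g := blRatio_id.scoreEq ν) (x := (φ, A))
    (f := fun p : BLDual d × SymMat d => (p.1, symInv p.2))
    (blRatio_id.analyticAt_scoreEq hν φ (symInv_mem hA)) h1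
  refine h2.congr ?_
  filter_upwards [(isOpen_univ.prod isOpen_posMat).mem_nhds
    (show (φ, A) ∈ Set.univ ×ˢ PosMat d from ⟨trivial, hA⟩)] with p hp
  exact (scoreMap_eq_scoreEq hν p.1 hp.2).symm

/-! ### The gradient of the objective function -/

section LogDet

variable {n : ℕ}

theorem differentiable_det :
    Differentiable ℝ fun B : SymMat n => (B : Matrix (Fin n) (Fin n) ℝ).det := by
  simp only [Matrix.det_apply]
  refine Differentiable.fun_sum fun σ _ => ?_
  simp only [Units.smul_def, zsmul_eq_mul]
  refine Differentiable.const_mul ?_ _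
  have h : ContDiff ℝ 1 fun B : SymMat n => ∏ i, (B : Matrix (Fin n) (Fin n) ℝ) (σ i) i :=
    contDiff_prod fun i _ => (SymMat.entryL (σ i) i).contDiff
  exact h.differentiable one_ne_zero

/-- The determinant of `1 + t M` is a polynomial in `t` whose linear coefficient is the trace. -/
theorem hasDerivAt_det_one_add_smul (M : Matrix (Fin n) (Fin n) ℝ) :
    HasDerivAt (fun t : ℝ => (1 + t • M).det) M.trace 0 := by
  have h := (Matrix.det (1 + (Polynomial.X : Polynomial ℝ) • M.map Polynomial.C)).hasDerivAt 0
  rw [Matrix.derivative_det_one_add_X_smul] at h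
  convert! h using 1
  ext t
  rw [← Polynomial.coe_evalRingHom, RingHom.map_det]
  congr 1
  ext i j
  rw [RingHom.mapMatrix_apply, Matrix.map_apply]
  simp only [Matrix.add_apply, Matrix.smul_apply, Matrix.map_apply, smul_eq_mul, map_add, map_mul,
    Polynomial.coe_evalRingHom, Polynomial.eval_X, Polynomial.eval_C]
  congr 1
  simp only [Matrix.one_apply]
  split_ifs <;> simp

theorem hasFDerivAt_log_det {C : SymMat n} (hC : C ∈ PosMat n) : ∃ L : SymMat n →L[ℝ] ℝ,
    (∀ Δ : SymMat n, L Δ = ((C : Matrix (Fin n) (Fin n) ℝ)⁻¹ *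
      (Δ : Matrix (Fin n) (Fin n) ℝ)).trace) ∧
    HasFDerivAt (fun B : SymMat n => Real.log (B : Matrix (Fin n) (Fin n) ℝ).det) L C := by
  have hpos : 0 < (C : Matrix (Fin n) (Fin n) ℝ).det :=
    Matrix.PosDef.det_pos (show (C : Matrix (Fin n) (Fin n) ℝ).PosDef from hC)
  have hd := (differentiable_det (n := n) C).hasFDerivAt
  refine ⟨_, fun Δ => ?_, hd.log hpos.ne'⟩
  have hline : HasDerivAt (fun t : ℝ => C + t • Δ) Δ 0 := by
    have := ((hasDerivAt_id (0 : ℝ)).smul_const Δ).const_add C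
    rwa [one_smul] at this
  have h1 : HasDerivAt (fun t : ℝ => ((C + t • Δ : SymMat n) : Matrix (Fin n) (Fin n) ℝ).det)
      (fderiv ℝ (fun B : SymMat n => (B : Matrix (Fin n) (Fin n) ℝ).det) C Δ) 0 := by
    have hd' : HasFDerivAt (fun B : SymMat n => (B : Matrix (Fin n) (Fin n) ℝ).det)
        (fderiv ℝ (fun B : SymMat n => (B : Matrix (Fin n) (Fin n) ℝ).det) C)
        (C + (0 : ℝ) • Δ) := by simpa using hd
    exact hd'.comp_hasDerivAt 0 hline
  have h2 := (hasDerivAt_det_one_add_smul ((C : Matrix (Fin n) (Fin n) ℝ)⁻¹ *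
    (Δ : Matrix (Fin n) (Fin n) ℝ))).const_mul (C : Matrix (Fin n) (Fin n) ℝ).det
  -- Factoring out `C` reduces the derivative at `C` to the derivative at the identity in the
  -- direction `C⁻¹Δ`.
  have h3 : (fun t : ℝ => ((C + t • Δ : SymMat n) : Matrix (Fin n) (Fin n) ℝ).det) =
      fun t : ℝ => (C : Matrix (Fin n) (Fin n) ℝ).det * (1 + t •
        ((C : Matrix (Fin n) (Fin n) ℝ)⁻¹ * (Δ : Matrix (Fin n) (Fin n) ℝ))).det := by
    ext t
    rw [← Matrix.det_mul, Matrix.mul_add, Matrix.mul_one, Matrix.mul_smul,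
      Matrix.mul_nonsing_inv_cancel_left _ _ (posMat_isUnit_det hC)]
    rfl
  rw [h3] at h1
  have h4 := h1.unique h2
  change ((C : Matrix (Fin n) (Fin n) ℝ).det)⁻¹ * fderiv ℝ _ C Δ = _
  rw [h4, inv_mul_cancel_left₀ hpos.ne']

theorem trace_mul_eq_sum (M : Matrix (Fin n) (Fin n) ℝ) (Δ : SymMat n) :
    (M * (Δ : Matrix (Fin n) (Fin n) ℝ)).trace =
      ∑ k, ∑ l, (Δ : Matrix (Fin n) (Fin n) ℝ) k l * M k l := by
  simp only [Matrix.trace, Matrix.diag, Matrix.mul_apply]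
  exact Finset.sum_congr rfl fun i _ => Finset.sum_congr rfl fun j _ => by
    rw [SymMat.apply_comm Δ j i, mul_comm]

/-- The functional `Δ ↦ y' Δ y`. -/
def quadL (y : Rd n) : SymMat n →L[ℝ] ℝ := ∑ i, ∑ j, (y i * y j) • SymMat.entryL i j

theorem quadL_apply (y : Rd n) (Δ : SymMat n) :
    quadL y Δ = quadForm (Δ : Matrix (Fin n) (Fin n) ℝ) y := by
  rw [quadForm_eq_sum]
  simp only [quadL, sum_apply, smul_apply, SymMat.entryL_apply, smul_eq_mul, mul_comm]

/-- `log ((ν + y' C y) / (ν + |y|²))`. -/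
def logRatio (ν : ℝ) (C : SymMat n) (y : Rd n) : ℝ :=
  Real.log (ν + quadForm (C : Matrix (Fin n) (Fin n) ℝ) y) - Real.log (ν + ‖y‖ ^ 2)

theorem scatterH_symInv {ν : ℝ} (hν : 0 < ν) {C : SymMat n} (hC : C ∈ PosMat n) (y : Rd n) :
    scatterH ν y (symInv C) = -(1 / 2) * Real.log (C : Matrix (Fin n) (Fin n) ℝ).det +
      (ν + n) / 2 * logRatio ν C y := by
  have h1 := quadForm_nonneg (show (C : Matrix (Fin n) (Fin n) ℝ).PosDef from hC) y
  have hlog : ∀ q : ℝ, 0 ≤ q → Real.log (1 + ν⁻¹ * q) = Real.log (ν + q) - Real.log ν := by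
    intro q hq
    rw [← Real.log_div (by positivity) hν.ne']
    congr 1
    field_simp
  have h2 : ((C : Matrix (Fin n) (Fin n) ℝ)⁻¹)⁻¹ = C :=
    Matrix.nonsing_inv_nonsing_inv _ (posMat_isUnit_det hC)
  rw [scatterH, tLoss, tLoss, coe_symInv, h2, inv_one, quadForm_one, hlog _ h1,
    hlog _ (sq_nonneg _), Matrix.det_nonsing_inv, Ring.inverse_eq_inv', Real.log_inv,
    Matrix.det_one, Real.log_one, logRatio]
  ring

theorem hasFDerivAt_logRatio {ν : ℝ} (hν : 0 < ν) {C : SymMat n} (hC : C ∈ PosMat n) (y : Rd n) :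
    HasFDerivAt (fun B => logRatio ν B y)
      ((ν + quadForm (C : Matrix (Fin n) (Fin n) ℝ) y)⁻¹ • quadL y) C := by
  have h1 := quadForm_nonneg (show (C : Matrix (Fin n) (Fin n) ℝ).PosDef from hC) y
  have h2 : HasFDerivAt (fun B : SymMat n => ν + quadForm (B : Matrix (Fin n) (Fin n) ℝ) y)
      (quadL y) C := by
    simp only [← quadL_apply]
    exact (quadL y).hasFDerivAt.const_add ν
  exact (h2.log (by positivity)).sub_const _

theorem hasFDerivAt_scatterH {ν : ℝ} (hν : 0 < ν) {C : SymMat n} (hC : C ∈ PosMat n)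
    (y : Rd n) : ∃ L : SymMat n →L[ℝ] ℝ,
      (∀ Δ : SymMat n, L Δ = (score ν y (symInv C) * (Δ : Matrix (Fin n) (Fin n) ℝ)).trace) ∧
      HasFDerivAt (fun B : SymMat n => scatterH ν y (symInv B)) L C := by
  have h1 := quadForm_nonneg (show (C : Matrix (Fin n) (Fin n) ℝ).PosDef from hC) y
  obtain ⟨L1, hL1, hd1⟩ := hasFDerivAt_log_det hC
  have hd := (hd1.const_mul (-(1 / 2) : ℝ)).add
    ((hasFDerivAt_logRatio hν hC y).const_mul ((ν + n) / 2))
  refine ⟨_, fun Δ => ?_, hd.congr_of_eventuallyEq ?_⟩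
  · have h2 : ((C : Matrix (Fin n) (Fin n) ℝ)⁻¹)⁻¹ = C :=
      Matrix.nonsing_inv_nonsing_inv _ (posMat_isUnit_det hC)
    have h3 : (Matrix.vecMulVec y.ofLp y.ofLp * (Δ : Matrix (Fin n) (Fin n) ℝ)).trace =
        quadForm (Δ : Matrix (Fin n) (Fin n) ℝ) y := by
      rw [trace_mul_eq_sum, quadForm_eq_sum]
      simp only [Matrix.vecMulVec_apply]
    rw [score, coe_symInv, h2, add_mul, neg_mul, smul_mul_assoc, smul_mul_assoc, Matrix.trace_add,
      Matrix.trace_neg, Matrix.trace_smul, Matrix.trace_smul, h3, ← hL1]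
    simp only [add_apply, smul_apply, smul_eq_mul]
    have : ν + quadForm (C : Matrix (Fin n) (Fin n) ℝ) y ≠ 0 := by positivity
    rw [quadL_apply]
    field_simp
  · filter_upwards [isOpen_posMat.mem_nhds hC] with B hB
    exact scatterH_symInv hν hB y

end LogDet

/-! ### Differentiation of logarithmic integrals under the integral sign -/

section IntegralLog

variable {V Ω ι : Type*} [NormedAddCommGroup V] [NormedSpace ℝ V] [MeasurableSpace Ω] [Fintype ι]

/-- Differentiation of `x ↦ ∫ (log (ν + q_ω x) - c ω) dμ` for linear functionals `q_ω`. -/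
theorem hasFDerivAt_integral_log (μ : Measure Ω) [IsFiniteMeasure μ] {ν : ℝ} (e : ι → V →L[ℝ] ℝ)
    (a : ι → Ω → ℝ) (ha : ∀ i, Measurable (a i)) (c : Ω → ℝ) (hc : Measurable c) {x₀ : V} {r M : ℝ}
    (hr : 0 < r) (hM : 0 ≤ M)
    (hpos : ∀ x ∈ Metric.ball x₀ r, ∀ ω, 0 < ν + ∑ i, a i ω * e i x)
    (hbd : ∀ x ∈ Metric.ball x₀ r, ∀ ω Δ,
      |∑ i, a i ω * e i Δ| ≤ M * (ν + ∑ i, a i ω * e i x) * ‖Δ‖)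
    (hInt : Integrable (fun ω => Real.log (ν + ∑ i, a i ω * e i x₀) - c ω) μ) :
    ∃ L : V →L[ℝ] ℝ, (∀ Δ, L Δ = ∫ ω, (∑ i, a i ω * e i Δ) / (ν + ∑ i, a i ω * e i x₀) ∂μ) ∧
      HasFDerivAt (fun x => ∫ ω, (Real.log (ν + ∑ i, a i ω * e i x) - c ω) ∂μ) L x₀ := by
  have hq : ∀ x, Measurable fun ω => ν + ∑ i, a i ω * e i x := fun x =>
    measurable_const.add (Finset.measurable_fun_sum _ fun i _ => (ha i).mul_const _)
  have happ : ∀ ω Δ, (∑ i, a i ω • e i) Δ = ∑ i, a i ω * e i Δ := fun ω Δ => by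
    simp only [sum_apply, smul_apply, smul_eq_mul]
  have hmeas : AEStronglyMeasurable
      (fun ω => (ν + ∑ i, a i ω * e i x₀)⁻¹ • ∑ i, a i ω • e i) μ := by
    refine ((hq x₀).inv.aestronglyMeasurable).smul ?_
    exact Finset.aestronglyMeasurable_fun_sum _ fun i _ =>
      (ha i).aestronglyMeasurable.smul aestronglyMeasurable_const
  -- The derivative of the logarithm is `q_ω / (ν + q_ω x)`, and `hbd` says precisely that its
  -- operator norm is at most `M` on the whole ball, so a constant dominates.
  have hbound : ∀ ω, ∀ x ∈ Metric.ball x₀ r,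
      ‖(ν + ∑ i, a i ω * e i x)⁻¹ • ∑ i, a i ω • e i‖ ≤ M := by
    intro ω x hx
    have h2 := hpos x hx ω
    rw [norm_smul, norm_inv, Real.norm_of_nonneg h2.le, ← div_eq_inv_mul, div_le_iff₀ h2]
    refine ContinuousLinearMap.opNorm_le_bound _ (by positivity) fun Δ => ?_
    rw [happ]
    exact hbd x hx ω Δ
  have hI : Integrable (fun ω => (ν + ∑ i, a i ω * e i x₀)⁻¹ • ∑ i, a i ω • e i) μ :=
    Integrable.of_bound hmeas M
      (Filter.Eventually.of_forall fun ω => hbound ω x₀ (Metric.mem_ball_self hr))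
  have hd := hasFDerivAt_integral_of_dominated_of_fderiv_le (μ := μ) (bound := fun _ => M)
    (s := Metric.ball x₀ r) (F := fun x ω => Real.log (ν + ∑ i, a i ω * e i x) - c ω)
    (F' := fun x ω => (ν + ∑ i, a i ω * e i x)⁻¹ • ∑ i, a i ω • e i) (x₀ := x₀)
    (Metric.ball_mem_nhds x₀ hr)
    (Filter.Eventually.of_forall fun x => ((hq x).log.sub hc).aestronglyMeasurable)
    hInt hmeas (Filter.Eventually.of_forall hbound) (integrable_const _)
    (Filter.Eventually.of_forall fun ω x hx => by
      have h1 : HasFDerivAt (fun x => ν + ∑ i, a i ω * e i x) (∑ i, a i ω • e i) x := by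
        simp only [← happ]
        exact (∑ i, a i ω • e i).hasFDerivAt.const_add ν
      exact (h1.log (hpos x hx ω).ne').sub_const _)
  refine ⟨_, fun Δ => ?_, hd⟩
  rw [ContinuousLinearMap.integral_apply hI]
  refine integral_congr_ae (Filter.Eventually.of_forall fun ω => ?_)
  simp only [smul_apply, happ, smul_eq_mul, div_eq_inv_mul]

end IntegralLog

/-! ### The objective function of a law and its critical points -/

section Objective

variable {n : ℕ}

theorem continuous_logRatio {ν : ℝ} (hν : 0 < ν) {C : SymMat n} (hC : C ∈ PosMat n) :
    Continuous (logRatio ν C) := by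
  have h0 : ∀ y, ν + quadForm (C : Matrix (Fin n) (Fin n) ℝ) y ≠ 0 := fun y => by
    have := quadForm_nonneg (show (C : Matrix (Fin n) (Fin n) ℝ).PosDef from hC) y
    positivity
  have h1 : ∀ y : Rd n, ν + ‖y‖ ^ 2 ≠ 0 := fun y => by positivity
  exact ((continuous_const.add (continuous_quadForm _)).log h0).sub
    ((continuous_const.add (continuous_norm.pow 2)).log h1)

/-- The ratio `(ν + y'Cy) / (ν + |y|²)` lies between two positive constants. This is why `L_ν(y, I)`
is subtracted: the integrals exist for every law, without a moment condition. -/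
theorem exists_abs_logRatio_le {ν : ℝ} (hν : 0 < ν) {C : SymMat n} (hC : C ∈ PosMat n) :
    ∃ M, ∀ y, |logRatio ν C y| ≤ M := by
  obtain ⟨c, hc, h⟩ := exists_quadForm_ge (show (C : Matrix (Fin n) (Fin n) ℝ).PosDef from hC)
  set K := n ^ 2 * ‖C‖ with hK
  have hK0 : 0 ≤ K := by positivity
  refine ⟨|Real.log (min 1 c)| + |Real.log (1 + K)|, fun y => ?_⟩
  have hm : 0 < min 1 c := lt_min one_pos hc
  have hden : 0 < ν + ‖y‖ ^ 2 := by positivity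
  have h1 := (abs_le.1 (abs_quadForm_le C y)).2
  have hlow : min 1 c * (ν + ‖y‖ ^ 2) ≤ ν + quadForm (C : Matrix (Fin n) (Fin n) ℝ) y := by
    have e1 := mul_le_mul_of_nonneg_right (min_le_left 1 c) hν.le
    have e2 := mul_le_mul_of_nonneg_right (min_le_right 1 c) (sq_nonneg ‖y‖)
    linarith [h y]
  have hup : ν + quadForm (C : Matrix (Fin n) (Fin n) ℝ) y ≤ (1 + K) * (ν + ‖y‖ ^ 2) := by
    nlinarith [sq_nonneg ‖y‖]
  have hnum : 0 < ν + quadForm (C : Matrix (Fin n) (Fin n) ℝ) y :=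
    lt_of_lt_of_le (by positivity) hlow
  have l1 := Real.log_le_log (by positivity) hlow
  have l2 := Real.log_le_log hnum hup
  rw [Real.log_mul hm.ne' hden.ne'] at l1
  rw [Real.log_mul (by positivity) hden.ne'] at l2
  rw [logRatio, abs_le]
  constructor
  · linarith [neg_abs_le (Real.log (min 1 c)), abs_nonneg (Real.log (1 + K))]
  · linarith [le_abs_self (Real.log (1 + K)), abs_nonneg (Real.log (min 1 c))]

theorem integrable_logRatio {ν : ℝ} (hν : 0 < ν) (Q : Law n) {C : SymMat n} (hC : C ∈ PosMat n) :
    Integrable (logRatio ν C) (Q : Measure (Rd n)) := by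
  obtain ⟨M, hM⟩ := exists_abs_logRatio_le hν hC
  exact Integrable.of_bound (continuous_logRatio hν hC).measurable.aestronglyMeasurable M
    (Filter.Eventually.of_forall hM)

theorem integrable_scatterH {ν : ℝ} (hν : 0 < ν) (Q : Law n) {A : SymMat n} (hA : A ∈ PosMat n) :
    Integrable (fun y => scatterH ν y A) (Q : Measure (Rd n)) := by
  have h : (fun y => scatterH ν y A) = fun y =>
      -(1 / 2) * Real.log (symInv A : Matrix (Fin n) (Fin n) ℝ).det +
      (ν + n) / 2 * logRatio ν (symInv A) y := by
    ext y
    rw [← scatterH_symInv hν (symInv_mem hA), symInv_symInv hA]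
  rw [h]
  exact (integrable_const _).add ((integrable_logRatio hν Q (symInv_mem hA)).const_mul _)

theorem scatterObj_symInv {ν : ℝ} (hν : 0 < ν) (Q : Law n) {C : SymMat n} (hC : C ∈ PosMat n) :
    scatterObj ν Q (symInv C) = -(1 / 2) * Real.log (C : Matrix (Fin n) (Fin n) ℝ).det +
      (ν + n) / 2 * ∫ y, logRatio ν C y ∂(Q : Measure (Rd n)) := by
  simp only [scatterObj, scatterH_symInv hν hC]
  rw [integral_add (integrable_const _) ((integrable_logRatio hν Q hC).const_mul _),
    integral_const]
  simp only [probReal_univ, one_smul]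
  rw [integral_const_mul]

/-- On a ball where `c |y|² ≤ y'By`, one has `|y'Δy| ≤ n² ‖Δ‖ |y|² ≤ (n²/c) ‖Δ‖ (ν + y'By)`, so a
constant dominates the derivatives. -/
theorem hasFDerivAt_integral_logRatio {ν : ℝ} (hν : 0 < ν) (Q : Law n) {C : SymMat n}
    (hC : C ∈ PosMat n) : ∃ L : SymMat n →L[ℝ] ℝ,
    (∀ Δ : SymMat n, L Δ = ∫ y, quadForm (Δ : Matrix (Fin n) (Fin n) ℝ) y /
      (ν + quadForm (C : Matrix (Fin n) (Fin n) ℝ) y) ∂(Q : Measure (Rd n))) ∧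
    HasFDerivAt (fun B => ∫ y, logRatio ν B y ∂(Q : Measure (Rd n))) L C := by
  obtain ⟨c, hc, r, hr, h⟩ := exists_ball_quadForm_ge hC
  have hquad : ∀ (B : SymMat n) (y : Rd n), ∑ p : Fin n × Fin n,
      y p.1 * y p.2 * SymMat.entryL p.1 p.2 B = quadForm (B : Matrix (Fin n) (Fin n) ℝ) y := by
    intro B y
    rw [quadForm_eq_sum, Fintype.sum_prod_type]
    simp only [SymMat.entryL_apply, mul_comm]
  have hpos : ∀ B ∈ Metric.ball C r, ∀ y : Rd n,
      c * ‖y‖ ^ 2 < ν + quadForm (B : Matrix (Fin n) (Fin n) ℝ) y := fun B hB y => by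
    have := (h B hB).2 y
    linarith
  have hbd : ∀ B ∈ Metric.ball C r, ∀ (y : Rd n) (Δ : SymMat n),
      |quadForm (Δ : Matrix (Fin n) (Fin n) ℝ) y| ≤
        n ^ 2 / c * (ν + quadForm (B : Matrix (Fin n) (Fin n) ℝ) y) * ‖Δ‖ := by
    intro B hB y Δ
    generalize hN : ‖Δ‖ = N
    have h1 := abs_quadForm_le Δ y
    have h2 : (0 : ℝ) ≤ N := hN ▸ norm_nonneg Δ
    rw [hN] at h1
    refine h1.trans ?_
    have h3 : (n : ℝ) ^ 2 * N * ‖y‖ ^ 2 = n ^ 2 / c * (c * ‖y‖ ^ 2) * N := by field_simp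
    rw [h3]
    exact mul_le_mul_of_nonneg_right
      (mul_le_mul_of_nonneg_left (hpos B hB y).le (by positivity)) h2
  have key := hasFDerivAt_integral_log (Q : Measure (Rd n)) (ν := ν)
    (fun p : Fin n × Fin n => SymMat.entryL p.1 p.2) (fun p y => y p.1 * y p.2)
    (fun p => (by fun_prop : Continuous fun y : Rd n => y p.1 * y p.2).measurable)
    (fun y => Real.log (ν + ‖y‖ ^ 2)) (by fun_prop) (x₀ := C) (M := n ^ 2 / c) hr (by positivity)
    (fun B hB y => by rw [hquad]; exact lt_of_le_of_lt (by positivity) (hpos B hB y))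
    (fun B hB y Δ => by rw [hquad, hquad]; exact hbd B hB y Δ)
    (by simp only [hquad]; exact integrable_logRatio hν Q hC)
  simp only [hquad] at key
  exact key

theorem lawToDual_apply (Q : Law n) (f : BL (Rd n)) :
    lawToDual Q f = ∫ y, f.toFun y ∂(Q : Measure (Rd n)) := rfl

theorem lawToDual_one (Q : Law n) : lawToDual Q 1 = 1 := by
  rw [lawToDual_apply]
  simp [BL.toFun_one]

theorem lawToDual_kernel {ν : ℝ} (hν : 0 < ν) (Q : Law n) {C : SymMat n} (hC : C ∈ PosMat n)
    (k l : Fin n) : lawToDual Q (blRatio_id.kernel ν C k l) =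
      ∫ y : Rd n, y k * y l / (ν + quadForm (C : Matrix (Fin n) (Fin n) ℝ) y)
        ∂(Q : Measure (Rd n)) := by
  rw [lawToDual_apply]
  simp only [blRatio_id.toFun_kernel hν hC]

theorem integrable_kernel {ν : ℝ} (hν : 0 < ν) (Q : Law n) {C : SymMat n} (hC : C ∈ PosMat n)
    (k l : Fin n) : Integrable (fun y : Rd n => y k * y l /
      (ν + quadForm (C : Matrix (Fin n) (Fin n) ℝ) y)) (Q : Measure (Rd n)) := by
  have := (blRatio_id.kernel ν C k l).integrable (Q : Measure (Rd n))
  rwa [show (blRatio_id.kernel ν C k l).toFun = _ from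
    funext fun y => blRatio_id.toFun_kernel hν hC k l y] at this

theorem quadForm_div_eq_sum (Δ : Matrix (Fin n) (Fin n) ℝ) (y : Rd n) (a : ℝ) :
    quadForm Δ y / a = ∑ k, ∑ l, Δ k l * (y k * y l / a) := by
  simp only [quadForm_eq_sum, Finset.sum_div, mul_div_assoc]

theorem integrable_quadForm_div {ν : ℝ} (hν : 0 < ν) (Q : Law n) {C : SymMat n}
    (hC : C ∈ PosMat n) (Δ : Matrix (Fin n) (Fin n) ℝ) :
    Integrable (fun y : Rd n => quadForm Δ y /
      (ν + quadForm (C : Matrix (Fin n) (Fin n) ℝ) y)) (Q : Measure (Rd n)) := by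
  simp only [quadForm_div_eq_sum]
  exact integrable_finsetSum _ fun k _ => integrable_finsetSum _ fun l _ =>
    (integrable_kernel hν Q hC k l).const_mul _

theorem integral_quadForm_div {ν : ℝ} (hν : 0 < ν) (Q : Law n) {C : SymMat n} (hC : C ∈ PosMat n)
    (Δ : Matrix (Fin n) (Fin n) ℝ) :
    ∫ y : Rd n, quadForm Δ y / (ν + quadForm (C : Matrix (Fin n) (Fin n) ℝ) y)
        ∂(Q : Measure (Rd n)) =
      ∑ k, ∑ l, Δ k l * lawToDual Q (blRatio_id.kernel ν C k l) := by
  simp only [quadForm_div_eq_sum, lawToDual_kernel hν Q hC]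
  rw [integral_finsetSum _ fun k _ => integrable_finsetSum _ fun l _ =>
    (integrable_kernel hν Q hC k l).const_mul (Δ k l)]
  refine Finset.sum_congr rfl fun k _ => ?_
  rw [integral_finsetSum _ fun l _ => (integrable_kernel hν Q hC k l).const_mul (Δ k l)]
  simp only [integral_const_mul]

theorem hasFDerivAt_scatterObj_symInv {ν : ℝ} (hν : 0 < ν) (Q : Law n) {C : SymMat n}
    (hC : C ∈ PosMat n) : ∃ L : SymMat n →L[ℝ] ℝ,
      (∀ Δ : SymMat n, L Δ = ∑ k, ∑ l, (Δ : Matrix (Fin n) (Fin n) ℝ) k l *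
        (blRatio_id.scoreEq ν (lawToDual Q, C) : Matrix (Fin n) (Fin n) ℝ) k l) ∧
      HasFDerivAt (fun B => scatterObj ν Q (symInv B)) L C := by
  obtain ⟨L1, hL1, hd1⟩ := hasFDerivAt_log_det hC
  obtain ⟨L2, hL2, hd2⟩ := hasFDerivAt_integral_logRatio hν Q hC
  have hd := (hd1.const_mul (-(1 / 2) : ℝ)).add (hd2.const_mul ((ν + n) / 2))
  refine ⟨_, fun Δ => ?_, hd.congr_of_eventuallyEq ?_⟩
  · simp only [add_apply, smul_apply, smul_eq_mul]
    rw [hL1, hL2, trace_mul_eq_sum]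
    rw [integral_quadForm_div hν Q hC]
    simp only [BLRatio.scoreEq_apply, lawToDual_one, coe_symInv, Finset.mul_sum,
      ← Finset.sum_add_distrib]
    exact Finset.sum_congr rfl fun k _ => Finset.sum_congr rfl fun l _ => by ring
  · filter_upwards [isOpen_posMat.mem_nhds hC] with B hB
    exact scatterObj_symInv hν Q hB

/-- Inversion is differentiable and involutive on `𝒫_n`, so the chain rule carries a vanishing
derivative between the variables `A` and `C = A⁻¹` in both directions. -/
theorem critical_iff {ν : ℝ} (hν : 0 < ν) (Q : Law n) {A : SymMat n} (hA : A ∈ PosMat n) :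
    HasFDerivAt (scatterObj ν Q) (0 : SymMat n →L[ℝ] ℝ) A ↔
      blRatio_id.scoreEq ν (lawToDual Q, symInv A) = 0 := by
  obtain ⟨L, hL, hd⟩ := hasFDerivAt_scatterObj_symInv hν Q (symInv_mem hA)
  constructor
  · intro h
    have h0 : HasFDerivAt (scatterObj ν Q) (0 : SymMat n →L[ℝ] ℝ) (symInv (symInv A)) := by
      rwa [symInv_symInv hA]
    have h1 := h0.comp _ (analyticAt_symInv (symInv_mem hA)).differentiableAt.hasFDerivAt
    have h2 : L = 0 := by
      rw [hd.unique h1, ContinuousLinearMap.zero_comp]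
    -- Testing the zero derivative on the gradient itself gives a vanishing sum of squares of its
    -- entries.
    have h3 := hL (blRatio_id.scoreEq ν (lawToDual Q, symInv A))
    rw [h2, zero_apply] at h3
    refine SymMat.ext_entries fun k l => ?_
    have h4 := (Finset.sum_eq_zero_iff_of_nonneg fun k _ => Finset.sum_nonneg fun l _ =>
      mul_self_nonneg _).1 h3.symm k (Finset.mem_univ k)
    exact mul_self_eq_zero.1 ((Finset.sum_eq_zero_iff_of_nonneg fun l _ =>
      mul_self_nonneg _).1 h4 l (Finset.mem_univ l))
  · intro h
    have hL0 : L = 0 := by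
      ext Δ
      rw [hL, h]
      simp
    rw [hL0] at hd
    have h1 := hd.comp _ (analyticAt_symInv hA).differentiableAt.hasFDerivAt
    rw [ContinuousLinearMap.zero_comp] at h1
    refine h1.congr_of_eventuallyEq ?_
    filter_upwards [isOpen_posMat.mem_nhds hA] with B hB
    rw [Function.comp_apply, symInv_symInv hB]

end Objective

/-! ### Critical points are strict minima -/

section Diagonalization

variable {n : ℕ}

theorem exists_orthogonal_diagonalization {B : Matrix (Fin n) (Fin n) ℝ} (hB : B.PosDef) :
    ∃ (U : Matrix (Fin n) (Fin n) ℝ) (w : Fin n → ℝ), Uᵀ * U = 1 ∧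
      Uᵀ * Matrix.diagonal w * U = B ∧ ∀ i, 0 < w i := by
  have h := hB.1.spectral_theorem
  set V : Matrix (Fin n) (Fin n) ℝ := (hB.1.eigenvectorUnitary : Matrix (Fin n) (Fin n) ℝ) with hV
  have hVV : V * star V = 1 := Unitary.coe_mul_star_self hB.1.eigenvectorUnitary
  have hstar : star V = Vᵀ := by
    rw [Matrix.star_eq_conjTranspose, Matrix.conjTranspose_eq_transpose_of_trivial]
  refine ⟨Vᵀ, hB.1.eigenvalues, ?_, ?_, hB.eigenvalues_pos⟩
  · rw [Matrix.transpose_transpose, ← hstar, hVV]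
  · rw [Matrix.transpose_transpose, ← hstar]
    exact h.symm

/-- Simultaneous diagonalization of two positive definite forms. -/
theorem exists_simultaneous_diagonalization {C B : Matrix (Fin n) (Fin n) ℝ} (hC : C.PosDef)
    (hB : B.PosDef) : ∃ (S : Matrix (Fin n) (Fin n) ℝ) (w : Fin n → ℝ), IsUnit S.det ∧
      Sᵀ * S = C ∧ Sᵀ * Matrix.diagonal w * S = B ∧ ∀ i, 0 < w i := by
  obtain ⟨U, w, hU, hUC, hw⟩ := exists_orthogonal_diagonalization hC
  -- `M` is a square root of `C` in the sense `M'M = C`. Diagonalizing `B` in the coordinates `M y`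
  -- by an orthogonal `V` leaves `C` equal to the sum of squares, and `S = V M` does both.
  set M := Matrix.diagonal (fun i => Real.sqrt (w i)) * U with hM
  have hMM : Mᵀ * M = C := by
    rw [hM, Matrix.transpose_mul, Matrix.diagonal_transpose, Matrix.mul_assoc,
      ← Matrix.mul_assoc (Matrix.diagonal _) (Matrix.diagonal _), Matrix.diagonal_mul_diagonal,
      ← Matrix.mul_assoc, ← hUC]
    congr 3
    ext i
    exact Real.mul_self_sqrt (hw i).le
  have hMdet : IsUnit M.det := by
    have h1 : M.det * M.det = C.det := by
      have := Matrix.det_mul Mᵀ M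
      rwa [hMM, Matrix.det_transpose, eq_comm] at this
    refine isUnit_iff_ne_zero.2 fun h0 => hC.det_pos.ne' ?_
    rw [← h1, h0, mul_zero]
  have hN : ((M⁻¹)ᵀ * B * M⁻¹).PosDef := by
    have := hB.conjTranspose_mul_mul_same (B := M⁻¹) (by
      rw [Matrix.mulVec_injective_iff_isUnit, Matrix.isUnit_nonsing_inv_iff]
      exact (Matrix.isUnit_iff_isUnit_det _).2 hMdet)
    rwa [Matrix.conjTranspose_eq_transpose_of_trivial] at this
  obtain ⟨V, v, hV, hVN, hv⟩ := exists_orthogonal_diagonalization hN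
  have hcancel : M⁻¹ * M = 1 := Matrix.nonsing_inv_mul M hMdet
  have hcancel' : Mᵀ * (M⁻¹)ᵀ = 1 := by rw [← Matrix.transpose_mul, hcancel, Matrix.transpose_one]
  refine ⟨V * M, v, ?_, ?_, ?_, hv⟩
  · rw [Matrix.det_mul]
    refine IsUnit.mul ?_ hMdet
    have : V.det * V.det = 1 := by
      rw [← Matrix.det_one (n := Fin n), ← hV, Matrix.det_mul, Matrix.det_transpose]
    exact IsUnit.of_mul_eq_one _ this
  · calc (V * M)ᵀ * (V * M) = Mᵀ * (Vᵀ * V) * M := by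
          rw [Matrix.transpose_mul]; simp only [Matrix.mul_assoc]
      _ = C := by rw [hV, Matrix.mul_one, hMM]
  · calc (V * M)ᵀ * Matrix.diagonal v * (V * M) = Mᵀ * (Vᵀ * Matrix.diagonal v * V) * M := by
          rw [Matrix.transpose_mul]; simp only [Matrix.mul_assoc]
      _ = (Mᵀ * (M⁻¹)ᵀ) * B * (M⁻¹ * M) := by rw [hVN]; simp only [Matrix.mul_assoc]
      _ = B := by rw [hcancel, hcancel', Matrix.one_mul, Matrix.mul_one]

theorem quadForm_conj_diagonal (S : Matrix (Fin n) (Fin n) ℝ) (w : Fin n → ℝ) (y : Rd n) :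
    quadForm (Sᵀ * Matrix.diagonal w * S) y = ∑ i, w i * (S *ᵥ y.ofLp) i ^ 2 := by
  rw [quadForm, ← Matrix.mulVec_mulVec, ← Matrix.mulVec_mulVec, Matrix.dotProduct_mulVec,
    Matrix.vecMul_transpose, dotProduct]
  refine Finset.sum_congr rfl fun i _ => ?_
  rw [Matrix.mulVec_diagonal]
  ring

theorem quadForm_transpose_mul_self (S : Matrix (Fin n) (Fin n) ℝ) (y : Rd n) :
    quadForm (Sᵀ * S) y = ∑ i, (S *ᵥ y.ofLp) i ^ 2 := by
  have := quadForm_conj_diagonal S (fun _ => 1) y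
  simpa using this

theorem mulVec_sq_eq_quadForm (S : Matrix (Fin n) (Fin n) ℝ) (i : Fin n) (y : Rd n) :
    (S *ᵥ y.ofLp) i ^ 2 = quadForm (Matrix.of fun k l => S i k * S i l) y := by
  rw [quadForm_eq_sum, pow_two, Matrix.mulVec, dotProduct, Finset.sum_mul_sum]
  exact Finset.sum_congr rfl fun k _ => Finset.sum_congr rfl fun l _ => by
    rw [Matrix.of_apply]; ring

/-- With `C = S'S` one has `y·w = (Sy)·((S⁻¹)'w)`, and the two factors have squared lengths `y'Cy`
and `w'C⁻¹w`. -/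
theorem sq_dotProduct_le {C : Matrix (Fin n) (Fin n) ℝ} (hC : C.PosDef) (y w : Rd n) :
    (y.ofLp ⬝ᵥ w.ofLp) ^ 2 ≤ quadForm C y * quadForm C⁻¹ w := by
  obtain ⟨S, _, hS, hSC, -⟩ := exists_simultaneous_diagonalization hC hC
  have hinv : C⁻¹ = ((S⁻¹)ᵀ)ᵀ * (S⁻¹)ᵀ := by
    rw [← hSC, Matrix.mul_inv_rev, Matrix.transpose_transpose, Matrix.transpose_nonsing_inv]
  have h1 : y.ofLp ⬝ᵥ w.ofLp = (S *ᵥ y.ofLp) ⬝ᵥ ((S⁻¹)ᵀ *ᵥ w.ofLp) := by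
    rw [Matrix.dotProduct_mulVec, Matrix.vecMul_transpose, Matrix.mulVec_mulVec,
      Matrix.nonsing_inv_mul S hS, Matrix.one_mulVec]
  rw [h1, ← hSC, quadForm_transpose_mul_self, hSC, hinv, quadForm_transpose_mul_self]
  exact Finset.sum_mul_sq_le_sq_mul_sq _ _ _

end Diagonalization

/-! ### Jensen's inequality for the logarithm, with its strict case -/

section Jensen

variable {ι : Type*} [Fintype ι]

/-- Concavity of the logarithm for the weights `ν/D` at the point 1 and `a_i/D` at the points `w_i`,
proved from `log x ≤ x - 1` at the points divided by their mean `X`. The atom at 1 has positive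
weight, so an atom with `w_i ≠ 1` and `a_i > 0` already makes the inequality strict. -/
theorem jensen_log {ν : ℝ} (hν : 0 < ν) {a w : ι → ℝ} (ha : ∀ i, 0 ≤ a i) (hw : ∀ i, 0 < w i) :
    ∑ i, a i / (ν + ∑ j, a j) * Real.log (w i) ≤
        Real.log (ν + ∑ i, w i * a i) - Real.log (ν + ∑ i, a i) ∧
      (∀ i, 0 < a i → w i ≠ 1 → ∑ i, a i / (ν + ∑ j, a j) * Real.log (w i) <
        Real.log (ν + ∑ i, w i * a i) - Real.log (ν + ∑ i, a i)) := by
  set D := ν + ∑ i, a i with hD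
  have hDpos : 0 < D := add_pos_of_pos_of_nonneg hν (Finset.sum_nonneg fun i _ => ha i)
  set Y := ν + ∑ i, w i * a i with hY
  have hYpos : 0 < Y := add_pos_of_pos_of_nonneg hν
    (Finset.sum_nonneg fun i _ => mul_nonneg (hw i).le (ha i))
  set X := Y / D with hX
  have hXpos : 0 < X := div_pos hYpos hDpos
  have hlogX : Real.log Y - Real.log D = Real.log X := (Real.log_div hYpos.ne' hDpos.ne').symm
  -- The right-hand sides of `log x ≤ x - 1` average to zero because `X` is the weighted mean.
  have hsum : ν / D * (1 / X - 1) + ∑ i, a i / D * (w i / X - 1) = 0 := by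
    have h1 : ∑ i, a i / D * (w i / X - 1) = (∑ i, w i * a i) / Y - (∑ i, a i) / D := by
      rw [Finset.sum_div, Finset.sum_div, ← Finset.sum_sub_distrib]
      refine Finset.sum_congr rfl fun i _ => ?_
      rw [hX]
      field_simp
    rw [h1, show ∑ i, w i * a i = Y - ν by rw [hY]; ring, show ∑ i, a i = D - ν by rw [hD]; ring, hX]
    field_simp
    ring
  have hwsum : ν / D + ∑ i, a i / D = 1 := by
    rw [← Finset.sum_div, ← add_div, ← hD, div_self hDpos.ne']
  have hrew : ∑ i, a i / D * Real.log (w i) - Real.log X =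
      ν / D * Real.log (1 / X) + ∑ i, a i / D * Real.log (w i / X) := by
    have h1 : ∑ i, a i / D * Real.log (w i / X) =
        ∑ i, a i / D * Real.log (w i) - (∑ i, a i / D) * Real.log X := by
      rw [Finset.sum_mul, ← Finset.sum_sub_distrib]
      refine Finset.sum_congr rfl fun i _ => ?_
      rw [Real.log_div (hw i).ne' hXpos.ne']
      ring
    rw [h1, one_div, Real.log_inv]
    linear_combination Real.log X * hwsum
  have t0 : ν / D * Real.log (1 / X) ≤ ν / D * (1 / X - 1) :=
    mul_le_mul_of_nonneg_left (Real.log_le_sub_one_of_pos (by positivity)) (by positivity)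
  have ti : ∀ i, a i / D * Real.log (w i / X) ≤ a i / D * (w i / X - 1) := fun i =>
    mul_le_mul_of_nonneg_left (Real.log_le_sub_one_of_pos (div_pos (hw i) hXpos))
      (div_nonneg (ha i) hDpos.le)
  rw [hlogX]
  constructor
  · have := Finset.sum_le_sum fun i (_ : i ∈ Finset.univ) => ti i
    linarith
  · intro i hai hwi
    -- If `X = 1`, the term of index `i` is strict; otherwise the atom at 1 is.
    by_cases hX1 : X = 1
    · have hlt : a i / D * Real.log (w i / X) < a i / D * (w i / X - 1) := by
        refine mul_lt_mul_of_pos_left (Real.log_lt_sub_one_of_pos (div_pos (hw i) hXpos) ?_)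
          (div_pos hai hDpos)
        rwa [hX1, div_one]
      have := Finset.sum_lt_sum (fun i (_ : i ∈ Finset.univ) => ti i) ⟨i, Finset.mem_univ i, hlt⟩
      linarith
    · have hlt : ν / D * Real.log (1 / X) < ν / D * (1 / X - 1) := by
        refine mul_lt_mul_of_pos_left (Real.log_lt_sub_one_of_pos (by positivity) ?_)
          (by positivity)
        rw [one_div]
        exact fun h => hX1 (inv_eq_one.1 h)
      have := Finset.sum_le_sum fun i (_ : i ∈ Finset.univ) => ti i
      linarith

end Jensen

/-! ### A critical point is the strict minimum -/

section Minimum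

variable {n : ℕ}

theorem inv_eq_of_scoreEq_eq_zero {E : Type*} [PseudoMetricSpace E] {y : E → Rd n}
    (hy : BLRatio y) {ν : ℝ} {φ : StrongDual ℝ (BL E)} (hφ : φ 1 = 1) {C : SymMat n}
    (h : hy.scoreEq ν (φ, C) = 0) (k l : Fin n) :
    (C : Matrix (Fin n) (Fin n) ℝ)⁻¹ k l = (ν + n) * φ (hy.kernel ν C k l) := by
  have h1 : (hy.scoreEq ν (φ, C) : Matrix (Fin n) (Fin n) ℝ) k l = 0 := by rw [h]; rfl
  rw [BLRatio.scoreEq_apply, hφ, coe_symInv] at h1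
  linarith

/-- In coordinates where `C` is the identity form and `B` is diagonal with entries `w_i`, the
log-determinants differ by `∑ log w_i`. The critical equation turns this sum into the integral of
the Jensen lower bound for the logarithmic term, so the difference of the objectives is `(ν + n)/2`
times the integral of the Jensen gap. -/
theorem scatterObj_lt_of_critical {ν : ℝ} (hν : 0 < ν) (Q : Law n) {C B : SymMat n}
    (hC : C ∈ PosMat n) (hB : B ∈ PosMat n) (hne : B ≠ C)
    (hcrit : blRatio_id.scoreEq ν (lawToDual Q, C) = 0) :
    scatterObj ν Q (symInv C) < scatterObj ν Q (symInv B) := by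
  obtain ⟨S, w, hSdet, hSC, hSB, hw⟩ := exists_simultaneous_diagonalization
    (show (C : Matrix (Fin n) (Fin n) ℝ).PosDef from hC)
    (show (B : Matrix (Fin n) (Fin n) ℝ).PosDef from hB)
  have hνn : 0 < ν + n := by positivity
  have hqC : ∀ y : Rd n, quadForm (C : Matrix (Fin n) (Fin n) ℝ) y =
      ∑ i, (S *ᵥ y.ofLp) i ^ 2 := fun y => by rw [← hSC, quadForm_transpose_mul_self]
  have hqB : ∀ y : Rd n, quadForm (B : Matrix (Fin n) (Fin n) ℝ) y =
      ∑ i, w i * (S *ᵥ y.ofLp) i ^ 2 := fun y => by rw [← hSB, quadForm_conj_diagonal]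
  -- This is the diagonal of `S C⁻¹ S' = 1`, with `C⁻¹` replaced by its integral expression from the
  -- critical equation.
  have hInt : ∀ i, ∫ y : Rd n, (S *ᵥ y.ofLp) i ^ 2 /
      (ν + quadForm (C : Matrix (Fin n) (Fin n) ℝ) y) ∂(Q : Measure (Rd n)) = 1 / (ν + n) := by
    intro i
    simp only [mulVec_sq_eq_quadForm]
    rw [integral_quadForm_div hν Q hC]
    have h1 : (S * (C : Matrix (Fin n) (Fin n) ℝ)⁻¹ * Sᵀ) i i = 1 := by
      have hST : IsUnit (Sᵀ).det := by rwa [Matrix.det_transpose]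
      rw [← hSC, Matrix.mul_inv_rev, ← Matrix.mul_assoc, Matrix.mul_nonsing_inv S hSdet,
        Matrix.one_mul, Matrix.nonsing_inv_mul _ hST, Matrix.one_apply_eq]
    have h2 : (S * (C : Matrix (Fin n) (Fin n) ℝ)⁻¹ * Sᵀ) i i =
        (ν + n) * ∑ k, ∑ l, S i k * S i l * lawToDual Q (blRatio_id.kernel ν C k l) := by
      simp only [Matrix.mul_apply, Finset.mul_sum, Finset.sum_mul, Matrix.transpose_apply]
      rw [Finset.sum_comm]
      refine Finset.sum_congr rfl fun k _ => Finset.sum_congr rfl fun l _ => ?_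
      rw [inv_eq_of_scoreEq_eq_zero blRatio_id (lawToDual_one Q) hcrit k l]
      ring
    simp only [Matrix.of_apply]
    rw [eq_div_iff hνn.ne', mul_comm, ← h2, h1]
  have hinti : ∀ i, Integrable (fun y : Rd n => (S *ᵥ y.ofLp) i ^ 2 /
      (ν + quadForm (C : Matrix (Fin n) (Fin n) ℝ) y)) (Q : Measure (Rd n)) := fun i => by
    simp only [mulVec_sq_eq_quadForm]
    exact integrable_quadForm_div hν Q hC _
  have hdet : Real.log (B : Matrix (Fin n) (Fin n) ℝ).det =
      Real.log (C : Matrix (Fin n) (Fin n) ℝ).det + ∑ i, Real.log (w i) := by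
    have hS0 : S.det ≠ 0 := hSdet.ne_zero
    rw [← hSB, ← hSC, Matrix.det_mul, Matrix.det_mul, Matrix.det_mul, Matrix.det_transpose,
      Matrix.det_diagonal, ← Real.log_prod fun i _ => (hw i).ne',
      ← Real.log_mul (mul_ne_zero hS0 hS0) (Finset.prod_pos fun i _ => hw i).ne']
    congr 1
    ring
  -- `g` is the Jensen gap. If its integral were zero, then `(Sy)_i` would vanish almost surely for
  -- some `w_i ≠ 1`, against the positive value in `hInt`.
  set g : Rd n → ℝ := fun y => (logRatio ν B y - logRatio ν C y) -
    ∑ i, (S *ᵥ y.ofLp) i ^ 2 / (ν + quadForm (C : Matrix (Fin n) (Fin n) ℝ) y) * Real.log (w i)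
    with hg
  have hgi1 : Integrable (fun y => logRatio ν B y - logRatio ν C y) (Q : Measure (Rd n)) :=
    (integrable_logRatio hν Q hB).sub (integrable_logRatio hν Q hC)
  have hgi2 : Integrable (fun y : Rd n => ∑ i, (S *ᵥ y.ofLp) i ^ 2 /
      (ν + quadForm (C : Matrix (Fin n) (Fin n) ℝ) y) * Real.log (w i)) (Q : Measure (Rd n)) :=
    integrable_finsetSum _ fun i _ => (hinti i).mul_const _
  have hgi : Integrable g (Q : Measure (Rd n)) := hgi1.sub hgi2
  have hdiff : ∀ y, logRatio ν B y - logRatio ν C y =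
      Real.log (ν + ∑ i, w i * (S *ᵥ y.ofLp) i ^ 2) - Real.log (ν + ∑ i, (S *ᵥ y.ofLp) i ^ 2) :=
    fun y => by rw [logRatio, logRatio, hqB, hqC]; ring
  have hg0 : ∀ y, 0 ≤ g y := by
    intro y
    have := (jensen_log hν (a := fun i => (S *ᵥ y.ofLp) i ^ 2) (fun i => sq_nonneg _) hw).1
    simp only [hg, hdiff, hqC]
    linarith
  have hgint : ∫ y, g y ∂(Q : Measure (Rd n)) =
      ∫ y, logRatio ν B y ∂(Q : Measure (Rd n)) - ∫ y, logRatio ν C y ∂(Q : Measure (Rd n)) -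
        (∑ i, Real.log (w i)) / (ν + n) := by
    rw [hg, integral_sub hgi1 hgi2, integral_sub (integrable_logRatio hν Q hB)
      (integrable_logRatio hν Q hC), integral_finsetSum _ fun i _ => (hinti i).mul_const _]
    congr 1
    rw [Finset.sum_div]
    refine Finset.sum_congr rfl fun i _ => ?_
    rw [integral_mul_const, hInt]
    ring
  have hpos : 0 < ∫ y, g y ∂(Q : Measure (Rd n)) := by
    refine lt_of_le_of_ne (integral_nonneg hg0) fun h0 => ?_
    have hae := (integral_eq_zero_iff_of_nonneg hg0 hgi).1 h0.symm
    obtain ⟨i, hi⟩ : ∃ i, w i ≠ 1 := by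
      by_contra hcon
      push Not at hcon
      refine hne (Subtype.ext ?_)
      rw [← hSB, ← hSC, show w = fun _ => 1 from funext hcon, Matrix.diagonal_one, Matrix.mul_one]
    have hz : ∀ᵐ y ∂(Q : Measure (Rd n)), (S *ᵥ y.ofLp) i ^ 2 /
        (ν + quadForm (C : Matrix (Fin n) (Fin n) ℝ) y) = 0 := by
      filter_upwards [hae] with y hy
      rcases (sq_nonneg ((S *ᵥ y.ofLp) i)).eq_or_lt with h | h
      · rw [← h, zero_div]
      · have := (jensen_log hν (a := fun i => (S *ᵥ y.ofLp) i ^ 2)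
          (fun i => sq_nonneg _) hw).2 i h hi
        simp only [hg, hdiff, hqC, Pi.zero_apply] at hy
        linarith
    have := hInt i
    rw [integral_congr_ae hz] at this
    simp only [integral_zero] at this
    exact (one_div_pos.2 hνn).ne this
  rw [scatterObj_symInv hν Q hC, scatterObj_symInv hν Q hB, hdet]
  rw [hgint, sub_pos, div_lt_iff₀ hνn] at hpos
  nlinarith

end Minimum

/-! ### The derivative of the score equation is invertible at a critical point -/

theorem BLRatio.toFun_sum_kernel {E : Type*} [PseudoMetricSpace E] {n : ℕ} {y : E → Rd n}
    (hy : BLRatio y) {ν : ℝ} (hν : 0 < ν) {C : SymMat n}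
    (hC : C ∈ PosMat n) (M : Matrix (Fin n) (Fin n) ℝ) (e : E) :
    (∑ k, ∑ l, M k l • hy.kernel ν C k l).toFun e =
      quadForm M (y e) / (ν + quadForm (C : Matrix (Fin n) (Fin n) ℝ) (y e)) := by
  simp only [BL.toFun_sum, BL.toFun_smul, hy.toFun_kernel hν hC, quadForm_eq_sum, Finset.sum_div,
    mul_div]

section Invertible

variable {E : Type*} [PseudoMetricSpace E] [MeasurableSpace E] [OpensMeasurableSpace E]

/-- Integration against a law, as an element of the dual of `BL E`. -/
def probToDual (μ : ProbabilityMeasure E) : StrongDual ℝ (BL E) :=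
  LinearMap.mkContinuous
    { toFun := fun f => ∫ y, f.toFun y ∂(μ : Measure E)
      map_add' := fun f g => by
        simp only [BL.toFun_add]
        exact integral_add (f.integrable _) (g.integrable _)
      map_smul' := fun c f => by
        simp only [BL.toFun_smul, RingHom.id_apply, smul_eq_mul]
        exact integral_const_mul _ _ }
    1 (fun f => by
      have h := norm_integral_le_of_norm_le_const (μ := (μ : Measure E)) (f := f.toFun)
        (C := f.supNorm) (Filter.Eventually.of_forall fun y => f.abs_le_supNorm y)
      simp only [probReal_univ, mul_one] at h
      rw [one_mul, BL.norm_def]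
      exact h.trans (le_add_of_nonneg_right f.lipNorm_nonneg))

theorem probToDual_apply (μ : ProbabilityMeasure E) (f : BL E) :
    probToDual μ f = ∫ y, f.toFun y ∂(μ : Measure E) := rfl

theorem probToDual_one (μ : ProbabilityMeasure E) : probToDual μ 1 = 1 := by
  rw [probToDual_apply]
  simp [BL.toFun_one]

theorem probToDual_eq_lawToDual {n : ℕ} (Q : Law n) : probToDual Q = lawToDual Q := rfl

variable {n : ℕ} {y : E → Rd n}

theorem quadForm_mul_inv_mul (C Δ : SymMat n) (x : Rd n) :
    quadForm ((Δ : Matrix (Fin n) (Fin n) ℝ) * (C : Matrix (Fin n) (Fin n) ℝ)⁻¹ *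
        (Δ : Matrix (Fin n) (Fin n) ℝ)) x =
      quadForm (C : Matrix (Fin n) (Fin n) ℝ)⁻¹
        (WithLp.toLp 2 ((Δ : Matrix (Fin n) (Fin n) ℝ) *ᵥ x.ofLp)) := by
  rw [quadForm, quadForm, ← Matrix.mulVec_mulVec, ← Matrix.mulVec_mulVec, Matrix.dotProduct_mulVec,
    ← Matrix.mulVec_transpose, SymMat.transpose_coe]

/-- Pairing the derivative with `Δ` and using the critical equation for `C⁻¹` gives `∫ (η - ρ²) =
0`, where `η = y'Ny / (ν + y'Cy)`, `N = Δ C⁻¹ Δ` and `ρ = y'Δy / (ν + y'Cy)`. The integrand is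
nonnegative and vanishes only where `Δy = 0`; the critical equation excludes this almost surely
unless `Δ = 0`. -/
theorem BLRatio.eq_zero_of_derivative_eq_zero (hy : BLRatio y) {ν : ℝ} (hν : 0 < ν)
    (μ : ProbabilityMeasure E) {C : SymMat n} (hC : C ∈ PosMat n)
    (hcrit : hy.scoreEq ν (probToDual μ, C) = 0) (Δ : SymMat n)
    (hΔ : ∀ k l, probToDual μ 1 / 2 * ((C : Matrix (Fin n) (Fin n) ℝ)⁻¹ *
        (Δ : Matrix (Fin n) (Fin n) ℝ) * (C : Matrix (Fin n) (Fin n) ℝ)⁻¹) k l -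
      (ν + n) / 2 * probToDual μ (hy.kernel ν C k l *
        ∑ i, ∑ j, (Δ : Matrix (Fin n) (Fin n) ℝ) i j • hy.kernel ν C i j) = 0) : Δ = 0 := by
  have hCpd : (C : Matrix (Fin n) (Fin n) ℝ).PosDef := hC
  have hνn : 0 < ν + n := by positivity
  have hinv := inv_eq_of_scoreEq_eq_zero hy (probToDual_one μ) hcrit
  set ρ : BL E := ∑ i, ∑ j, (Δ : Matrix (Fin n) (Fin n) ℝ) i j • hy.kernel ν C i j with hρ
  set N : Matrix (Fin n) (Fin n) ℝ := (Δ : Matrix (Fin n) (Fin n) ℝ) *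
    (C : Matrix (Fin n) (Fin n) ℝ)⁻¹ * (Δ : Matrix (Fin n) (Fin n) ℝ) with hN
  set η : BL E := ∑ i, ∑ j, N i j • hy.kernel ν C i j with hη
  have hφη : ∑ k, ∑ l, (Δ : Matrix (Fin n) (Fin n) ℝ) k l *
      ((C : Matrix (Fin n) (Fin n) ℝ)⁻¹ * (Δ : Matrix (Fin n) (Fin n) ℝ) *
        (C : Matrix (Fin n) (Fin n) ℝ)⁻¹) k l = (ν + n) * probToDual μ η := by
    rw [← trace_mul_eq_sum, Matrix.trace_mul_comm, ← Matrix.mul_assoc, ← Matrix.mul_assoc, ← hN, hη]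
    simp only [map_sum, map_smul, Matrix.trace, Matrix.diag, Matrix.mul_apply, Finset.mul_sum,
      smul_eq_mul]
    refine Finset.sum_congr rfl fun i _ => Finset.sum_congr rfl fun j _ => ?_
    rw [hinv, hy.kernel_comm]
    ring
  have hφρ : ∑ k, ∑ l, (Δ : Matrix (Fin n) (Fin n) ℝ) k l *
      probToDual μ (hy.kernel ν C k l * ρ) = probToDual μ (ρ * ρ) := by
    have h : ρ * ρ = (∑ i, ∑ j, (Δ : Matrix (Fin n) (Fin n) ℝ) i j • hy.kernel ν C i j) * ρ := by
      rw [← hρ]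
    rw [h]
    simp only [Finset.sum_mul, map_sum, smul_mul_assoc, map_smul, smul_eq_mul]
  have hsum : probToDual μ (η - ρ * ρ) = 0 := by
    have h1 : ∑ k, ∑ l, (Δ : Matrix (Fin n) (Fin n) ℝ) k l *
        (probToDual μ 1 / 2 * ((C : Matrix (Fin n) (Fin n) ℝ)⁻¹ *
        (Δ : Matrix (Fin n) (Fin n) ℝ) * (C : Matrix (Fin n) (Fin n) ℝ)⁻¹) k l -
      (ν + n) / 2 * probToDual μ (hy.kernel ν C k l * ρ)) = 0 := by
      simp only [hΔ, mul_zero, Finset.sum_const_zero]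
    have h2 : ∑ k, ∑ l, (Δ : Matrix (Fin n) (Fin n) ℝ) k l *
        (probToDual μ 1 / 2 * ((C : Matrix (Fin n) (Fin n) ℝ)⁻¹ *
        (Δ : Matrix (Fin n) (Fin n) ℝ) * (C : Matrix (Fin n) (Fin n) ℝ)⁻¹) k l -
      (ν + n) / 2 * probToDual μ (hy.kernel ν C k l * ρ)) =
        1 / 2 * ((ν + n) * probToDual μ η) - (ν + n) / 2 * probToDual μ (ρ * ρ) := by
      rw [← hφη, ← hφρ]
      simp only [Finset.mul_sum, ← Finset.sum_sub_distrib, probToDual_one]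
      exact Finset.sum_congr rfl fun k _ => Finset.sum_congr rfl fun l _ => by ring
    rw [h2] at h1
    rw [map_sub]
    have h3 : (ν + n) * (probToDual μ η - probToDual μ (ρ * ρ)) = 0 := by linarith
    exact (mul_eq_zero.1 h3).resolve_left hνn.ne'
  -- Cauchy–Schwarz gives `(y'Δy)² ≤ (y'Cy)(y'Ny)`. The summand `ν` in the denominator leaves the
  -- strict margin on the left.
  have hkey : ∀ e, ν * quadForm N (y e) /
      (ν + quadForm (C : Matrix (Fin n) (Fin n) ℝ) (y e)) ^ 2 ≤ (η - ρ * ρ).toFun e := by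
    intro e
    have hq := quadForm_nonneg hCpd (y e)
    have hden : 0 < ν + quadForm (C : Matrix (Fin n) (Fin n) ℝ) (y e) := by positivity
    have hcs := sq_dotProduct_le hCpd (y e)
      (WithLp.toLp 2 ((Δ : Matrix (Fin n) (Fin n) ℝ) *ᵥ (y e).ofLp))
    rw [← quadForm_mul_inv_mul, ← hN] at hcs
    change quadForm (Δ : Matrix (Fin n) (Fin n) ℝ) (y e) ^ 2 ≤ _ at hcs
    rw [BL.toFun_sub, BL.toFun_mul, hη, hρ, hy.toFun_sum_kernel hν hC, hy.toFun_sum_kernel hν hC]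
    rw [div_mul_div_comm, div_sub_div _ _ hden.ne' (by positivity),
      div_le_div_iff₀ (by positivity) (by positivity)]
    have : 0 ≤ (quadForm (C : Matrix (Fin n) (Fin n) ℝ) (y e) * quadForm N (y e) -
      quadForm (Δ : Matrix (Fin n) (Fin n) ℝ) (y e) ^ 2) *
      (ν + quadForm (C : Matrix (Fin n) (Fin n) ℝ) (y e)) ^ 3 :=
      mul_nonneg (by linarith) (by positivity)
    linarith
  have hNnn : ∀ x, 0 ≤ quadForm N x := fun x => by
    rw [hN, quadForm_mul_inv_mul]
    exact quadForm_nonneg hCpd.inv _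
  have hae : ∀ᵐ e ∂(μ : Measure E), (Δ : Matrix (Fin n) (Fin n) ℝ) *ᵥ (y e).ofLp = 0 := by
    have h0 : ∀ e, 0 ≤ (η - ρ * ρ).toFun e := fun e => by
      have hq := quadForm_nonneg hCpd (y e)
      have := hNnn (y e)
      exact le_trans (by positivity) (hkey e)
    have := (integral_eq_zero_iff_of_nonneg h0 ((η - ρ * ρ).integrable _)).1 hsum
    filter_upwards [this] with e he
    by_contra hne
    have hpos : 0 < quadForm N (y e) := by
      rw [hN, quadForm_mul_inv_mul]
      exact quadForm_pos hCpd.inv (by simpa using hne)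
    have hq := quadForm_nonneg hCpd (y e)
    have h2 := hkey e
    rw [he] at h2
    exact absurd h2 (not_le.2 (by rw [Pi.zero_apply]; positivity))
  -- By the critical equation `Δ C⁻¹ = (ν + n) ∫ Δ y y' / (ν + y'Cy)`, and the integrand vanishes
  -- almost surely.
  have hzero : (Δ : Matrix (Fin n) (Fin n) ℝ) * (C : Matrix (Fin n) (Fin n) ℝ)⁻¹ = 0 := by
    ext k l
    rw [Matrix.mul_apply, Matrix.zero_apply]
    have h1 : ∑ j, (Δ : Matrix (Fin n) (Fin n) ℝ) k j * (C : Matrix (Fin n) (Fin n) ℝ)⁻¹ j l =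
        (ν + n) * probToDual μ
          (∑ j, (Δ : Matrix (Fin n) (Fin n) ℝ) k j • hy.kernel ν C j l) := by
      simp only [map_sum, map_smul, Finset.mul_sum, smul_eq_mul, hinv]
      exact Finset.sum_congr rfl fun j _ => by ring
    rw [h1, probToDual_apply, integral_eq_zero_of_ae, mul_zero]
    filter_upwards [hae] with e he
    have h2 := congrFun he k
    simp only [Matrix.mulVec, dotProduct, Pi.zero_apply] at h2
    simp only [BL.toFun_sum, BL.toFun_smul, hy.toFun_kernel hν hC, Pi.zero_apply]
    have h3 : ∀ j, (Δ : Matrix (Fin n) (Fin n) ℝ) k j * ((y e) j * (y e) l /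
        (ν + quadForm (C : Matrix (Fin n) (Fin n) ℝ) (y e))) =
        (Δ : Matrix (Fin n) (Fin n) ℝ) k j * (y e) j * ((y e) l /
        (ν + quadForm (C : Matrix (Fin n) (Fin n) ℝ) (y e))) := fun j => by ring
    simp only [h3, ← Finset.sum_mul]
    rw [h2, zero_mul]
  refine Subtype.ext ?_
  have := congrArg (· * (C : Matrix (Fin n) (Fin n) ℝ)) hzero
  simpa [Matrix.mul_assoc, Matrix.nonsing_inv_mul _ (posMat_isUnit_det hC)] using this

/-- At a critical point the derivative of the score equation in the matrix variable is an
isomorphism. -/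
theorem BLRatio.exists_equiv_hasFDerivAt_scoreEq (hy : BLRatio y) {ν : ℝ} (hν : 0 < ν)
    (μ : ProbabilityMeasure E) {C : SymMat n} (hC : C ∈ PosMat n)
    (hcrit : hy.scoreEq ν (probToDual μ, C) = 0) : ∃ D : SymMat n ≃L[ℝ] SymMat n,
      HasFDerivAt (fun B => hy.scoreEq ν (probToDual μ, B)) (D : SymMat n →L[ℝ] SymMat n) C := by
  obtain ⟨D, hD, hd⟩ := hy.hasFDerivAt_scoreEq hν (probToDual μ) hC
  have hinj : Function.Injective (D : SymMat n →ₗ[ℝ] SymMat n) := by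
    refine (injective_iff_map_eq_zero _).2 fun Δ hΔ => ?_
    refine hy.eq_zero_of_derivative_eq_zero hν μ hC hcrit Δ fun k l => ?_
    rw [← hD, show D Δ = 0 from hΔ]
    rfl
  refine ⟨(LinearEquiv.ofInjectiveEndo _ hinj).toContinuousLinearEquiv, ?_⟩
  convert! hd using 1

end Invertible

/-! ### Existence of the minimum -/

section Rays

variable {ι : Type*} [Fintype ι]

/-- The function `t ↦ log (ν + ∑ exp (t s_i) a_i) - log (ν + ∑ a_i)`, as a function of `t s`. -/
def logSumRatio (ν : ℝ) (a s : ι → ℝ) : ℝ :=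
  Real.log (ν + ∑ i, Real.exp (s i) * a i) - Real.log (ν + ∑ i, a i)

theorem logSumRatio_pos_num {ν : ℝ} (hν : 0 < ν) {a : ι → ℝ} (ha : ∀ i, 0 ≤ a i) (s : ι → ℝ) :
    0 < ν + ∑ i, Real.exp (s i) * a i :=
  add_pos_of_pos_of_nonneg hν (Finset.sum_nonneg fun i _ =>
    mul_nonneg (Real.exp_pos _).le (ha i))

theorem logSumRatio_pos_den {ν : ℝ} (hν : 0 < ν) {a : ι → ℝ} (ha : ∀ i, 0 ≤ a i) :
    0 < ν + ∑ i, a i :=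
  add_pos_of_pos_of_nonneg hν (Finset.sum_nonneg fun i _ => ha i)

/-- Up to the logarithm this is `(𝔼 Z)^p ≤ 𝔼 Z^p` for the variable `Z` equal to 1 with probability
`ν/D` and to `exp s_i` with probability `a_i/D`. It plays the role of convexity along rays from the
identity. -/
theorem mul_logSumRatio_le {ν : ℝ} (hν : 0 < ν) {a : ι → ℝ} (ha : ∀ i, 0 ≤ a i) (s : ι → ℝ)
    {p : ℝ} (hp : 1 ≤ p) : p * logSumRatio ν a s ≤ logSumRatio ν a (p • s) := by
  have hD := logSumRatio_pos_den hν ha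
  set D := ν + ∑ i, a i with hDdef
  have hw : ∑ o : Option ι, o.elim (ν / D) (fun i => a i / D) = 1 := by
    rw [Fintype.sum_option]
    simp only [Option.elim_none, Option.elim_some]
    rw [← Finset.sum_div, ← add_div, ← hDdef, div_self hD.ne']
  have h := Real.rpow_arith_mean_le_arith_mean_rpow Finset.univ
    (fun o : Option ι => o.elim (ν / D) (fun i => a i / D))
    (fun o : Option ι => o.elim 1 (fun i => Real.exp (s i)))
    (fun o _ => by
      cases o with
      | none => exact (div_pos hν hD).le
      | some i => exact div_nonneg (ha i) hD.le) hw
    (fun o _ => by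
      cases o with
      | none => exact zero_le_one
      | some i => exact (Real.exp_pos _).le) hp
  rw [Fintype.sum_option, Fintype.sum_option] at h
  simp only [Option.elim_none, Option.elim_some, Real.one_rpow, mul_one] at h
  have e1 : ν / D + ∑ i, a i / D * Real.exp (s i) = (ν + ∑ i, Real.exp (s i) * a i) / D := by
    rw [add_div, Finset.sum_div]
    congr 1
    exact Finset.sum_congr rfl fun i _ => by ring
  have e2 : ν / D + ∑ i, a i / D * Real.exp (s i) ^ p =
      (ν + ∑ i, Real.exp ((p • s) i) * a i) / D := by
    rw [add_div, Finset.sum_div]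
    congr 1
    refine Finset.sum_congr rfl fun i _ => ?_
    rw [← Real.exp_mul, Pi.smul_apply, smul_eq_mul, mul_comm (s i)]
    ring
  rw [e1, e2] at h
  have hX := div_pos (logSumRatio_pos_num hν ha s) hD
  have h2 := Real.log_le_log (Real.rpow_pos_of_pos hX p) h
  rw [Real.log_rpow hX, Real.log_div (logSumRatio_pos_num hν ha s).ne' hD.ne',
    Real.log_div (logSumRatio_pos_num hν ha _).ne' hD.ne'] at h2
  exact h2

/-- The maximum of `0` and of the `s_i` with `a_i ≠ 0`. -/
def supportMax (a s : ι → ℝ) : ℝ := by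
  classical
  exact Finset.univ.sup' ⟨none, Finset.mem_univ _⟩
    (fun o : Option ι => o.elim 0 fun i => if a i = 0 then 0 else s i)

theorem supportMax_nonneg (a s : ι → ℝ) : 0 ≤ supportMax a s := by
  classical
  exact Finset.le_sup' (fun o : Option ι => o.elim 0 fun i => if a i = 0 then 0 else s i)
    (Finset.mem_univ none)

theorem le_supportMax {a s : ι → ℝ} {i : ι} (hi : a i ≠ 0) : s i ≤ supportMax a s := by
  classical
  have := Finset.le_sup' (fun o : Option ι => o.elim 0 fun i => if a i = 0 then 0 else s i)
    (Finset.mem_univ (some i))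
  simpa [hi, supportMax] using this

theorem supportMax_eq (a s : ι → ℝ) :
    supportMax a s = 0 ∨ ∃ i, a i ≠ 0 ∧ supportMax a s = s i := by
  classical
  obtain ⟨o, -, ho⟩ := Finset.exists_mem_eq_sup' (s := (Finset.univ : Finset (Option ι)))
    ⟨none, Finset.mem_univ _⟩ (fun o : Option ι => o.elim 0 fun i => if a i = 0 then 0 else s i)
  change supportMax a s = _ at ho
  cases o with
  | none => exact Or.inl ho
  | some i =>
    simp only [Option.elim_some] at ho
    split_ifs at ho with h
    · exact Or.inl ho
    · exact Or.inr ⟨i, h, ho⟩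

theorem supportMax_le_sum (a s : ι → ℝ) : supportMax a s ≤ ∑ i, |s i| := by
  rcases supportMax_eq a s with h | ⟨i, -, h⟩
  · rw [h]; exact Finset.sum_nonneg fun i _ => abs_nonneg _
  · rw [h]
    exact (le_abs_self _).trans
      (Finset.single_le_sum (f := fun i => |s i|) (fun i _ => abs_nonneg _) (Finset.mem_univ i))

theorem lt_supportMax_iff {a s : ι → ℝ} {c : ℝ} (hc : 0 ≤ c) :
    c < supportMax a s ↔ ∃ i, a i ≠ 0 ∧ c < s i := by
  constructor
  · intro h
    rcases supportMax_eq a s with h0 | ⟨i, hi, h1⟩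
    · linarith
    · exact ⟨i, hi, h1 ▸ h⟩
  · rintro ⟨i, hi, h⟩
    exact h.trans_le (le_supportMax hi)

theorem logSumRatio_le {ν : ℝ} (hν : 0 < ν) {a : ι → ℝ} (ha : ∀ i, 0 ≤ a i) (s : ι → ℝ) {t : ℝ}
    (ht : 0 ≤ t) : logSumRatio ν a (t • s) ≤ t * supportMax a s := by
  have hD := logSumRatio_pos_den hν ha
  have h1 : ν + ∑ i, Real.exp ((t • s) i) * a i ≤
      Real.exp (t * supportMax a s) * (ν + ∑ i, a i) := by
    rw [mul_add, Finset.mul_sum]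
    refine add_le_add ?_ (Finset.sum_le_sum fun i _ => ?_)
    · exact le_mul_of_one_le_left hν.le
        (Real.one_le_exp (mul_nonneg ht (supportMax_nonneg a s)))
    · by_cases h : a i = 0
      · simp [h]
      · refine mul_le_mul_of_nonneg_right (Real.exp_le_exp.2 ?_) (ha i)
        exact mul_le_mul_of_nonneg_left (le_supportMax h) ht
  have h2 := Real.log_le_log (logSumRatio_pos_num hν ha _) h1
  rw [Real.log_mul (Real.exp_pos _).ne' hD.ne', Real.log_exp] at h2
  rw [logSumRatio]
  linarith

/-- Only one term of the sum is kept, the one that attains the maximum (or the constant `ν` when the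
maximum is 0). The additive constant depends on `a`, so this bound serves pointwise limits and not
domination. -/
theorem exists_le_logSumRatio {ν : ℝ} (hν : 0 < ν) {a : ι → ℝ} (ha : ∀ i, 0 ≤ a i) (s : ι → ℝ) :
    ∃ c, ∀ t : ℝ, t * supportMax a s + c ≤ logSumRatio ν a (t • s) := by
  have hterm : ∀ (t : ℝ) i, 0 ≤ Real.exp ((t • s) i) * a i := fun t i =>
    mul_nonneg (Real.exp_pos _).le (ha i)
  rcases supportMax_eq a s with h | ⟨i, hi, h⟩
  · refine ⟨Real.log ν - Real.log (ν + ∑ i, a i), fun t => ?_⟩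
    have := Real.log_le_log hν (le_add_of_nonneg_right
      (Finset.sum_nonneg fun i (_ : i ∈ Finset.univ) => hterm t i))
    rw [h, logSumRatio]
    linarith
  · refine ⟨Real.log (a i) - Real.log (ν + ∑ i, a i), fun t => ?_⟩
    have hai : 0 < a i := lt_of_le_of_ne (ha i) hi.symm
    have h1 : Real.exp (t * s i) * a i ≤ ν + ∑ i, Real.exp ((t • s) i) * a i := by
      have := Finset.single_le_sum (fun i (_ : i ∈ Finset.univ) => hterm t i) (Finset.mem_univ i)
      simp only [Pi.smul_apply, smul_eq_mul] at this ⊢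
      linarith
    have h2 := Real.log_le_log (mul_pos (Real.exp_pos _) hai) h1
    rw [Real.log_mul (Real.exp_pos _).ne' hai.ne', Real.log_exp] at h2
    rw [h, logSumRatio]
    linarith

theorem neg_le_logSumRatio {ν : ℝ} (hν : 0 < ν) {a : ι → ℝ} (ha : ∀ i, 0 ≤ a i) (s : ι → ℝ) {t : ℝ}
    (ht : 0 ≤ t) : -(t * ∑ i, |s i|) ≤ logSumRatio ν a (t • s) := by
  have hD := logSumRatio_pos_den hν ha
  have h1 : Real.exp (-(t * ∑ i, |s i|)) * (ν + ∑ i, a i) ≤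
      ν + ∑ i, Real.exp ((t • s) i) * a i := by
    rw [mul_add, Finset.mul_sum Finset.univ a]
    have hs : 0 ≤ ∑ i, |s i| := Finset.sum_nonneg fun i _ => abs_nonneg _
    refine add_le_add ?_ (Finset.sum_le_sum fun i _ => ?_)
    · refine mul_le_of_le_one_left hν.le (Real.exp_le_one_iff.2 ?_)
      have := mul_nonneg ht hs
      linarith
    · refine mul_le_mul_of_nonneg_right (Real.exp_le_exp.2 ?_) (ha i)
      have h3 : |s i| ≤ ∑ i, |s i| :=
        Finset.single_le_sum (f := fun i => |s i|) (fun i _ => abs_nonneg _) (Finset.mem_univ i)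
      have h4 : -(∑ i, |s i|) ≤ s i := by linarith [neg_abs_le (s i)]
      have := mul_le_mul_of_nonneg_left h4 ht
      simp only [Pi.smul_apply, smul_eq_mul]
      linarith
  have h2 := Real.log_le_log (mul_pos (Real.exp_pos _) hD) h1
  rw [Real.log_mul (Real.exp_pos _).ne' hD.ne', Real.log_exp] at h2
  rw [logSumRatio]
  linarith

/-- The function is linear with slope `supportMax a s` up to a bounded error, hence this asymptotic
slope. The step `k + 1` avoids division by zero. -/
theorem tendsto_logSumRatio_div {ν : ℝ} (hν : 0 < ν) {a : ι → ℝ} (ha : ∀ i, 0 ≤ a i) (s : ι → ℝ) :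
    Filter.Tendsto (fun k : ℕ => logSumRatio ν a (((k : ℝ) + 1) • s) / ((k : ℝ) + 1)) Filter.atTop
      (nhds (supportMax a s)) := by
  obtain ⟨c, hc⟩ := exists_le_logSumRatio hν ha s
  have h0 : Filter.Tendsto (fun k : ℕ => supportMax a s + c * (1 / ((k : ℝ) + 1))) Filter.atTop
      (nhds (supportMax a s)) := by
    have := (tendsto_one_div_add_atTop_nhds_zero_nat (𝕜 := ℝ)).const_mul c
    simpa using this.const_add (supportMax a s)
  refine tendsto_of_tendsto_of_tendsto_of_le_of_le h0 tendsto_const_nhds (fun k => ?_) fun k => ?_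
  · have hk : (0 : ℝ) < (k : ℝ) + 1 := by positivity
    have := hc ((k : ℝ) + 1)
    simp only
    rw [le_div_iff₀ hk]
    field_simp
    linarith
  · have hk : (0 : ℝ) < (k : ℝ) + 1 := by positivity
    have := logSumRatio_le hν ha s hk.le
    simp only
    rw [div_le_iff₀ hk]
    linarith

end Rays

/-! ### Subspace masses and the sign of the asymptotic slope -/

section Orthogonal

variable {n : ℕ}

theorem finrank_orthogonal_span {ι : Type*} [Fintype ι] {v : ι → Rd n} (hv : Orthonormal ℝ v) :
    Module.finrank ℝ (Submodule.span ℝ (Set.range v))ᗮ + Fintype.card ι = n := by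
  have h1 := Submodule.finrank_add_finrank_orthogonal (Submodule.span ℝ (Set.range v))
  rw [finrank_span_eq_card hv.linearIndependent, finrank_euclideanSpace_fin] at h1
  omega

theorem mem_orthogonal_span_iff {ι : Type*} {v : ι → Rd n} {x : Rd n} :
    x ∈ (Submodule.span ℝ (Set.range v))ᗮ ↔ ∀ i, inner ℝ (v i) x = 0 := by
  rw [Submodule.mem_orthogonal]
  constructor
  · exact fun h i => h _ (Submodule.subset_span ⟨i, rfl⟩)
  · intro h u hu
    induction hu using Submodule.span_induction with
    | mem x hx => obtain ⟨i, rfl⟩ := hx; exact h i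
    | zero => exact inner_zero_left _
    | add x y _ _ hx hy => rw [inner_add_left, hx, hy, add_zero]
    | smul c x _ hx => rw [inner_smul_left, hx, mul_zero]

theorem inner_row (U : Matrix (Fin n) (Fin n) ℝ) (i : Fin n) (y : Rd n) :
    inner ℝ (WithLp.toLp 2 (U i) : Rd n) y = (U *ᵥ y.ofLp) i := by
  rw [EuclideanSpace.inner_eq_star_dotProduct, Matrix.mulVec, dotProduct_comm]
  rfl

theorem orthonormal_rows {U : Matrix (Fin n) (Fin n) ℝ} (hU : Uᵀ * U = 1) :
    Orthonormal ℝ fun i => (WithLp.toLp 2 (U i) : Rd n) := by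
  have hU' : U * Uᵀ = 1 := mul_eq_one_comm.1 hU
  rw [orthonormal_iff_ite]
  intro i j
  rw [inner_row]
  have := congrFun (congrFun hU' i) j
  rw [Matrix.mul_apply, Matrix.one_apply] at this
  exact this

/-- The excess of `(ν + n) ∫ max` over the sum of exponents, for a law that puts little mass on
proper subspaces. -/
theorem sum_lt_integral_supportMax {ν : ℝ} (hν : 0 < ν) {Q : Law n}
    (hQ : Q ∈ scatterDomain n (ν + n)) {U : Matrix (Fin n) (Fin n) ℝ} (hU : Uᵀ * U = 1)
    {s : Fin n → ℝ} (hs : s ≠ 0)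
    (hInt : Integrable (fun y : Rd n => supportMax (fun i => (U *ᵥ y.ofLp) i ^ 2) s)
      (Q : Measure (Rd n))) :
    ∑ i, s i < (ν + n) * ∫ y : Rd n, supportMax (fun i => (U *ᵥ y.ofLp) i ^ 2) s
      ∂(Q : Measure (Rd n)) := by
  classical
  have hνn : 0 < ν + n := by positivity
  set m : Rd n → ℝ := fun y => supportMax (fun i => (U *ᵥ y.ofLp) i ^ 2) s with hm
  have hm0 : ∀ y, 0 ≤ m y := fun y => supportMax_nonneg _ _
  by_cases hpos : ∃ j, 0 < s j
  swap
  -- If no exponent is positive, the sum is strictly negative because `s ≠ 0`, while the integral is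
  -- nonnegative.
  · push Not at hpos
    have h1 : ∑ i, s i < 0 := by
      obtain ⟨j, hj⟩ : ∃ j, s j ≠ 0 := by
        by_contra hcon
        push Not at hcon
        exact hs (funext hcon)
      exact Finset.sum_neg' (fun i _ => hpos i)
        ⟨j, Finset.mem_univ j, lt_of_le_of_ne (hpos j) hj⟩
    exact h1.trans_le (mul_nonneg hνn.le (integral_nonneg hm0))
  obtain ⟨j, hj⟩ := hpos
  -- Layer-cake comparison: `N c` counts the exponents above `c`, so `∫_0^∞ N` is the sum of the
  -- positive parts of the `s_i`, and `q c` is the mass of `{m > c}`, so `∫_0^∞ q = ∫ m`. The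
  -- subspace condition compares `N` and `(ν + n) q` level by level.
  set N : ℝ → ℝ := fun c => ∑ i, (Set.Iio (s i)).indicator (fun _ => (1 : ℝ)) c with hN
  set q : ℝ → ℝ := fun c => (Q : Measure (Rd n)).real {y | c < m y} with hq
  have hNcard : ∀ c, N c = Fintype.card {i // c < s i} := fun c => by
    rw [Fintype.card_subtype, hN]
    simp [Set.indicator_apply]
  have hle : ∀ c, 0 < c → N c ≤ (ν + n) * q c ∧ (c < s j → N c < (ν + n) * q c) := by
    intro c hc
    have hlt : 0 < Fintype.card {i // c < s i} → N c < (ν + n) * q c := by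
      intro hcard
      have hort : Orthonormal ℝ fun i : {i // c < s i} => (WithLp.toLp 2 (U i) : Rd n) :=
        (orthonormal_rows hU).comp _ Subtype.val_injective
      have hfin := finrank_orthogonal_span hort
      have h1 := hQ (Submodule.span ℝ (Set.range fun i : {i // c < s i} =>
        (WithLp.toLp 2 (U i) : Rd n)))ᗮ (by omega)
      -- The maximum is at most `c` exactly when `y` is orthogonal to every row of `U` whose
      -- exponent exceeds `c`: a subspace of dimension `n - N c`.
      have hset : {y | c < m y} = ((Submodule.span ℝ (Set.range fun i : {i // c < s i} =>
          (WithLp.toLp 2 (U i) : Rd n)))ᗮ : Set (Rd n))ᶜ := by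
        ext y
        rw [Set.mem_ofPred_eq, hm, lt_supportMax_iff hc.le, Set.mem_compl_iff, SetLike.mem_coe,
          mem_orthogonal_span_iff]
        simp only [inner_row, Subtype.forall, not_forall]
        constructor
        · rintro ⟨i, h2, h3⟩
          exact ⟨i, h3, fun h0 => h2 (by rw [h0]; ring)⟩
        · rintro ⟨i, h2, h3⟩
          exact ⟨i, pow_ne_zero 2 h3, h2⟩
      have hqc : q c = 1 - (Q : Measure (Rd n)).real ((Submodule.span ℝ (Set.range
          fun i : {i // c < s i} => (WithLp.toLp 2 (U i) : Rd n)))ᗮ : Set (Rd n)) := by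
        rw [hq]
        simp only
        rw [hset, probReal_compl_eq_one_sub (Submodule.closed_of_finiteDimensional _).measurableSet]
      have hcast : (n : ℝ) - Module.finrank ℝ (Submodule.span ℝ (Set.range
          fun i : {i // c < s i} => (WithLp.toLp 2 (U i) : Rd n)))ᗮ =
          Fintype.card {i // c < s i} := by
        have h2 := congrArg (Nat.cast : ℕ → ℝ) hfin
        push_cast at h2
        linarith
      rw [hcast] at h1
      rw [hqc, hNcard]
      have h3 : (Fintype.card {i // c < s i} : ℝ) / (ν + n) * (ν + n) =
        Fintype.card {i // c < s i} := div_mul_cancel₀ _ hνn.ne'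
      nlinarith
    rcases Nat.eq_zero_or_pos (Fintype.card {i // c < s i}) with h0 | h0
    · refine ⟨?_, fun h => ?_⟩
      · rw [hNcard, h0, Nat.cast_zero]
        exact mul_nonneg hνn.le measureReal_nonneg
      · have : Nonempty {i // c < s i} := ⟨⟨j, h⟩⟩
        exact absurd h0 Fintype.card_ne_zero
    · exact ⟨(hlt h0).le, fun _ => hlt h0⟩
  have hlayer : ∫ y, m y ∂(Q : Measure (Rd n)) = ∫ c in Set.Ioi 0, q c :=
    hInt.integral_eq_integral_meas_lt (Filter.Eventually.of_forall hm0)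
  have hNi : ∀ i, IntegrableOn ((Set.Iio (s i)).indicator fun _ => (1 : ℝ)) (Set.Ioi 0) := by
    intro i
    rw [IntegrableOn, integrable_indicator_iff measurableSet_Iio]
    refine integrableOn_const ?_
    rw [Measure.restrict_apply measurableSet_Iio, Set.Iio_inter_Ioi, Real.volume_Ioo]
    exact ENNReal.ofReal_ne_top
  have hNint : IntegrableOn N (Set.Ioi 0) := integrable_finsetSum _ fun i _ => hNi i
  have hNval : ∑ i, s i ≤ ∫ c in Set.Ioi 0, N c := by
    rw [hN, integral_finsetSum _ fun i _ => hNi i]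
    refine Finset.sum_le_sum fun i _ => ?_
    rw [integral_indicator measurableSet_Iio, Measure.restrict_restrict measurableSet_Iio,
      Set.Iio_inter_Ioi, setIntegral_const, smul_eq_mul, mul_one, Real.volume_real_Ioo]
    exact le_trans (by linarith) (le_max_left _ _)
  have hqint : IntegrableOn q (Set.Ioi 0) := by
    have hanti : Antitone q := fun c c' h =>
      measureReal_mono (fun y (hy : c' < m y) => lt_of_le_of_lt h hy)
    have hbd : Integrable ((Set.Iio (∑ i, |s i| + 1)).indicator fun _ => (1 : ℝ))
        (volume.restrict (Set.Ioi 0)) := by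
      rw [integrable_indicator_iff measurableSet_Iio]
      refine integrableOn_const ?_
      rw [Measure.restrict_apply measurableSet_Iio, Set.Iio_inter_Ioi, Real.volume_Ioo]
      exact ENNReal.ofReal_ne_top
    refine hbd.mono' hanti.measurable.aestronglyMeasurable (Filter.Eventually.of_forall fun c => ?_)
    rw [Real.norm_of_nonneg measureReal_nonneg]
    by_cases hc : c < ∑ i, |s i| + 1
    · rw [Set.indicator_of_mem (show c ∈ Set.Iio _ from hc)]
      exact measureReal_le_one
    · rw [Set.indicator_of_notMem (show c ∉ Set.Iio _ from hc)]
      have : {y | c < m y} = ∅ := Set.eq_empty_of_forall_notMem fun y (hy : c < m y) => by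
        have := supportMax_le_sum (fun i => (U *ᵥ y.ofLp) i ^ 2) s
        simp only [hm] at hy
        linarith
      simp [this]
  -- The inequality between levels is strict on `(0, s_j)`, an interval of positive length.
  have hdiff : 0 < ∫ c in Set.Ioi 0, ((ν + n) * q c - N c) := by
    rw [integral_pos_iff_support_of_nonneg_ae]
    · refine lt_of_lt_of_le ?_ (measure_mono (s := Set.Ioo 0 (s j)) fun c hc => ?_)
      · rw [Measure.restrict_apply measurableSet_Ioo,
          Set.inter_eq_left.2 (Set.Ioo_subset_Ioi_self), Real.volume_Ioo, ENNReal.ofReal_pos]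
        linarith
      · have := (hle c hc.1).2 hc.2
        rw [Function.mem_support]
        linarith
    · refine (ae_restrict_iff' measurableSet_Ioi).2 (Filter.Eventually.of_forall fun c hc => ?_)
      have := (hle c hc).1
      rw [Pi.zero_apply]
      linarith
    · exact (hqint.const_mul _).sub hNint
  rw [integral_sub (hqint.const_mul _) hNint, integral_const_mul, ← hlayer] at hdiff
  linarith

end Orthogonal

/-! ### Existence of a minimum by compactness of directions -/

section Existence

variable {n : ℕ}

/-- The symmetric matrix `U' diag(exp s) U`. -/
def expMat (p : Matrix (Fin n) (Fin n) ℝ × (Fin n → ℝ)) : SymMat n :=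
  ⟨p.1ᵀ * Matrix.diagonal (fun i => Real.exp (p.2 i)) * p.1, by
    change (p.1ᵀ * Matrix.diagonal (fun i => Real.exp (p.2 i)) * p.1)ᵀ = _
    rw [Matrix.transpose_mul, Matrix.transpose_mul, Matrix.transpose_transpose,
      Matrix.diagonal_transpose, Matrix.mul_assoc]⟩

/-- The orthogonal matrices. -/
def orthoSet (n : ℕ) : Set (Matrix (Fin n) (Fin n) ℝ) := {U | Uᵀ * U = 1}

theorem quadForm_expMat (p : Matrix (Fin n) (Fin n) ℝ × (Fin n → ℝ)) (y : Rd n) :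
    quadForm (expMat p : Matrix (Fin n) (Fin n) ℝ) y =
      ∑ i, Real.exp (p.2 i) * (p.1 *ᵥ y.ofLp) i ^ 2 :=
  quadForm_conj_diagonal p.1 _ y

theorem norm_sq_eq_of_mem_orthoSet {U : Matrix (Fin n) (Fin n) ℝ} (hU : U ∈ orthoSet n)
    (y : Rd n) : ‖y‖ ^ 2 = ∑ i, (U *ᵥ y.ofLp) i ^ 2 := by
  rw [← quadForm_one, ← quadForm_transpose_mul_self, show Uᵀ * U = 1 from hU]

theorem expMat_mem_posMat {U : Matrix (Fin n) (Fin n) ℝ} (hU : U ∈ orthoSet n) (s : Fin n → ℝ) :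
    expMat (U, s) ∈ PosMat n := by
  refine posDef_of_quadForm_pos fun y hy => ?_
  rw [quadForm_expMat]
  have h1 : 0 < ∑ i, (U *ᵥ y.ofLp) i ^ 2 := by
    rw [← norm_sq_eq_of_mem_orthoSet hU]
    have := norm_pos_iff.2 hy
    positivity
  obtain ⟨i, hi, hpos⟩ := Finset.exists_lt_of_sum_lt (s := Finset.univ) (f := fun _ => (0 : ℝ))
    (by simpa using h1)
  exact Finset.sum_pos' (fun i _ => by positivity) ⟨i, hi, mul_pos (Real.exp_pos _) hpos⟩

theorem log_det_expMat {U : Matrix (Fin n) (Fin n) ℝ} (hU : U ∈ orthoSet n) (s : Fin n → ℝ) :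
    Real.log (expMat (U, s) : Matrix (Fin n) (Fin n) ℝ).det = ∑ i, s i := by
  have h : U.det * U.det = 1 := by
    rw [← Matrix.det_one (n := Fin n), ← show Uᵀ * U = 1 from hU, Matrix.det_mul,
      Matrix.det_transpose]
  have h2 : (expMat (U, s) : Matrix (Fin n) (Fin n) ℝ).det = Real.exp (∑ i, s i) := by
    change (Uᵀ * Matrix.diagonal (fun i => Real.exp (s i)) * U).det = _
    rw [Matrix.det_mul, Matrix.det_mul, Matrix.det_transpose, Matrix.det_diagonal, Real.exp_sum]
    linear_combination (∏ i, Real.exp (s i)) * h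
  rw [h2, Real.log_exp]

theorem logRatio_expMat {U : Matrix (Fin n) (Fin n) ℝ} (hU : U ∈ orthoSet n) (ν : ℝ)
    (s : Fin n → ℝ) (y : Rd n) : logRatio ν (expMat (U, s)) y =
      logSumRatio ν (fun i => (U *ᵥ y.ofLp) i ^ 2) s := by
  rw [logRatio, quadForm_expMat, norm_sq_eq_of_mem_orthoSet hU, logSumRatio]

theorem continuous_expMat : Continuous (expMat (n := n)) := by
  refine SymMat.continuous_of_entries fun i j => ?_
  have h : (fun p : Matrix (Fin n) (Fin n) ℝ × (Fin n → ℝ) =>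
      (expMat p : Matrix (Fin n) (Fin n) ℝ) i j) =
      fun p => ∑ k, p.1 k i * Real.exp (p.2 k) * p.1 k j := by
    ext p
    change (p.1ᵀ * Matrix.diagonal (fun i => Real.exp (p.2 i)) * p.1) i j = _
    rw [Matrix.mul_apply]
    simp only [Matrix.mul_diagonal, Matrix.transpose_apply]
  rw [h]
  have h1 : ∀ k l, Continuous fun p : Matrix (Fin n) (Fin n) ℝ × (Fin n → ℝ) => p.1 k l :=
    fun k l => (continuous_apply_apply k l).comp continuous_fst
  have h2 : ∀ k, Continuous fun p : Matrix (Fin n) (Fin n) ℝ × (Fin n → ℝ) => p.2 k :=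
    fun k => (continuous_apply k).comp continuous_snd
  exact continuous_finsetSum _ fun k _ =>
    ((h1 k i).mul (Real.continuous_exp.comp (h2 k))).mul (h1 k j)

/-- Orthogonality is a system of polynomial equations in the entries, and unit columns keep every
entry in `[-1, 1]`. -/
theorem isCompact_orthoSet : IsCompact (orthoSet n) := by
  have hc : IsCompact (Set.univ.pi fun _ : Fin n => Set.univ.pi fun _ : Fin n =>
      Set.Icc (-1 : ℝ) 1) := isCompact_univ_pi fun _ => isCompact_univ_pi fun _ => isCompact_Icc
  refine IsCompact.of_isClosed_subset (X := Matrix (Fin n) (Fin n) ℝ) hc ?_ fun U hU => ?_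
  · have : orthoSet n = ⋂ i, ⋂ j, {U : Matrix (Fin n) (Fin n) ℝ |
        ∑ k, U k i * U k j = (1 : Matrix (Fin n) (Fin n) ℝ) i j} := by
      ext U
      simp only [Set.mem_iInter]
      constructor
      · intro h i j
        have h1 := congrFun (congrFun (show Uᵀ * U = 1 from h) i) j
        rw [Matrix.mul_apply] at h1
        exact h1
      · intro h
        change Uᵀ * U = 1
        ext i j
        rw [Matrix.mul_apply]
        exact h i j
    rw [this]
    refine isClosed_iInter fun i => isClosed_iInter fun j => isClosed_eq ?_ continuous_const
    exact continuous_finsetSum _ fun k _ =>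
      (continuous_apply_apply k i).mul (continuous_apply_apply k j)
  · intro i _ j _
    have h1 := congrFun (congrFun (show Uᵀ * U = 1 from hU) j) j
    rw [Matrix.mul_apply, Matrix.one_apply_eq] at h1
    have h2 : U i j * U i j ≤ ∑ k, Uᵀ j k * U k j :=
      Finset.single_le_sum (f := fun k => Uᵀ j k * U k j)
        (fun k _ => mul_self_nonneg (U k j)) (Finset.mem_univ i)
    rw [h1] at h2
    exact abs_le.1 (abs_le_one_iff_mul_self_le_one.2 h2)

theorem continuousOn_scatterObj_symInv {ν : ℝ} (hν : 0 < ν) (Q : Law n) :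
    ContinuousOn (fun B : SymMat n => scatterObj ν Q (symInv B)) (PosMat n) := fun C hC => by
  obtain ⟨L, -, hL⟩ := hasFDerivAt_scatterObj_symInv hν Q hC
  exact hL.continuousAt.continuousWithinAt

theorem scatterObj_expMat {ν : ℝ} (hν : 0 < ν) (Q : Law n) {U : Matrix (Fin n) (Fin n) ℝ}
    (hU : U ∈ orthoSet n) (s : Fin n → ℝ) : scatterObj ν Q (symInv (expMat (U, s))) =
      -(1 / 2) * ∑ i, s i + (ν + n) / 2 *
        ∫ y : Rd n, logSumRatio ν (fun i => (U *ᵥ y.ofLp) i ^ 2) s ∂(Q : Measure (Rd n)) := by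
  rw [scatterObj_symInv hν Q (expMat_mem_posMat hU s), log_det_expMat hU]
  simp only [logRatio_expMat hU]

theorem integrable_logSumRatio {ν : ℝ} (hν : 0 < ν) (Q : Law n) {U : Matrix (Fin n) (Fin n) ℝ}
    (hU : U ∈ orthoSet n) (s : Fin n → ℝ) :
    Integrable (fun y : Rd n => logSumRatio ν (fun i => (U *ᵥ y.ofLp) i ^ 2) s)
      (Q : Measure (Rd n)) := by
  have := integrable_logRatio hν Q (expMat_mem_posMat hU s)
  rwa [show logRatio ν (expMat (U, s)) = _ from funext fun y => logRatio_expMat hU ν s y] at this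

/-- The log-determinant is linear in `s` and the logarithmic integral satisfies
`mul_logSumRatio_le`. So positivity at one point of a ray persists at all farther points. -/
theorem mul_scatterObj_expMat_le {ν : ℝ} (hν : 0 < ν) (Q : Law n) {U : Matrix (Fin n) (Fin n) ℝ}
    (hU : U ∈ orthoSet n) (s : Fin n → ℝ) {p : ℝ} (hp : 1 ≤ p) :
    p * scatterObj ν Q (symInv (expMat (U, s))) ≤
      scatterObj ν Q (symInv (expMat (U, p • s))) := by
  rw [scatterObj_expMat hν Q hU, scatterObj_expMat hν Q hU]
  have h1 : p * ∫ y : Rd n, logSumRatio ν (fun i => (U *ᵥ y.ofLp) i ^ 2) s ∂(Q : Measure (Rd n)) ≤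
      ∫ y : Rd n, logSumRatio ν (fun i => (U *ᵥ y.ofLp) i ^ 2) (p • s) ∂(Q : Measure (Rd n)) := by
    rw [← integral_const_mul]
    exact integral_mono ((integrable_logSumRatio hν Q hU s).const_mul p)
      (integrable_logSumRatio hν Q hU _)
      fun y => mul_logSumRatio_le hν (fun i => sq_nonneg _) s hp
  have h2 : ∑ i, (p • s) i = p * ∑ i, s i := by
    rw [Finset.mul_sum]; rfl
  rw [h2]
  have h3 := mul_le_mul_of_nonneg_left h1 (show 0 ≤ (ν + n) / 2 by positivity)
  linarith

/-- Along each ray the objective function is eventually positive. -/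
theorem exists_scatterObj_expMat_pos {ν : ℝ} (hν : 0 < ν) {Q : Law n}
    (hQ : Q ∈ scatterDomain n (ν + n)) {U : Matrix (Fin n) (Fin n) ℝ} (hU : U ∈ orthoSet n)
    {s : Fin n → ℝ} (hs : s ≠ 0) :
    ∃ t : ℝ, 1 ≤ t ∧ 0 < scatterObj ν Q (symInv (expMat (U, t • s))) := by
  set a : Rd n → Fin n → ℝ := fun y i => (U *ᵥ y.ofLp) i ^ 2 with ha
  have ha0 : ∀ y i, 0 ≤ a y i := fun y i => sq_nonneg _
  have hB : 0 ≤ ∑ i, |s i| := Finset.sum_nonneg fun i _ => abs_nonneg _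
  -- Dominated convergence of the slopes, with the bound `∑ |s_i|` that does not depend on `y`.
  have hlim : Filter.Tendsto (fun k : ℕ => ∫ y, logSumRatio ν (a y) (((k : ℝ) + 1) • s) /
      ((k : ℝ) + 1) ∂(Q : Measure (Rd n))) Filter.atTop
      (nhds (∫ y, supportMax (a y) s ∂(Q : Measure (Rd n)))) := by
    refine tendsto_integral_of_dominated_convergence (fun _ => ∑ i, |s i|) (fun k => ?_)
      (integrable_const _) (fun k => Filter.Eventually.of_forall fun y => ?_)
      (Filter.Eventually.of_forall fun y => tendsto_logSumRatio_div hν (ha0 y) s)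
    · exact ((integrable_logSumRatio hν Q hU _).div_const _).aestronglyMeasurable
    · have hk : (0 : ℝ) < (k : ℝ) + 1 := by positivity
      rw [Real.norm_eq_abs, abs_le]
      constructor
      · rw [le_div_iff₀ hk]
        have := neg_le_logSumRatio hν (ha0 y) s hk.le
        linarith
      · rw [div_le_iff₀ hk]
        have h1 := logSumRatio_le hν (ha0 y) s hk.le
        have h2 := mul_le_mul_of_nonneg_left (supportMax_le_sum (a y) s) hk.le
        linarith
  have hInt : Integrable (fun y => supportMax (a y) s) (Q : Measure (Rd n)) := by
    have hmeas : AEStronglyMeasurable (fun y => supportMax (a y) s) (Q : Measure (Rd n)) :=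
      aestronglyMeasurable_of_tendsto_ae Filter.atTop
        (fun k : ℕ => ((integrable_logSumRatio hν Q hU (((k : ℝ) + 1) • s)).div_const
          ((k : ℝ) + 1)).aestronglyMeasurable)
        (Filter.Eventually.of_forall fun y => tendsto_logSumRatio_div hν (ha0 y) s)
    refine Integrable.of_bound hmeas (∑ i, |s i|) (Filter.Eventually.of_forall fun y => ?_)
    rw [Real.norm_of_nonneg (supportMax_nonneg _ _)]
    exact supportMax_le_sum _ _
  have hgt := sum_lt_integral_supportMax hν hQ hU hs hInt
  have hνn : 0 < ν + n := by positivity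
  -- The limiting slope strictly exceeds `∑ s_i`, so some finite `k` already does better than the
  -- log-determinant term.
  have hev := (hlim.const_mul (ν + n)).eventually (lt_mem_nhds hgt)
  obtain ⟨k, hk⟩ := hev.exists
  have hk1 : (0 : ℝ) < (k : ℝ) + 1 := by positivity
  refine ⟨(k : ℝ) + 1, by linarith [Nat.cast_nonneg (α := ℝ) k], ?_⟩
  rw [scatterObj_expMat hν Q hU]
  rw [integral_div, mul_div_assoc', lt_div_iff₀ hk1] at hk
  have h2 : ∑ i, (((k : ℝ) + 1) • s) i = ((k : ℝ) + 1) * ∑ i, s i := by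
    rw [Finset.mul_sum]; rfl
  rw [h2]
  linarith

/-- The pairs (orthogonal frame, unit direction) form a compact set, so the radius beyond which the
objective is positive can be chosen uniformly. -/
theorem exists_scatterObj_pos_of_le_norm {ν : ℝ} (hν : 0 < ν) {Q : Law n}
    (hQ : Q ∈ scatterDomain n (ν + n)) : ∃ N : ℝ, ∀ U ∈ orthoSet n, ∀ s : Fin n → ℝ, ‖s‖ = 1 →
      ∀ t, N ≤ t → 0 < scatterObj ν Q (symInv (expMat (U, t • s))) := by
  set K := orthoSet n ×ˢ Metric.sphere (0 : Fin n → ℝ) 1 with hK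
  have hKc : IsCompact K := isCompact_orthoSet.prod (isCompact_sphere _ _)
  have key : ∃ N : ℝ, ∀ p ∈ K, ∀ t, N ≤ t →
      0 < scatterObj ν Q (symInv (expMat (p.1, t • p.2))) := by
    refine hKc.induction_on (p := fun T => ∃ N : ℝ, ∀ p ∈ T, ∀ t, N ≤ t →
      0 < scatterObj ν Q (symInv (expMat (p.1, t • p.2)))) ⟨0, by simp⟩ ?_ ?_ ?_
    · rintro S T hST ⟨N, hN⟩
      exact ⟨N, fun p hp => hN p (hST hp)⟩
    · rintro S T ⟨N, hN⟩ ⟨M, hM⟩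
      refine ⟨max N M, fun p hp t ht => ?_⟩
      rcases hp with hp | hp
      · exact hN p hp t ((le_max_left _ _).trans ht)
      · exact hM p hp t ((le_max_right _ _).trans ht)
    · rintro ⟨U, s⟩ ⟨hU, hs⟩
      have hs1 : ‖s‖ = 1 := by simpa using hs
      obtain ⟨t, ht, hpos⟩ := exists_scatterObj_expMat_pos hν hQ hU (s := s)
        (by rintro rfl; simp at hs1)
      have hcont : ContinuousOn (fun p : Matrix (Fin n) (Fin n) ℝ × (Fin n → ℝ) =>
          scatterObj ν Q (symInv (expMat (p.1, t • p.2)))) K := by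
        refine (continuousOn_scatterObj_symInv hν Q).comp (f := fun p :
          Matrix (Fin n) (Fin n) ℝ × (Fin n → ℝ) => expMat (p.1, t • p.2)) ?_ ?_
        · exact (continuous_expMat.comp
            (continuous_fst.prodMk (continuous_snd.const_smul t))).continuousOn
        · exact fun p hp => expMat_mem_posMat hp.1 _
      -- Continuity spreads positivity at the fixed `t` to nearby pairs, and the scaling inequality
      -- extends it from `t` to every larger `t'`.
      have hev := (hcont (U, s) ⟨hU, hs⟩).eventually (lt_mem_nhds hpos)
      refine ⟨_, Filter.inter_mem hev self_mem_nhdsWithin, t, ?_⟩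
      rintro p ⟨hp1, hp2⟩ t' ht'
      have hp1' : 0 < scatterObj ν Q (symInv (expMat (p.1, t • p.2))) := hp1
      have h1 : t' • p.2 = (t' / t) • (t • p.2) := by
        rw [smul_smul, div_mul_cancel₀ _ (by linarith)]
      have h2 : 1 ≤ t' / t := (one_le_div (by linarith)).2 ht'
      rw [h1]
      exact lt_of_lt_of_le (mul_pos (by linarith) hp1') (mul_scatterObj_expMat_le hν Q hp2.1 _ h2)
  obtain ⟨N, hN⟩ := key
  exact ⟨N, fun U hU s hs => hN (U, s) ⟨hU, by simpa using hs⟩⟩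

theorem exists_eq_expMat {C : SymMat n} (hC : C ∈ PosMat n) :
    ∃ U ∈ orthoSet n, ∃ s, C = expMat (U, s) := by
  obtain ⟨U, w, hU, hUC, hw⟩ := exists_orthogonal_diagonalization
    (show (C : Matrix (Fin n) (Fin n) ℝ).PosDef from hC)
  refine ⟨U, hU, fun i => Real.log (w i), Subtype.ext ?_⟩
  change (C : Matrix (Fin n) (Fin n) ℝ) =
    Uᵀ * Matrix.diagonal (fun i => Real.exp (Real.log (w i))) * U
  simp only [Real.exp_log (hw _)]
  exact hUC.symm

/-- The objective is 0 at the identity and positive outside a compact set of parameters, so a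
minimum over that set is global. -/
theorem exists_isMin_scatterObj {ν : ℝ} (hν : 0 < ν) {Q : Law n}
    (hQ : Q ∈ scatterDomain n (ν + n)) : ∃ C ∈ PosMat n, ∀ B ∈ PosMat n,
      scatterObj ν Q (symInv C) ≤ scatterObj ν Q (symInv B) := by
  obtain ⟨N, hN⟩ := exists_scatterObj_pos_of_le_norm hν hQ
  set K := orthoSet n ×ˢ Metric.closedBall (0 : Fin n → ℝ) (max N 0) with hK
  have hKc : IsCompact K := isCompact_orthoSet.prod (isCompact_closedBall _ _)
  have h1 : (1 : Matrix (Fin n) (Fin n) ℝ) ∈ orthoSet n := by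
    change (1 : Matrix (Fin n) (Fin n) ℝ)ᵀ * 1 = 1
    rw [Matrix.transpose_one, Matrix.mul_one]
  have h10 : ((1 : Matrix (Fin n) (Fin n) ℝ), (0 : Fin n → ℝ)) ∈ K :=
    ⟨h1, Metric.mem_closedBall_self (le_max_right _ _)⟩
  have hcont : ContinuousOn (fun p => scatterObj ν Q (symInv (expMat p))) K :=
    (continuousOn_scatterObj_symInv hν Q).comp continuous_expMat.continuousOn
      fun p hp => expMat_mem_posMat hp.1 _
  obtain ⟨p, hp, hmin⟩ := hKc.exists_isMinOn ⟨_, h10⟩ hcont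
  refine ⟨expMat p, expMat_mem_posMat hp.1 _, fun B hB => ?_⟩
  obtain ⟨U, hU, s, rfl⟩ := exists_eq_expMat hB
  by_cases hs : ‖s‖ ≤ max N 0
  · exact hmin (show (U, s) ∈ K from ⟨hU, by simpa using hs⟩)
  · push Not at hs
    have hs0 : 0 < ‖s‖ := lt_of_le_of_lt (le_max_right _ _) hs
    have h2 := hN U hU (‖s‖⁻¹ • s) (by rw [norm_smul, norm_inv, norm_norm, inv_mul_cancel₀ hs0.ne'])
      ‖s‖ ((le_max_left _ _).trans hs.le)
    rw [smul_smul, mul_inv_cancel₀ hs0.ne', one_smul] at h2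
    have h3 : scatterObj ν Q (symInv (expMat p)) ≤ scatterObj ν Q (symInv (expMat (1, 0))) :=
      hmin h10
    have h4 : scatterObj ν Q (symInv (expMat ((1 : Matrix (Fin n) (Fin n) ℝ), 0))) = 0 := by
      rw [scatterObj_expMat hν Q h1]
      simp [logSumRatio]
    linarith

theorem exists_critical {ν : ℝ} (hν : 0 < ν) {Q : Law n} (hQ : Q ∈ scatterDomain n (ν + n)) :
    ∃ C ∈ PosMat n, blRatio_id.scoreEq ν (lawToDual Q, C) = 0 := by
  obtain ⟨C, hC, hmin⟩ := exists_isMin_scatterObj hν hQ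
  refine ⟨C, hC, ?_⟩
  obtain ⟨L, hL, hd⟩ := hasFDerivAt_scatterObj_symInv hν Q hC
  have hloc : IsLocalMin (fun B : SymMat n => scatterObj ν Q (symInv B)) C := by
    filter_upwards [isOpen_posMat.mem_nhds hC] with B hB
    exact hmin B hB
  have hL0 := hloc.hasFDerivAt_eq_zero hd
  have h3 := hL (blRatio_id.scoreEq ν (lawToDual Q, C))
  rw [hL0, zero_apply] at h3
  refine SymMat.ext_entries fun k l => ?_
  have h4 := (Finset.sum_eq_zero_iff_of_nonneg fun k _ => Finset.sum_nonneg fun l _ =>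
    mul_self_nonneg _).1 h3.symm k (Finset.mem_univ k)
  exact mul_self_eq_zero.1 ((Finset.sum_eq_zero_iff_of_nonneg fun l _ =>
    mul_self_nonneg _).1 h4 l (Finset.mem_univ l))

/-- Two distinct critical points would each have a strictly smaller value than the other. -/
theorem isTScatter_of_critical {ν : ℝ} (hν : 0 < ν) (Q : Law n) {C : SymMat n} (hC : C ∈ PosMat n)
    (hcrit : blRatio_id.scoreEq ν (lawToDual Q, C) = 0) : IsTScatter ν Q (symInv C) where
  posDef := symInv_mem hC
  integrable := fun B hB => integrable_scatterH hν Q hB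
  critical := (critical_iff hν Q (symInv_mem hC)).2 (by rwa [symInv_symInv hC])
  unique := fun B hB h => by
    have h1 := (critical_iff hν Q hB).1 h
    by_contra hne
    have hne' : symInv B ≠ C := fun h2 => hne (by rw [← h2, symInv_symInv hB])
    have e1 := scatterObj_lt_of_critical hν Q hC (symInv_mem hB) hne' hcrit
    have e2 := scatterObj_lt_of_critical hν Q (symInv_mem hB) hC hne'.symm h1
    exact lt_asymm e1 e2
  minimal := fun B hB hne => by
    have hne' : symInv B ≠ C := fun h2 => hne (by rw [← h2, symInv_symInv hB])
    have := scatterObj_lt_of_critical hν Q hC (symInv_mem hB) hne' hcrit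
    rwa [symInv_symInv hB] at this

theorem isTScatter_tScatter {ν : ℝ} (hν : 0 < ν) {Q : Law n} (hQ : Q ∈ scatterDomain n (ν + n)) :
    IsTScatter ν Q (tScatter ν Q) := by
  obtain ⟨C, hC, hcrit⟩ := exists_critical hν hQ
  exact Classical.epsilon_spec ⟨_, isTScatter_of_critical hν Q hC hcrit⟩

/-- A solution of the score equation is the inverse of the scatter functional. -/
theorem eq_symInv_tScatter {ν : ℝ} (hν : 0 < ν) {Q : Law n} (hQ : Q ∈ scatterDomain n (ν + n))
    {C : SymMat n} (hC : C ∈ PosMat n) (hcrit : blRatio_id.scoreEq ν (lawToDual Q, C) = 0) :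
    C = symInv (tScatter ν Q) := by
  have h := isTScatter_tScatter hν hQ
  rw [← h.unique _ (symInv_mem hC) ((isTScatter_of_critical hν Q hC hcrit).critical),
    symInv_symInv hC]

theorem scoreEq_tScatter {ν : ℝ} (hν : 0 < ν) {Q : Law n} (hQ : Q ∈ scatterDomain n (ν + n)) :
    blRatio_id.scoreEq ν (lawToDual Q, symInv (tScatter ν Q)) = 0 :=
  have h := isTScatter_tScatter hν hQ
  (critical_iff hν Q h.posDef).1 h.critical

theorem exists_equiv_hasFDerivAt_scoreMap {ν : ℝ} (hν : 0 < ν) {Q : Law n}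
    (hQ : Q ∈ scatterDomain n (ν + n)) : ∃ D : SymMat n ≃L[ℝ] SymMat n,
      HasFDerivAt (fun C : SymMat n => scoreMap ν (lawToDual Q, symInv C))
        (D : SymMat n →L[ℝ] SymMat n) (symInv (tScatter ν Q)) := by
  have hpd := symInv_mem (isTScatter_tScatter hν hQ).posDef
  obtain ⟨D, hD⟩ := blRatio_id.exists_equiv_hasFDerivAt_scoreEq hν Q hpd (scoreEq_tScatter hν hQ)
  refine ⟨D, hD.congr_of_eventuallyEq ?_⟩
  filter_upwards [isOpen_posMat.mem_nhds hpd] with C hC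
  rw [scoreMap_eq_scoreEq hν _ (symInv_mem hC), symInv_symInv hC]
  rfl

end Existence

/-! ### The domain of the scatter functional is open -/

section DomainOpen

namespace BLRatio

variable {E : Type*} [PseudoMetricSpace E] {n m : ℕ} {y : E → Rd n}

/-- `1 - ∑ᵢ ⟨vᵢ, y⟩² / (1 + |y|²)` as an element of `BL E`. -/
def tilt (hy : BLRatio y) (v : Fin m → Rd n) : BL E :=
  1 - ∑ i, ∑ k, ∑ l, (v i k * v i l) • hy.ratio k l

theorem toFun_tilt (hy : BLRatio y) (v : Fin m → Rd n) (e : E) :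
    (hy.tilt v).toFun e = 1 - (∑ i, inner ℝ (v i) (y e) ^ 2) / (1 + ‖y e‖ ^ 2) := by
  rw [tilt, BL.toFun_sub, BL.toFun_one, BL.toFun_sum, Finset.sum_div]
  congr 1
  refine Finset.sum_congr rfl fun i _ => ?_
  have h := hy.toFun_linearCombination (Matrix.of fun k l => v i k * v i l) e
  simp only [Matrix.of_apply] at h
  rw [h, quadForm_eq_sum, EuclideanSpace.inner_eq_star_dotProduct]
  congr 1
  simp only [dotProduct, Matrix.of_apply, Pi.star_apply, star_trivial]
  rw [pow_two, Finset.sum_mul_sum]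
  exact Finset.sum_congr rfl fun k _ => Finset.sum_congr rfl fun l _ => by ring

/-- Continuity in the `BL` norm is immediate since only the scalar coefficients of finitely many
fixed elements depend on the frame. -/
theorem continuous_tilt (hy : BLRatio y) :
    Continuous fun v : Fin m → Rd n => hy.tilt v := by
  unfold tilt
  refine continuous_const.sub (continuous_finsetSum _ fun i _ => continuous_finsetSum _ fun k _ =>
    continuous_finsetSum _ fun l _ => ?_)
  have h : Continuous fun v : Fin m → Rd n => v i k * v i l := by fun_prop
  exact h.smul continuous_const

theorem toFun_tilt_mem (hy : BLRatio y) {v : Fin m → Rd n} (hv : Orthonormal ℝ v) (e : E) :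
    0 < (hy.tilt v).toFun e ∧ (hy.tilt v).toFun e ≤ 1 := by
  have h0 : (0 : ℝ) < 1 + ‖y e‖ ^ 2 := by positivity
  have h1 := hv.sum_inner_products_le (y e) (s := Finset.univ)
  simp only [Real.norm_eq_abs, sq_abs] at h1
  rw [toFun_tilt, sub_pos, div_lt_one h0]
  refine ⟨by linarith, sub_le_self _ (div_nonneg (Finset.sum_nonneg fun i _ => sq_nonneg _) h0.le)⟩

theorem toFun_tilt_eq_one_iff (hy : BLRatio y) (v : Fin m → Rd n) (e : E) :
    (hy.tilt v).toFun e = 1 ↔ y e ∈ (Submodule.span ℝ (Set.range v))ᗮ := by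
  have h0 : (0 : ℝ) < 1 + ‖y e‖ ^ 2 := by positivity
  rw [toFun_tilt, mem_orthogonal_span_iff, sub_eq_self, div_eq_zero_iff, or_iff_left h0.ne',
    Finset.sum_eq_zero_iff_of_nonneg fun i _ => sq_nonneg _]
  simp

/-- Functionals that satisfy the subspace condition with constant `a`. -/
def domainCondition (hy : BLRatio y) (a : ℝ) (Z : BL E → ℝ) : Prop :=
  ∀ m ∈ Finset.Icc 1 n, ∀ v : Fin m → Rd n, Orthonormal ℝ v → ∃ k : ℕ,
    Z (hy.tilt v ^ k) < 1 - m / a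

end BLRatio

theorem isCompact_setOf_orthonormal (m n : ℕ) :
    IsCompact {v : Fin m → Rd n | Orthonormal ℝ v} := by
  refine Metric.isCompact_of_isClosed_isBounded ?_ ?_
  · simp only [orthonormal_iff_ite, Set.ofPred_forall]
    exact isClosed_iInter fun i => isClosed_iInter fun j =>
      isClosed_eq (by fun_prop) continuous_const
  · refine (Metric.isBounded_iff_subset_closedBall 0).2 ⟨1, fun v hv => ?_⟩
    rw [mem_closedBall_zero_iff, pi_norm_le_iff_of_nonneg zero_le_one]
    exact fun i => (hv.1 i).le

/-- For one frame and one power the inequality is open jointly in the functional and the frame.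
Compactness of the frames then yields a common neighbourhood of the functional. The exponent may
vary with the frame. -/
theorem BLRatio.isOpen_domainCondition {E : Type*} [PseudoMetricSpace E] {n : ℕ} {y : E → Rd n}
    (hy : BLRatio y) {Z : Type*} [TopologicalSpace Z] {ev : Z → BL E → ℝ}
    (hev : Continuous fun p : Z × BL E => ev p.1 p.2) (a : ℝ) :
    IsOpen {z | hy.domainCondition a (ev z)} := by
  simp only [BLRatio.domainCondition, Set.ofPred_forall]
  refine (Finset.Icc 1 n).finite_toSet.isOpen_biInter fun m _ => ?_
  have h : {z | ∀ v : Fin m → Rd n, Orthonormal ℝ v → ∃ k : ℕ, ev z (hy.tilt v ^ k) < 1 - m / a} =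
      ⋂ v : Fin m → Rd n, ⋂ (_ : Orthonormal ℝ v),
        {z | ∃ k : ℕ, ev z (hy.tilt v ^ k) < 1 - m / a} := by
    simp only [Set.ofPred_forall]
  rw [← h, isOpen_iff_eventually]
  intro z hz
  refine (isCompact_setOf_orthonormal m n).eventually_forall_of_forall_eventually
    (P := fun z v => ∃ k : ℕ, ev z (hy.tilt v ^ k) < 1 - m / a) fun v hv => ?_
  obtain ⟨k, hk⟩ := hz v hv
  have hc : Continuous fun p : Z × (Fin m → Rd n) => ev p.1 (hy.tilt p.2 ^ k) :=
    hev.comp (continuous_fst.prodMk ((hy.continuous_tilt.comp continuous_snd).pow k))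
  filter_upwards [hc.continuousAt.eventually_lt continuousAt_const hk] with p hp
  exact ⟨k, hp⟩

section Measure

variable {E : Type*} [PseudoMetricSpace E] [MeasurableSpace E] [OpensMeasurableSpace E] {n : ℕ}
  {y : E → Rd n}

theorem BLRatio.measure_le_tilt {m : ℕ} (hy : BLRatio y) (hm : Measurable y)
    (μ : ProbabilityMeasure E)
    {v : Fin m → Rd n} (hv : Orthonormal ℝ v) (k : ℕ) :
    (μ : Measure E).real (y ⁻¹' ((Submodule.span ℝ (Set.range v))ᗮ : Set (Rd n))) ≤
      probToDual μ (hy.tilt v ^ k) := by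
  have hS : MeasurableSet (y ⁻¹' ((Submodule.span ℝ (Set.range v))ᗮ : Set (Rd n))) :=
    hm (Submodule.closed_of_finiteDimensional _).measurableSet
  rw [probToDual_apply, ← integral_indicator_one hS]
  refine integral_mono ((integrable_const 1).indicator hS) (BL.integrable _ _) fun e => ?_
  rw [BL.toFun_pow]
  by_cases he : e ∈ y ⁻¹' ((Submodule.span ℝ (Set.range v))ᗮ : Set (Rd n))
  · rw [Set.indicator_of_mem he, (hy.toFun_tilt_eq_one_iff v e).2 he, one_pow]
    rfl
  · rw [Set.indicator_of_notMem he]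
    exact (pow_pos (hy.toFun_tilt_mem hv e).1 k).le

/-- The tilt takes values in `(0, 1]` and equals 1 exactly when `y` lies in the subspace, so its
powers converge boundedly to the indicator. -/
theorem BLRatio.tendsto_tilt {m : ℕ} (hy : BLRatio y) (hm : Measurable y)
    (μ : ProbabilityMeasure E) {v : Fin m → Rd n} (hv : Orthonormal ℝ v) :
    Filter.Tendsto (fun k : ℕ => probToDual μ (hy.tilt v ^ k)) Filter.atTop
      (nhds ((μ : Measure E).real (y ⁻¹' ((Submodule.span ℝ (Set.range v))ᗮ : Set (Rd n))))) := by
  have hS : MeasurableSet (y ⁻¹' ((Submodule.span ℝ (Set.range v))ᗮ : Set (Rd n))) :=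
    hm (Submodule.closed_of_finiteDimensional _).measurableSet
  simp only [probToDual_apply, ← integral_indicator_one hS]
  refine tendsto_integral_of_dominated_convergence (fun _ => 1)
    (fun k => (BL.continuous _).measurable.aestronglyMeasurable) (integrable_const 1)
    (fun k => Filter.Eventually.of_forall fun e => ?_) (Filter.Eventually.of_forall fun e => ?_)
  · rw [BL.toFun_pow, Real.norm_eq_abs, abs_pow, abs_of_pos (hy.toFun_tilt_mem hv e).1]
    exact pow_le_one₀ (hy.toFun_tilt_mem hv e).1.le (hy.toFun_tilt_mem hv e).2
  · simp only [BL.toFun_pow]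
    by_cases he : e ∈ y ⁻¹' ((Submodule.span ℝ (Set.range v))ᗮ : Set (Rd n))
    · rw [Set.indicator_of_mem he, (hy.toFun_tilt_eq_one_iff v e).2 he]
      simp
    · rw [Set.indicator_of_notMem he]
      refine tendsto_pow_atTop_nhds_zero_of_lt_one (hy.toFun_tilt_mem hv e).1.le
        (lt_of_le_of_ne (hy.toFun_tilt_mem hv e).2 fun h => he ((hy.toFun_tilt_eq_one_iff v e).1 h))

/-- The integrals of the powers bound the mass of the subspace from above and converge to it, so a
strict bound on the mass holds exactly when some power satisfies it. Orthogonal complements of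
`m`-frames with `1 ≤ m ≤ n` are all the proper subspaces. -/
theorem BLRatio.domainCondition_iff (hy : BLRatio y) (hm : Measurable y) (a : ℝ)
    (μ : ProbabilityMeasure E) : hy.domainCondition a (probToDual μ) ↔
      μ.map hm.aemeasurable ∈ scatterDomain n a := by
  have hmap : ∀ H : Submodule ℝ (Rd n),
      ((μ.map hm.aemeasurable : Law n) : Measure (Rd n)).real (H : Set (Rd n)) =
        (μ : Measure E).real (y ⁻¹' (H : Set (Rd n))) := fun H => by
    rw [ProbabilityMeasure.toMeasure_map, map_measureReal_apply hm
      (Submodule.closed_of_finiteDimensional _).measurableSet]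
  constructor
  · intro h H hH
    rw [hmap]
    have hfin := Submodule.finrank_add_finrank_orthogonal H
    rw [finrank_euclideanSpace_fin] at hfin
    let b := stdOrthonormalBasis ℝ Hᗮ
    let v : Fin (Module.finrank ℝ Hᗮ) → Rd n := fun i => (b i : Rd n)
    have hv : Orthonormal ℝ v := b.orthonormal.comp_linearIsometry Hᗮ.subtypeₗᵢ
    have hspan : Submodule.span ℝ (Set.range v) = Hᗮ := by
      have h1 : Set.range v = Hᗮ.subtype '' Set.range b := by
        rw [← Set.range_comp]
        rfl
      have h2 : Submodule.span ℝ (Set.range b) = ⊤ := by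
        rw [← b.coe_toBasis]
        exact b.toBasis.span_eq
      rw [h1, Submodule.span_image, h2, Submodule.map_top, Submodule.range_subtype]
    obtain ⟨k, hk⟩ := h _ (Finset.mem_Icc.2 ⟨by omega, by omega⟩) v hv
    have h3 := hy.measure_le_tilt hm μ hv k
    rw [hspan, Submodule.orthogonal_orthogonal] at h3
    have h4 : ((Module.finrank ℝ Hᗮ : ℕ) : ℝ) = n - Module.finrank ℝ H := by
      rw [eq_sub_iff_add_eq']
      exact_mod_cast hfin
    rw [← h4]
    exact h3.trans_lt hk
  · intro h m hm' v hv
    have hfin := finrank_orthogonal_span hv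
    rw [Fintype.card_fin] at hfin
    have h1 := h (Submodule.span ℝ (Set.range v))ᗮ (by have := (Finset.mem_Icc.1 hm').1; omega)
    have h4 : (n : ℝ) - Module.finrank ℝ (Submodule.span ℝ (Set.range v))ᗮ = m := by
      rw [sub_eq_iff_eq_add']
      exact_mod_cast hfin.symm
    rw [hmap, h4] at h1
    exact ((hy.tendsto_tilt hm μ hv).eventually_lt_const h1).exists

end Measure

/-- Weak convergence handles the fixed function `f₀`, and `|∫ (f - f₀)| ≤ ‖f - f₀‖` holds uniformly
in the law. -/
theorem continuous_probToDual_apply {E : Type*} [PseudoMetricSpace E] [MeasurableSpace E]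
    [OpensMeasurableSpace E] :
    Continuous fun p : ProbabilityMeasure E × BL E => probToDual p.1 p.2 := by
  refine continuous_iff_continuousAt.2 fun ⟨μ₀, f₀⟩ => ?_
  have h1 : Continuous fun μ : ProbabilityMeasure E => probToDual μ f₀ :=
    ProbabilityMeasure.continuous_integral_boundedContinuousFunction
      (BoundedContinuousFunction.ofNormedAddCommGroup f₀.toFun f₀.continuous ‖f₀‖ f₀.abs_le_norm)
  have h2 : Filter.Tendsto (fun p : ProbabilityMeasure E × BL E => probToDual p.1 (p.2 - f₀))
      (nhds (μ₀, f₀)) (nhds 0) := by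
    have h3 : Filter.Tendsto (fun p : ProbabilityMeasure E × BL E => ‖p.2 - f₀‖)
        (nhds (μ₀, f₀)) (nhds 0) := by
      have : Continuous fun p : ProbabilityMeasure E × BL E => ‖p.2 - f₀‖ := by fun_prop
      simpa using this.tendsto (μ₀, f₀)
    refine squeeze_zero_norm (fun p => ?_) h3
    have h := norm_integral_le_of_norm_le_const (μ := (p.1 : Measure E)) (f := (p.2 - f₀).toFun)
      (C := ‖p.2 - f₀‖) (Filter.Eventually.of_forall fun y => (p.2 - f₀).abs_le_norm y)
    rw [probReal_univ, mul_one] at h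
    exact h
  have h4 := h2.add ((h1.comp continuous_fst).tendsto (μ₀, f₀))
  simp only [Function.comp_def, map_sub, sub_add_cancel, zero_add] at h4
  exact h4

theorem isOpen_scatterDomain (n : ℕ) (a : ℝ) : IsOpen (scatterDomain n a) := by
  have h := (blRatio_id (n := n)).isOpen_domainCondition
    (ev := fun Q : Law n => probToDual Q) continuous_probToDual_apply a
  convert! h using 1
  ext Q
  rw [Set.mem_ofPred_eq, blRatio_id.domainCondition_iff measurable_id]
  have : Q.map (measurable_id (α := Rd n)).aemeasurable = Q :=
    Subtype.ext Measure.map_id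
  exact iff_of_eq (congrArg (· ∈ scatterDomain n a) this.symm)

end DomainOpen

/-! ### Analytic functionals of laws -/

section Gluing

variable {Λ X W : Type*} [NormedAddCommGroup X] [NormedSpace ℝ X] [NormedAddCommGroup W]
  [NormedSpace ℝ W]

/-- Local analytic maps that agree near the laws in their domains glue to an analytic functional. -/
theorem analyticOnLaws_of_local {Φ : Λ → X} {T : Λ → W} {D : Set Λ} {O : Set X} (hO : IsOpen O)
    (hOD : ∀ P, Φ P ∈ O ↔ P ∈ D) {r : Λ → ℝ} {ψ : Λ → X → W} (hr : ∀ P ∈ D, 0 < r P)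
    (hψ : ∀ P ∈ D, AnalyticOnNhd ℝ (ψ P) (Metric.ball (Φ P) (r P)))
    (hT : ∀ P ∈ D, ψ P (Φ P) = T P)
    (hcomp : ∀ P ∈ D, ∀ Q ∈ D, Φ Q ∈ Metric.ball (Φ P) (r P) → ψ P =ᶠ[nhds (Φ Q)] ψ Q) :
    AnalyticOnLaws Φ T D := by
  classical
  have hsub : ∀ P ∈ D, Metric.ball (Φ P) (r P / 3) ⊆ Metric.ball (Φ P) (r P) := fun P hP =>
    Metric.ball_subset_ball (by have := hr P hP; linarith)
  have hagree' : ∀ P ∈ D, ∀ Q ∈ D, r Q ≤ r P → ∀ x, x ∈ Metric.ball (Φ P) (r P / 3) →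
      x ∈ Metric.ball (Φ Q) (r Q / 3) → ψ P x = ψ Q x := by
    intro P hP Q hQ hle x hxP hxQ
    -- The shrinking by 3 pays off here: the centres are at distance below `(r P + r Q)/3`, hence
    -- below `r P`, so `hcomp` applies at the centre of the smaller ball.
    have hPQ : Φ Q ∈ Metric.ball (Φ P) (r P) := by
      rw [Metric.mem_ball] at hxP hxQ ⊢
      have := dist_triangle_left (Φ Q) (Φ P) x
      have := hr P hP
      linarith
    -- An intersection of balls is convex, so the identity theorem propagates the agreement near `Φ
    -- Q` to all of it.
    have hpre : IsPreconnected (Metric.ball (Φ P) (r P) ∩ Metric.ball (Φ Q) (r Q)) :=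
      ((convex_ball _ _).inter (convex_ball _ _)).isPreconnected
    exact ((hψ P hP).mono Set.inter_subset_left).eqOn_of_preconnected_of_eventuallyEq
      ((hψ Q hQ).mono Set.inter_subset_right) hpre ⟨hPQ, Metric.mem_ball_self (hr Q hQ)⟩
      (hcomp P hP Q hQ hPQ) ⟨hsub P hP hxP, hsub Q hQ hxQ⟩
  have hagree : ∀ P ∈ D, ∀ Q ∈ D, ∀ x, x ∈ Metric.ball (Φ P) (r P / 3) →
      x ∈ Metric.ball (Φ Q) (r Q / 3) → ψ P x = ψ Q x := by
    intro P hP Q hQ x hxP hxQ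
    rcases le_total (r Q) (r P) with h | h
    · exact hagree' P hP Q hQ h x hxP hxQ
    · exact (hagree' Q hQ P hP h x hxQ hxP).symm
  -- The choice of `P` is immaterial by `hagree`; the value 0 occurs only outside the union of the
  -- small balls.
  let g : X → W := fun x => if h : ∃ P ∈ D, x ∈ Metric.ball (Φ P) (r P / 3) then ψ h.choose x else 0
  have hg : ∀ P ∈ D, ∀ x ∈ Metric.ball (Φ P) (r P / 3), g x = ψ P x := by
    intro P hP x hx
    have h : ∃ P ∈ D, x ∈ Metric.ball (Φ P) (r P / 3) := ⟨P, hP, hx⟩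
    simp only [g, dif_pos h]
    exact hagree _ h.choose_spec.1 P hP x h.choose_spec.2 hx
  have hself : ∀ P ∈ D, Φ P ∈ Metric.ball (Φ P) (r P / 3) := fun P hP =>
    Metric.mem_ball_self (by have := hr P hP; linarith)
  -- Intersecting with `O` removes images of laws outside `D` that might fall into one of the balls.
  refine ⟨O ∩ ⋃ P ∈ D, Metric.ball (Φ P) (r P / 3), g,
    hO.inter (isOpen_biUnion fun P _ => Metric.isOpen_ball), fun P => ?_, ?_, fun P hP => ?_⟩
  · refine ⟨fun h => (hOD P).1 h.1, fun h => ⟨(hOD P).2 h, ?_⟩⟩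
    exact Set.mem_biUnion h (hself P h)
  · rintro x ⟨-, hx⟩
    obtain ⟨P, hP, hxP⟩ := Set.mem_iUnion₂.1 hx
    refine (hψ P hP x (hsub P hP hxP)).congr ?_
    filter_upwards [Metric.isOpen_ball.mem_nhds hxP] with z hz
    exact (hg P hP z hz).symm
  · rw [hg P hP _ (hself P hP), hT P hP]

theorem AnalyticOnLaws.postcomp {V : Type*} [NormedAddCommGroup V] [NormedSpace ℝ V] {Φ : Λ → X}
    {T : Λ → W} {D : Set Λ} (hT : AnalyticOnLaws Φ T D) {h : W → V} {U : Set W} (hU : IsOpen U)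
    (hTU : ∀ P ∈ D, T P ∈ U) (hh : AnalyticOnNhd ℝ h U) :
    AnalyticOnLaws Φ (fun P => h (T P)) D := by
  obtain ⟨O, g, hO, hOD, hg, hgT⟩ := hT
  refine ⟨O ∩ g ⁻¹' U, fun x => h (g x), hg.continuousOn.isOpen_inter_preimage hO hU,
    fun P => ⟨fun hP => (hOD P).1 hP.1, fun hP => ⟨(hOD P).2 hP, ?_⟩⟩, fun x hx => ?_,
    fun P hP => congrArg h (hgT P hP)⟩
  · rw [Set.mem_preimage, hgT P hP]
    exact hTU P hP
  · exact AnalyticAt.comp (g := h) (f := g) (hh _ hx.2) (hg x hx.1)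

/-- A continuous linear map that matches the two embeddings of laws transfers analyticity. It is
applied to the passage from the Kolmogorov norm to a `BL` dual. -/
theorem AnalyticOnLaws.pullback {Λ' X' : Type*} [NormedAddCommGroup X'] [NormedSpace ℝ X']
    {Φ : Λ → X} {T : Λ → W} {D : Set Λ} (hT : AnalyticOnLaws Φ T D) {Φ' : Λ' → X'} {ι : Λ' → Λ}
    (Ψ : X' →L[ℝ] X) (hΨ : ∀ P, Ψ (Φ' P) = Φ (ι P)) :
    AnalyticOnLaws Φ' (fun P => T (ι P)) (ι ⁻¹' D) := by
  obtain ⟨O, g, hO, hOD, hg, hgT⟩ := hT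
  refine ⟨Ψ ⁻¹' O, fun x => g (Ψ x), hO.preimage Ψ.continuous, fun P => ?_, fun x hx => ?_,
    fun P hP => ?_⟩
  · rw [Set.mem_preimage, hΨ, hOD]
    rfl
  · exact AnalyticAt.comp (g := g) (f := Ψ) (hg _ hx) (Ψ.analyticAt x)
  · exact (congrArg g (hΨ P)).trans (hgT _ hP)

theorem AnalyticOnLaws.congr {Φ : Λ → X} {T T' : Λ → W} {D : Set Λ} (hT : AnalyticOnLaws Φ T D)
    (h : ∀ P ∈ D, T P = T' P) : AnalyticOnLaws Φ T' D := by
  obtain ⟨O, g, hO, hOD, hg, hgT⟩ := hT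
  exact ⟨O, g, hO, hOD, hg, fun P hP => (hgT P hP).trans (h P hP)⟩

end Gluing

/-! ### Analyticity of the scatter functional by implicit functions -/

section ScatterAnalytic

/-- The analytic implicit function theorem: a local analytic solution of `f (x, ψ x) = 0`, which is
the only one near the base point. -/
theorem exists_analytic_implicit {X V W : Type*} [NormedAddCommGroup X] [NormedSpace ℝ X]
    [CompleteSpace X] [NormedAddCommGroup V] [NormedSpace ℝ V] [CompleteSpace V]
    [NormedAddCommGroup W] [NormedSpace ℝ W] [CompleteSpace W] {f : X × V → W} {x₀ : X} {v₀ : V}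
    (hf : AnalyticAt ℝ f (x₀, v₀)) (h0 : f (x₀, v₀) = 0) {D : V ≃L[ℝ] W}
    (hD : HasFDerivAt (fun v => f (x₀, v)) (D : V →L[ℝ] W) v₀) :
    ∃ ψ : X → V, ψ x₀ = v₀ ∧ AnalyticAt ℝ ψ x₀ ∧ (∀ᶠ x in nhds x₀, f (x, ψ x) = 0) ∧
      ∀ᶠ p in nhds (x₀, v₀), f p = 0 → ψ p.1 = p.2 := by
  -- The exponent `⊤` is the analytic class, so the smooth implicit function theorem returns an
  -- analytic function.
  have cdf : ContDiffAt ℝ ⊤ f (x₀, v₀) := hf.contDiffAt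
  have hinv : (fderiv ℝ f (x₀, v₀) ∘L .inr ℝ X V).IsInvertible := by
    have h1 : HasFDerivAt (fun v : V => (x₀, v)) (ContinuousLinearMap.inr ℝ X V) v₀ :=
      hasFDerivAt_prodMk_right x₀ v₀
    have h2 := HasFDerivAt.comp (f := fun v : V => (x₀, v)) v₀
      (hf.differentiableAt.hasFDerivAt) h1
    rw [h2.unique hD]
    exact ⟨D, rfl⟩
  refine ⟨cdf.implicitFunction (by simp) hinv, cdf.implicitFunction_apply_self _ _, ?_, ?_, ?_⟩
  · exact (cdf.contDiffAt_implicitFunction (by simp) hinv).analyticAt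
  · filter_upwards [cdf.eventually_apply_implicitFunction (by simp) hinv] with x hx
    rw [hx, h0]
  · filter_upwards [cdf.eventually_apply_eq_iff_implicitFunction (by simp) hinv] with p hp h
    exact hp.1 (by rw [h, h0])

variable {E : Type*} [PseudoMetricSpace E] [MeasurableSpace E] [OpensMeasurableSpace E] {n : ℕ}
  {y : E → Rd n}

/-- By change of variables, existence and uniqueness of solutions, proved on `ℝ^n` for the image
law, carry over to the dual of `BL E`. -/
theorem BLRatio.scoreEq_eq_map (hy : BLRatio y) (hm : Measurable y) {ν : ℝ} (hν : 0 < ν)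
    (μ : ProbabilityMeasure E) {C : SymMat n} (hC : C ∈ PosMat n) :
    hy.scoreEq ν (probToDual μ, C) =
      blRatio_id.scoreEq ν (lawToDual (μ.map hm.aemeasurable), C) := by
  refine SymMat.ext_entries fun k l => ?_
  rw [scoreEq_apply, scoreEq_apply, ← probToDual_eq_lawToDual, probToDual_one, probToDual_one]
  congr 2
  rw [probToDual_apply, probToDual_apply, ProbabilityMeasure.toMeasure_map,
    integral_map hm.aemeasurable (BL.continuous _).measurable.aestronglyMeasurable]
  simp only [hy.toFun_kernel hν hC, blRatio_id.toFun_kernel hν hC]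

/-- The scatter functional of the image law is analytic. -/
theorem BLRatio.analyticOnLaws_tScatter (hy : BLRatio y) (hm : Measurable y) {ν : ℝ} (hν : 0 < ν) :
    AnalyticOnLaws probToDual (fun μ : ProbabilityMeasure E => tScatter ν (μ.map hm.aemeasurable))
      {μ | μ.map hm.aemeasurable ∈ scatterDomain n (ν + n)} := by
  set D : Set (ProbabilityMeasure E) := {μ | μ.map hm.aemeasurable ∈ scatterDomain n (ν + n)}
    with hDdef
  set S : ProbabilityMeasure E → SymMat n := fun μ => symInv (tScatter ν (μ.map hm.aemeasurable))
    with hSdef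
  have hSpos : ∀ μ ∈ D, S μ ∈ PosMat n := fun μ hμ => symInv_mem (isTScatter_tScatter hν hμ).posDef
  have hS0 : ∀ μ ∈ D, hy.scoreEq ν (probToDual μ, S μ) = 0 := fun μ hμ => by
    rw [hy.scoreEq_eq_map hm hν μ (hSpos μ hμ)]
    exact scoreEq_tScatter hν hμ
  have hSuniq : ∀ μ ∈ D, ∀ C ∈ PosMat n, hy.scoreEq ν (probToDual μ, C) = 0 → C = S μ :=
    fun μ hμ C hC h => by
      rw [hy.scoreEq_eq_map hm hν μ hC] at h
      exact eq_symInv_tScatter hν hμ hC h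
  -- A ball on which the implicit function is analytic, positive definite valued and solves the
  -- equation; the last clause is its uniqueness near the base point.
  have hloc : ∀ μ ∈ D, ∃ (r : ℝ) (ψ : StrongDual ℝ (BL E) → SymMat n), 0 < r ∧
      AnalyticOnNhd ℝ ψ (Metric.ball (probToDual μ) r) ∧ ψ (probToDual μ) = S μ ∧
      (∀ φ ∈ Metric.ball (probToDual μ) r, ψ φ ∈ PosMat n ∧ hy.scoreEq ν (φ, ψ φ) = 0) ∧
      ∀ᶠ p in nhds (probToDual μ, S μ), hy.scoreEq ν p = 0 → ψ p.1 = p.2 := by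
    intro μ hμ
    obtain ⟨L, hL⟩ := hy.exists_equiv_hasFDerivAt_scoreEq hν μ (hSpos μ hμ) (hS0 μ hμ)
    obtain ⟨ψ, h1, h2, h3, h4⟩ := exists_analytic_implicit
      (hy.analyticAt_scoreEq hν (probToDual μ) (hSpos μ hμ)) (hS0 μ hμ) hL
    have h5 : ∀ᶠ φ in nhds (probToDual μ), ψ φ ∈ PosMat n :=
      h2.continuousAt.eventually (by rw [h1]; exact isOpen_posMat.mem_nhds (hSpos μ hμ))
    obtain ⟨r, hr, hball⟩ := Metric.eventually_nhds_iff_ball.1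
      (h2.eventually_analyticAt.and (h5.and h3))
    exact ⟨r, ψ, hr, fun φ hφ => (hball φ hφ).1, h1, fun φ hφ => (hball φ hφ).2, h4⟩
  choose! r ψ hr hψ hψS hψeq hψuniq using hloc
  have hO : IsOpen {φ : StrongDual ℝ (BL E) | hy.domainCondition (ν + n) φ} :=
    hy.isOpen_domainCondition (ev := fun φ : StrongDual ℝ (BL E) => φ)
      (isBoundedBilinearMap_apply.continuous) (ν + n)
  have hmain : AnalyticOnLaws probToDual S D := by
    refine analyticOnLaws_of_local hO (fun μ => hy.domainCondition_iff hm (ν + n) μ) hr hψ hψS ?_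
    -- At `φ_Q` the solution based at `P` is positive definite, so it equals `S Q` by global
    -- uniqueness. By continuity it stays close to `S Q` near `φ_Q`, where the local uniqueness at
    -- `Q` applies.
    intro P hP Q hQ hPQ
    have h1 : ψ P (probToDual Q) = S Q :=
      hSuniq Q hQ _ (hψeq P hP _ hPQ).1 (hψeq P hP _ hPQ).2
    have h2 : Filter.Tendsto (fun φ => (φ, ψ P φ)) (nhds (probToDual Q))
        (nhds (probToDual Q, S Q)) := by
      rw [← h1]
      exact (continuousAt_id.prodMk (hψ P hP _ hPQ).continuousAt)
    filter_upwards [h2.eventually (hψuniq Q hQ), Metric.isOpen_ball.mem_nhds hPQ] with φ hφ hφ'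
    exact (hφ (hψeq P hP φ hφ').2).symm
  refine (hmain.postcomp isOpen_posMat hSpos fun C hC => analyticAt_symInv hC).congr fun μ hμ => ?_
  exact symInv_symInv (isTScatter_tScatter hν hμ).posDef

theorem analyticOnLaws_tScatter {ν : ℝ} (hν : 0 < ν) :
    AnalyticOnLaws lawToDual (tScatter ν) (scatterDomain n (ν + n)) := by
  have h := (blRatio_id (n := n)).analyticOnLaws_tScatter measurable_id hν
  have : ∀ Q : Law n, Q.map (measurable_id (α := Rd n)).aemeasurable = Q := fun Q =>
    Subtype.ext Measure.map_id
  convert! h using 1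
  · ext1 Q
    exact congrArg (tScatter ν) (this Q).symm
  · ext Q
    exact iff_of_eq (congrArg (· ∈ scatterDomain n (ν + n)) (this Q).symm)

end ScatterAnalytic

/-! ### Location and scatter as a scatter problem in one more dimension -/

section Lift

variable {d : ℕ}

@[simp] theorem liftOne_castSucc (y : Rd d) (i : Fin d) : liftOne y i.castSucc = y i := by
  simp [liftOne]

@[simp] theorem liftOne_last (y : Rd d) : liftOne y (Fin.last d) = 1 := by
  simp [liftOne]

theorem dist_liftOne (x y : Rd d) : dist (liftOne x) (liftOne y) = dist x y := by
  rw [EuclideanSpace.dist_eq, EuclideanSpace.dist_eq, Fin.sum_univ_castSucc]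
  simp

theorem norm_liftOne_sq (y : Rd d) : ‖liftOne y‖ ^ 2 = 1 + ‖y‖ ^ 2 := by
  rw [EuclideanSpace.norm_sq_eq, EuclideanSpace.norm_sq_eq, Fin.sum_univ_castSucc]
  simp [add_comm]

/-- The map `y ↦ (y, 1)` is an isometry, so the ratios inherit their bounds from `ℝ^{d+1}`. -/
theorem blRatio_liftOne : BLRatio (liftOne (d := d)) := by
  intro k l
  obtain ⟨⟨M, hM⟩, K, hK⟩ := blRatio_id (n := d + 1) k l
  exact ⟨⟨M, fun y => hM (liftOne y)⟩, K, fun x y => by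
    rw [← dist_liftOne]
    exact hK (liftOne x) (liftOne y)⟩

theorem locScatterBlock_castSucc_castSucc (θ : Rd d × SymMat d) (i j : Fin d) :
    locScatterBlock θ i.castSucc j.castSucc =
      (θ.2 : Matrix (Fin d) (Fin d) ℝ) i j + θ.1 i * θ.1 j := by
  simp [locScatterBlock, Matrix.vecMulVec_apply]

theorem locScatterBlock_castSucc_last (θ : Rd d × SymMat d) (i : Fin d) :
    locScatterBlock θ i.castSucc (Fin.last d) = θ.1 i := by
  simp [locScatterBlock]

theorem locScatterBlock_last_castSucc (θ : Rd d × SymMat d) (j : Fin d) :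
    locScatterBlock θ (Fin.last d) j.castSucc = θ.1 j := by
  simp [locScatterBlock]

theorem locScatterBlock_last_last (θ : Rd d × SymMat d) :
    locScatterBlock θ (Fin.last d) (Fin.last d) = 1 := by
  simp [locScatterBlock]

/-- The block matrix of `(μ, Σ)` as a symmetric matrix. -/
def blockSym (θ : Rd d × SymMat d) : SymMat (d + 1) :=
  ⟨locScatterBlock θ, by
    refine Matrix.IsSymm.ext fun i j => ?_
    refine Fin.lastCases ?_ (fun i => ?_) i <;> refine Fin.lastCases ?_ (fun j => ?_) j
    · rfl
    · rw [locScatterBlock_castSucc_last, locScatterBlock_last_castSucc]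
    · rw [locScatterBlock_castSucc_last, locScatterBlock_last_castSucc]
    · rw [locScatterBlock_castSucc_castSucc, locScatterBlock_castSucc_castSucc,
        SymMat.apply_comm θ.2, mul_comm (θ.1 j)]⟩

theorem coe_blockSym (θ : Rd d × SymMat d) :
    (blockSym θ : Matrix (Fin (d + 1)) (Fin (d + 1)) ℝ) = locScatterBlock θ := rfl

/-- The pair `(μ, Σ)` with a given block matrix. -/
def unblock (A : SymMat (d + 1)) : Rd d × SymMat d :=
  (WithLp.toLp 2 fun i => (A : Matrix (Fin (d + 1)) (Fin (d + 1)) ℝ) i.castSucc (Fin.last d),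
    ⟨Matrix.of fun i j => (A : Matrix (Fin (d + 1)) (Fin (d + 1)) ℝ) i.castSucc j.castSucc -
      (A : Matrix (Fin (d + 1)) (Fin (d + 1)) ℝ) i.castSucc (Fin.last d) *
      (A : Matrix (Fin (d + 1)) (Fin (d + 1)) ℝ) j.castSucc (Fin.last d),
      Matrix.IsSymm.ext fun i j => by
        rw [Matrix.of_apply, Matrix.of_apply, SymMat.apply_comm A j.castSucc, mul_comm]⟩)

theorem unblock_fst (A : SymMat (d + 1)) (i : Fin d) : (unblock A).1 i =
    (A : Matrix (Fin (d + 1)) (Fin (d + 1)) ℝ) i.castSucc (Fin.last d) := rfl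

theorem unblock_snd (A : SymMat (d + 1)) (i j : Fin d) :
    ((unblock A).2 : Matrix (Fin d) (Fin d) ℝ) i j =
      (A : Matrix (Fin (d + 1)) (Fin (d + 1)) ℝ) i.castSucc j.castSucc -
      (A : Matrix (Fin (d + 1)) (Fin (d + 1)) ℝ) i.castSucc (Fin.last d) *
      (A : Matrix (Fin (d + 1)) (Fin (d + 1)) ℝ) j.castSucc (Fin.last d) := rfl

theorem unblock_blockSym (θ : Rd d × SymMat d) : unblock (blockSym θ) = θ := by
  refine Prod.ext ?_ (SymMat.ext_entries fun i j => ?_)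
  · ext i
    rw [unblock_fst, coe_blockSym, locScatterBlock_castSucc_last]
  · rw [unblock_snd, coe_blockSym, locScatterBlock_castSucc_castSucc,
      locScatterBlock_castSucc_last, locScatterBlock_castSucc_last, add_sub_cancel_right]

theorem blockSym_unblock {A : SymMat (d + 1)}
    (hA : (A : Matrix (Fin (d + 1)) (Fin (d + 1)) ℝ) (Fin.last d) (Fin.last d) = 1) :
    blockSym (unblock A) = A := by
  refine SymMat.ext_entries fun i j => ?_
  rw [coe_blockSym]
  refine Fin.lastCases ?_ (fun i => ?_) i <;> refine Fin.lastCases ?_ (fun j => ?_) j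
  · rw [locScatterBlock_last_last, hA]
  · rw [locScatterBlock_last_castSucc, unblock_fst, SymMat.apply_comm]
  · rw [locScatterBlock_castSucc_last, unblock_fst]
  · rw [locScatterBlock_castSucc_castSucc, unblock_fst, unblock_fst, unblock_snd, sub_add_cancel]

theorem quadForm_locScatterBlock (θ : Rd d × SymMat d) (z : Rd (d + 1)) :
    quadForm (locScatterBlock θ) z =
      quadForm (θ.2 : Matrix (Fin d) (Fin d) ℝ) (WithLp.toLp 2 fun i => z i.castSucc) +
        (∑ i, θ.1 i * z i.castSucc + z (Fin.last d)) ^ 2 := by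
  simp only [quadForm_eq_sum, Fin.sum_univ_castSucc, locScatterBlock_castSucc_castSucc,
    locScatterBlock_castSucc_last, locScatterBlock_last_castSucc, locScatterBlock_last_last,
    add_mul, Finset.sum_add_distrib, add_sq]
  have h1 : ∑ i : Fin d, ∑ j : Fin d, θ.1 i * θ.1 j * (z i.castSucc * z j.castSucc) =
      (∑ i, θ.1 i * z i.castSucc) ^ 2 := by
    rw [pow_two, Finset.sum_mul_sum]
    exact Finset.sum_congr rfl fun i _ => Finset.sum_congr rfl fun j _ => by ring
  have h2 : ∑ i : Fin d, θ.1 i * (z i.castSucc * z (Fin.last d)) =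
      (∑ i, θ.1 i * z i.castSucc) * z (Fin.last d) := by
    rw [Finset.sum_mul]
    exact Finset.sum_congr rfl fun i _ => by ring
  have h3 : ∑ i : Fin d, θ.1 i * (z (Fin.last d) * z i.castSucc) =
      (∑ i, θ.1 i * z i.castSucc) * z (Fin.last d) := by
    rw [Finset.sum_mul]
    exact Finset.sum_congr rfl fun i _ => by ring
  rw [h1, h2, h3]
  ring

theorem blockSym_mem_iff (θ : Rd d × SymMat d) : blockSym θ ∈ PosMat (d + 1) ↔ θ.2 ∈ PosMat d := by
  constructor
  · intro h
    refine posDef_of_quadForm_pos fun x hx => ?_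
    -- The last coordinate is chosen to make the square in `quadForm_locScatterBlock` vanish.
    let z : Rd (d + 1) := WithLp.toLp 2 (Fin.snoc x.ofLp (-∑ i, θ.1 i * x i) : Fin (d + 1) → ℝ)
    have hzi : ∀ i : Fin d, z i.castSucc = x i := fun i => by simp [z]
    have hzl : z (Fin.last d) = -∑ i, θ.1 i * x i := by simp [z]
    have hz : z ≠ 0 := fun h0 => hx (by
      ext i
      rw [← hzi, h0]
      rfl)
    have h1 := quadForm_pos (show (locScatterBlock θ).PosDef from h) hz
    rw [quadForm_locScatterBlock, hzl] at h1
    simpa only [hzi, add_neg_cancel, ne_eq, OfNat.ofNat_ne_zero, not_false_eq_true, zero_pow,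
      add_zero] using h1
  · intro h
    refine posDef_of_quadForm_pos fun z hz => ?_
    rw [coe_blockSym, quadForm_locScatterBlock]
    by_cases h0 : (WithLp.toLp 2 fun i : Fin d => z i.castSucc : Rd d) = 0
    · have hzi : ∀ i : Fin d, z i.castSucc = 0 := fun i => congrArg (fun x : Rd d => x i) h0
      have hl : z (Fin.last d) ≠ 0 := fun hl => hz (by
        ext i
        refine Fin.lastCases hl (fun i => ?_) i
        exact hzi i)
      refine add_pos_of_nonneg_of_pos (quadForm_nonneg h _) ?_
      simp only [hzi, mul_zero, Finset.sum_const_zero, zero_add]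
      positivity
    · exact add_pos_of_pos_of_nonneg (quadForm_pos h h0) (sq_nonneg _)

theorem det_locScatterBlock (θ : Rd d × SymMat d) :
    (locScatterBlock θ).det = (θ.2 : Matrix (Fin d) (Fin d) ℝ).det := by
  rw [locScatterBlock, Matrix.det_reindex_self, Matrix.det_fromBlocks_one₂₂]
  congr 1
  ext i j
  simp [Matrix.mul_apply, Matrix.vecMulVec_apply]

theorem quadForm_inv_eq {n : ℕ} {A : Matrix (Fin n) (Fin n) ℝ} (hA : IsUnit A.det) {z : Rd n}
    {w : Fin n → ℝ} (h : A *ᵥ w = z.ofLp) : quadForm A⁻¹ z = z.ofLp ⬝ᵥ w := by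
  rw [quadForm, ← h, Matrix.mulVec_mulVec, Matrix.nonsing_inv_mul _ hA, Matrix.one_mulVec]

theorem quadForm_inv_locScatterBlock {θ : Rd d × SymMat d} (hθ : θ.2 ∈ PosMat d) (y : Rd d) :
    quadForm (locScatterBlock θ)⁻¹ (liftOne y) =
      1 + quadForm (θ.2 : Matrix (Fin d) (Fin d) ℝ)⁻¹ (y - θ.1) := by
  set u : Fin d → ℝ := (θ.2 : Matrix (Fin d) (Fin d) ℝ)⁻¹ *ᵥ (y - θ.1).ofLp with hu
  have hSu : (θ.2 : Matrix (Fin d) (Fin d) ℝ) *ᵥ u = (y - θ.1).ofLp := by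
    rw [hu, Matrix.mulVec_mulVec, Matrix.mul_nonsing_inv _ (posMat_isUnit_det hθ),
      Matrix.one_mulVec]
  have hunit : IsUnit (locScatterBlock θ).det := by
    rw [det_locScatterBlock]
    exact posMat_isUnit_det hθ
  -- The block inverse is not computed: with `u = Σ⁻¹(y - μ)`, the vector `(u, 1 - μ·u)` solves the
  -- linear system with right-hand side `(y, 1)`.
  have hw : locScatterBlock θ *ᵥ (Fin.snoc u (1 - ∑ i, θ.1 i * u i) : Fin (d + 1) → ℝ) =
      (liftOne y).ofLp := by
    ext i
    rw [Matrix.mulVec, dotProduct, Fin.sum_univ_castSucc]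
    refine Fin.lastCases ?_ (fun i => ?_) i
    · simp only [locScatterBlock_last_castSucc, locScatterBlock_last_last, Fin.snoc_castSucc,
        Fin.snoc_last, liftOne_last]
      ring
    · have h1 := congrFun hSu i
      rw [Matrix.mulVec, dotProduct] at h1
      simp only [locScatterBlock_castSucc_castSucc, locScatterBlock_castSucc_last,
        Fin.snoc_castSucc, Fin.snoc_last, liftOne_castSucc, add_mul, Finset.sum_add_distrib, h1,
        mul_assoc, ← Finset.mul_sum]
      simp only [WithLp.ofLp_sub, Pi.sub_apply]
      ring
  rw [quadForm_inv_eq hunit hw, quadForm, ← hu, dotProduct, Fin.sum_univ_castSucc]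
  simp only [liftOne_castSucc, liftOne_last, Fin.snoc_castSucc, Fin.snoc_last, dotProduct,
    WithLp.ofLp_sub, Pi.sub_apply, sub_mul, Finset.sum_sub_distrib]
  ring

/-- Since `ν - 1 + (1 + q) = ν + q`, the two logarithms differ by the constant `log (ν/(ν - 1))`,
which cancels in the difference defining `H`. The exponents agree because `(ν - 1) + (d + 1) = ν +
d`. -/
theorem locScatterH_eq {ν : ℝ} (hν : 1 < ν) (y : Rd d) {θ : Rd d × SymMat d}
    (hθ : θ.2 ∈ PosMat d) : locScatterH ν y θ = scatterH (ν - 1) (liftOne y) (blockSym θ) := by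
  have h0 : 0 < ν - 1 := by linarith
  have key : ∀ q : ℝ, 0 ≤ q → Real.log (1 + (ν - 1)⁻¹ * (1 + q)) =
      Real.log (ν / (ν - 1)) + Real.log (1 + ν⁻¹ * q) := by
    intro q hq
    rw [← Real.log_mul (by positivity) (by positivity)]
    congr 1
    field_simp
    ring
  have hq : 0 ≤ quadForm (θ.2 : Matrix (Fin d) (Fin d) ℝ)⁻¹ (y - θ.1) :=
    quadForm_nonneg (symInv_mem hθ) _
  rw [locScatterH, scatterH, tLoss, tLoss, tLoss, tLoss, coe_blockSym, det_locScatterBlock,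
    quadForm_inv_locScatterBlock hθ, inv_one, inv_one, quadForm_one, quadForm_one,
    norm_liftOne_sq, key _ hq, key _ (sq_nonneg _),
    Matrix.det_one, Matrix.det_one]
  push_cast
  ring

end Lift

/-! ### Affine subspaces of `ℝ^d` as linear subspaces of `ℝ^{d+1}` -/

section LiftDomain

variable {d : ℕ}

/-- The linear map `(x, t) ↦ x - t y₀`. -/
def shear (y₀ : Rd d) : Rd (d + 1) →ₗ[ℝ] Rd d where
  toFun z := WithLp.toLp 2 fun i => z i.castSucc - z (Fin.last d) * y₀ i
  map_add' x z := by
    ext i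
    simp only [WithLp.ofLp_add, Pi.add_apply]
    ring
  map_smul' c z := by
    ext i
    simp only [WithLp.ofLp_smul, Pi.smul_apply, smul_eq_mul, RingHom.id_apply]
    ring

theorem shear_apply (y₀ : Rd d) (z : Rd (d + 1)) (i : Fin d) :
    shear y₀ z i = z i.castSucc - z (Fin.last d) * y₀ i := rfl

theorem shear_liftOne (y₀ y : Rd d) : shear y₀ (liftOne y) = y - y₀ := by
  ext i
  rw [shear_apply, liftOne_castSucc, liftOne_last, one_mul]
  rfl

theorem shear_eq_zero_iff (y₀ : Rd d) (z : Rd (d + 1)) :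
    shear y₀ z = 0 ↔ z = z (Fin.last d) • liftOne y₀ := by
  constructor
  · intro h
    ext i
    refine Fin.lastCases ?_ (fun i => ?_) i
    · simp
    · have := congrArg (fun x : Rd d => x i) h
      simp only [shear_apply] at this
      simpa using sub_eq_zero.1 this
  · intro h
    rw [h, map_smul, shear_liftOne, sub_self, smul_zero]

theorem surjective_shear (y₀ : Rd d) : Function.Surjective (shear y₀) := fun x =>
  ⟨liftOne (x + y₀), by rw [shear_liftOne, add_sub_cancel_right]⟩

theorem liftOne_ne_zero (y : Rd d) : liftOne y ≠ 0 := fun h => by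
  have := liftOne_last y
  rw [h] at this
  exact zero_ne_one this

/-- The shear is surjective with kernel the line through `(y₀, 1)`, which accounts for the extra
dimension. -/
theorem finrank_comap_shear (y₀ : Rd d) (V : Submodule ℝ (Rd d)) :
    Module.finrank ℝ (V.comap (shear y₀)) = Module.finrank ℝ V + 1 := by
  have h := LinearMap.finrank_range_add_finrank_ker ((shear y₀).domRestrict (V.comap (shear y₀)))
  have hr : LinearMap.range ((shear y₀).domRestrict (V.comap (shear y₀))) = V := by
    rw [LinearMap.range_domRestrict, Submodule.map_comap_eq_of_surjective (surjective_shear y₀)]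
  have hmem : liftOne y₀ ∈ V.comap (shear y₀) := by
    rw [Submodule.mem_comap, shear_liftOne, sub_self]
    exact V.zero_mem
  have hk : Module.finrank ℝ
      (LinearMap.ker ((shear y₀).domRestrict (V.comap (shear y₀)))) = 1 := by
    refine finrank_eq_one ⟨⟨liftOne y₀, hmem⟩, ?_⟩ ?_ ?_
    · rw [LinearMap.mem_ker, LinearMap.domRestrict_apply, shear_liftOne, sub_self]
    · intro h0
      exact liftOne_ne_zero y₀ (congrArg Subtype.val (congrArg Subtype.val h0))
    · rintro ⟨⟨z, hz⟩, hz'⟩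
      rw [LinearMap.mem_ker, LinearMap.domRestrict_apply] at hz'
      exact ⟨z (Fin.last d), Subtype.ext (Subtype.ext ((shear_eq_zero_iff y₀ z).1 hz').symm)⟩
  rw [← h, hr, hk]

theorem preimage_liftOne_comap_shear (y₀ : Rd d) (V : Submodule ℝ (Rd d)) :
    liftOne ⁻¹' (V.comap (shear y₀) : Set (Rd (d + 1))) =
      (AffineSubspace.mk' y₀ V : Set (Rd d)) := by
  ext y
  rw [Set.mem_preimage, SetLike.mem_coe, Submodule.mem_comap, shear_liftOne, SetLike.mem_coe,
    AffineSubspace.mem_mk', vsub_eq_sub]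

theorem exists_eq_comap_shear {H : Submodule ℝ (Rd (d + 1))} {y₀ : Rd d} (h : liftOne y₀ ∈ H) :
    ∃ V : Submodule ℝ (Rd d), H = V.comap (shear y₀) := by
  refine ⟨H.map (shear y₀), ?_⟩
  refine le_antisymm (Submodule.le_comap_map _ _) fun z hz => ?_
  obtain ⟨w, hw, hwz⟩ := hz
  have h1 : shear y₀ (z - w) = 0 := by rw [map_sub, hwz, sub_self]
  have h2 := (shear_eq_zero_iff y₀ _).1 h1
  rw [← sub_add_cancel z w, h2]
  exact H.add_mem (H.smul_mem _ h) hw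

theorem liftLaw_real_apply (P : Law d) (H : Submodule ℝ (Rd (d + 1))) :
    (liftLaw P : Measure (Rd (d + 1))).real (H : Set (Rd (d + 1))) =
      (P : Measure (Rd d)).real (liftOne ⁻¹' (H : Set (Rd (d + 1)))) := by
  rw [liftLaw, ProbabilityMeasure.toMeasure_map, map_measureReal_apply measurable_liftOne
      (Submodule.closed_of_finiteDimensional _).measurableSet]

/-- Linear subspaces that meet the hyperplane of last coordinate 1 correspond to nonempty affine
subspaces of dimension one less, and the codimension is unchanged. -/
theorem liftLaw_mem_scatterDomain_iff {ν : ℝ} (hν : 1 < ν) (P : Law d) :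
    liftLaw P ∈ scatterDomain (d + 1) (ν - 1 + (d + 1 : ℕ)) ↔ P ∈ locScatterDomain d (ν + d) := by
  have hcast : ν - 1 + ((d + 1 : ℕ) : ℝ) = ν + d := by
    push_cast
    ring
  have hpos : (0 : ℝ) < ν + d := by positivity
  rw [hcast]
  constructor
  · rintro h J ⟨y₀, hy₀⟩ hJ
    have h1 := h (J.direction.comap (shear y₀)) (by rw [finrank_comap_shear]; omega)
    rw [liftLaw_real_apply, preimage_liftOne_comap_shear, AffineSubspace.mk'_eq hy₀,
      finrank_comap_shear] at h1
    push_cast at h1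
    rwa [add_sub_add_right_eq_sub] at h1
  · intro h H hH
    rw [liftLaw_real_apply]
    rcases (liftOne ⁻¹' (H : Set (Rd (d + 1)))).eq_empty_or_nonempty with h0 | ⟨y₀, hy₀⟩
    -- A subspace that misses the hyperplane has mass 0, and its bound is positive because `d + 1 <
    -- ν + d`.
    · rw [h0, measureReal_empty, sub_pos, div_lt_one hpos]
      push_cast
      have : (0 : ℝ) ≤ Module.finrank ℝ H := Nat.cast_nonneg _
      linarith
    · obtain ⟨V, rfl⟩ := exists_eq_comap_shear (show liftOne y₀ ∈ H from hy₀)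
      rw [finrank_comap_shear] at hH ⊢
      have h1 := h (AffineSubspace.mk' y₀ V) ⟨y₀, AffineSubspace.self_mem_mk' _ _⟩
        (by rw [AffineSubspace.direction_mk']; omega)
      rw [preimage_liftOne_comap_shear]
      rw [AffineSubspace.direction_mk'] at h1
      push_cast
      rwa [add_sub_add_right_eq_sub]

end LiftDomain

/-! ### The location-scatter functional -/

section LocScatter

variable {d : ℕ} {ν : ℝ}

/-- Let `t` be the integral of `1/(ν - 1 + y'Cy)` over the lifted points. The trace of the critical
equation against `C` gives `(ν + d)(1 - (ν - 1) t) = d + 1`, and its corner entry gives `A_last = (ν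
+ d) t`; together `(ν - 1)(A_last - 1) = 0`. -/
theorem tScatter_liftLaw_last_last (hν : 1 < ν) {P : Law d}
    (hP : P ∈ locScatterDomain d (ν + d)) :
    (tScatter (ν - 1) (liftLaw P) : Matrix (Fin (d + 1)) (Fin (d + 1)) ℝ)
      (Fin.last d) (Fin.last d) = 1 := by
  have h0 : 0 < ν - 1 := by linarith
  have hQ := (liftLaw_mem_scatterDomain_iff hν P).2 hP
  set A := tScatter (ν - 1) (liftLaw P) with hA
  have hApos : A ∈ PosMat (d + 1) := (isTScatter_tScatter h0 hQ).posDef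
  have hCpos := symInv_mem hApos
  have hcrit : blRatio_liftOne.scoreEq (ν - 1) (probToDual P, symInv A) = 0 := by
    rw [blRatio_liftOne.scoreEq_eq_map measurable_liftOne h0 P hCpos]
    exact scoreEq_tScatter h0 hQ
  have hent := inv_eq_of_scoreEq_eq_zero blRatio_liftOne (probToDual_one P) hcrit
  have hinv : (symInv A : Matrix (Fin (d + 1)) (Fin (d + 1)) ℝ)⁻¹ = A :=
    congrArg Subtype.val (symInv_symInv hApos)
  rw [hinv] at hent
  set C : Matrix (Fin (d + 1)) (Fin (d + 1)) ℝ :=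
    (symInv A : Matrix (Fin (d + 1)) (Fin (d + 1)) ℝ) with hC
  -- This is `y'Cy / (ν - 1 + y'Cy) = 1 - (ν - 1)/(ν - 1 + y'Cy)`; the last fraction is a kernel
  -- entry because the last coordinate of a lifted point is 1.
  have hker : ∑ k, ∑ l, C k l • blRatio_liftOne.kernel (ν - 1) (symInv A) k l =
      1 - (ν - 1) • blRatio_liftOne.kernel (ν - 1) (symInv A) (Fin.last d) (Fin.last d) := by
    refine BL.ext fun y => ?_
    have hq : 0 ≤ quadForm C (liftOne y) := quadForm_nonneg hCpos _
    rw [blRatio_liftOne.toFun_sum_kernel h0 hCpos, BL.toFun_sub, BL.toFun_smul, BL.toFun_one,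
      blRatio_liftOne.toFun_kernel h0 hCpos, liftOne_last, ← hC]
    have : ν - 1 + quadForm C (liftOne y) ≠ 0 := by positivity
    field_simp
    ring
  have htr : ∑ k, ∑ l, C k l * (A : Matrix (Fin (d + 1)) (Fin (d + 1)) ℝ) k l = d + 1 := by
    have h1 : C * (A : Matrix (Fin (d + 1)) (Fin (d + 1)) ℝ) = 1 :=
      Matrix.nonsing_inv_mul _ (posMat_isUnit_det hApos)
    have h2 := congrArg Matrix.trace h1
    rw [Matrix.trace_one, Fintype.card_fin] at h2
    push_cast at h2
    rw [← h2, Matrix.trace]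
    refine Finset.sum_congr rfl fun k _ => ?_
    rw [Matrix.diag_apply, Matrix.mul_apply]
    exact Finset.sum_congr rfl fun l _ => by rw [SymMat.apply_comm A k l]
  have h3 := congrArg (probToDual P) hker
  rw [map_sub, map_smul, probToDual_one, map_sum] at h3
  simp only [map_sum, map_smul, smul_eq_mul] at h3
  have h4 : (ν - 1 + (d + 1 : ℕ)) * ∑ k, ∑ l, C k l *
      probToDual P (blRatio_liftOne.kernel (ν - 1) (symInv A) k l) = d + 1 := by
    rw [← htr, Finset.mul_sum]
    refine Finset.sum_congr rfl fun k _ => ?_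
    rw [Finset.mul_sum]
    exact Finset.sum_congr rfl fun l _ => by rw [hent k l]; ring
  rw [h3] at h4
  have h5 := hent (Fin.last d) (Fin.last d)
  set t := probToDual P (blRatio_liftOne.kernel (ν - 1) (symInv A) (Fin.last d) (Fin.last d))
  push_cast at h4 h5
  have h6 : (ν - 1) * (((A : Matrix (Fin (d + 1)) (Fin (d + 1)) ℝ) (Fin.last d) (Fin.last d)) - 1)
      = 0 := by
    rw [h5]
    linear_combination -h4
  exact sub_eq_zero.1 ((mul_eq_zero.1 h6).resolve_left h0.ne')

theorem integrable_locScatterH (hν : 1 < ν) (P : Law d) {θ : Rd d × SymMat d}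
    (hθ : θ.2 ∈ PosMat d) : Integrable (fun y => locScatterH ν y θ) (P : Measure (Rd d)) := by
  have h := integrable_scatterH (sub_pos.2 hν) (liftLaw P) ((blockSym_mem_iff θ).2 hθ)
  rw [liftLaw, ProbabilityMeasure.toMeasure_map] at h
  have h2 := (integrable_map_measure h.aestronglyMeasurable measurable_liftOne.aemeasurable).1 h
  exact h2.congr (Filter.Eventually.of_forall fun y => (locScatterH_eq hν y hθ).symm)

theorem locScatterObj_eq (hν : 1 < ν) (P : Law d) {θ : Rd d × SymMat d}
    (hθ : θ.2 ∈ PosMat d) : locScatterObj ν P θ = scatterObj (ν - 1) (liftLaw P) (blockSym θ) := by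
  have h := integrable_scatterH (sub_pos.2 hν) (liftLaw P) ((blockSym_mem_iff θ).2 hθ)
  rw [liftLaw, ProbabilityMeasure.toMeasure_map] at h
  rw [locScatterObj, scatterObj, liftLaw, ProbabilityMeasure.toMeasure_map,
    integral_map measurable_liftOne.aemeasurable h.aestronglyMeasurable]
  exact integral_congr_ae (Filter.Eventually.of_forall fun y => locScatterH_eq hν y hθ)

theorem blockSym_unblock_tScatter (hν : 1 < ν) {P : Law d}
    (hP : P ∈ locScatterDomain d (ν + d)) :
    blockSym (unblock (tScatter (ν - 1) (liftLaw P))) = tScatter (ν - 1) (liftLaw P) :=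
  blockSym_unblock (tScatter_liftLaw_last_last hν hP)

/-- The unconstrained minimizer over `𝒫_{d+1}` has corner entry 1, so it is itself a block matrix.
Being the strict minimum overall, it is the strict minimum among block matrices. -/
theorem isTLocScatter_unblock (hν : 1 < ν) {P : Law d} (hP : P ∈ locScatterDomain d (ν + d)) :
    IsTLocScatter ν P (unblock (tScatter (ν - 1) (liftLaw P))) := by
  have h := isTScatter_tScatter (sub_pos.2 hν) ((liftLaw_mem_scatterDomain_iff hν P).2 hP)
  have hb := blockSym_unblock_tScatter hν hP
  have hpos : (unblock (tScatter (ν - 1) (liftLaw P))).2 ∈ PosMat d := by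
    rw [← blockSym_mem_iff, hb]
    exact h.posDef
  refine ⟨hpos, fun η hη => integrable_locScatterH hν P hη, fun η hη hne => ?_⟩
  rw [locScatterObj_eq hν P hpos, locScatterObj_eq hν P hη, hb]
  refine h.minimal _ ((blockSym_mem_iff η).2 hη) fun h1 => hne ?_
  rw [← h1, unblock_blockSym]

theorem IsTLocScatter.eq {P : Law d} {θ η : Rd d × SymMat d} (hθ : IsTLocScatter ν P θ)
    (hη : IsTLocScatter ν P η) : θ = η := by
  by_contra hne
  exact lt_asymm (hθ.minimal η hη.posDef (Ne.symm hne)) (hη.minimal θ hθ.posDef hne)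

theorem isTLocScatter_tLocScatter (hν : 1 < ν) {P : Law d}
    (hP : P ∈ locScatterDomain d (ν + d)) : IsTLocScatter ν P (tLocScatter ν P) :=
  Classical.epsilon_spec ⟨_, isTLocScatter_unblock hν hP⟩

theorem tLocScatter_eq (hν : 1 < ν) {P : Law d} (hP : P ∈ locScatterDomain d (ν + d)) :
    tLocScatter ν P = unblock (tScatter (ν - 1) (liftLaw P)) :=
  (isTLocScatter_tLocScatter hν hP).eq (isTLocScatter_unblock hν hP)

theorem tScatter_liftLaw_eq (hν : 1 < ν) {P : Law d} (hP : P ∈ locScatterDomain d (ν + d)) :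
    (tScatter (ν - 1) (liftLaw P) : Matrix (Fin (d + 1)) (Fin (d + 1)) ℝ) =
      locScatterBlock (tLocScatter ν P) := by
  rw [tLocScatter_eq hν hP, ← coe_blockSym, blockSym_unblock_tScatter hν hP]

theorem analyticAt_unblock (A : SymMat (d + 1)) : AnalyticAt ℝ (unblock (d := d)) A := by
  refine AnalyticAt.prod (f := fun A => (unblock A).1) (g := fun A => (unblock A).2) ?_ ?_
  · let L : SymMat (d + 1) →ₗ[ℝ] Rd d :=
      { toFun := fun A => (unblock A).1
        map_add' := fun _ _ => rfl
        map_smul' := fun _ _ => rfl }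
    exact (LinearMap.toContinuousLinearMap L).analyticAt A
  · refine SymMat.analyticAt_of_entries fun i j => ?_
    exact ((SymMat.entryL i.castSucc j.castSucc).analyticAt A).sub
      (((SymMat.entryL i.castSucc (Fin.last d)).analyticAt A).mul
        ((SymMat.entryL j.castSucc (Fin.last d)).analyticAt A))

theorem analyticOnLaws_tLocScatter (hν : 1 < ν) :
    AnalyticOnLaws lawToDual (tLocScatter (d := d) ν) (locScatterDomain d (ν + d)) := by
  have h := (blRatio_liftOne (d := d)).analyticOnLaws_tScatter measurable_liftOne (sub_pos.2 hν)
  have h2 := h.postcomp isOpen_univ (fun _ _ => Set.mem_univ _) (h := unblock)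
    fun A _ => analyticAt_unblock A
  have hD : {P : Law d | P.map measurable_liftOne.aemeasurable ∈
      scatterDomain (d + 1) (ν - 1 + (d + 1 : ℕ))} = locScatterDomain d (ν + d) := by
    ext P
    exact liftLaw_mem_scatterDomain_iff hν P
  rw [hD] at h2
  exact h2.congr fun P hP => (tLocScatter_eq hν hP).symm

end LocScatter

/-! ### The line with the metric `|arctan x - arctan y|` and the Kolmogorov norm -/

/-- The real line with the metric `|arctan x - arctan y|`. -/
def ArctanLine : Type := ℝ

namespace ArctanLine

instance : PseudoMetricSpace ArctanLine :=
  PseudoMetricSpace.induced Real.arctan (inferInstanceAs (PseudoMetricSpace ℝ))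

instance : MeasurableSpace ArctanLine := inferInstanceAs (MeasurableSpace ℝ)

instance : OpensMeasurableSpace ArctanLine := by
  refine ⟨MeasurableSpace.generateFrom_le fun s hs => ?_⟩
  obtain ⟨t, ht, rfl⟩ := isOpen_induced_iff.1 hs
  exact Real.continuous_arctan.measurable ht.measurableSet

theorem abs_sub_le (f : BL ArctanLine) (x y : ℝ) :
    |f.toFun x - f.toFun y| ≤ f.lipNorm * |Real.arctan x - Real.arctan y| :=
  f.abs_sub_le_lipNorm x y

theorem continuous_toFun (f : BL ArctanLine) : Continuous fun x : ℝ => f.toFun x := by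
  refine continuous_iff_continuousAt.2 fun x => ?_
  refine tendsto_iff_dist_tendsto_zero.2 (squeeze_zero (fun _ => dist_nonneg)
    (fun y => abs_sub_le f y x) ?_)
  have h : Continuous fun y : ℝ => f.lipNorm * |Real.arctan y - Real.arctan x| := by
    have := Real.continuous_arctan
    fun_prop
  simpa using h.tendsto x

/-- Since `arctan' = 1/(1 + x²)`, the derivative bound makes both `K arctan - f` and `K arctan + f`
increasing, which is the Lipschitz bound for the arctan metric. -/
theorem isBL_of_deriv {f f' : ℝ → ℝ} {M K : ℝ} (hM : ∀ x, |f x| ≤ M)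
    (hf : ∀ x, HasDerivAt f (f' x) x) (hK : ∀ x, |f' x| * (1 + x ^ 2) ≤ K) :
    IsBL (E := ArctanLine) f := by
  have hK' : ∀ x, |f' x| ≤ K / (1 + x ^ 2) := fun x => (le_div_iff₀ (by positivity)).2 (hK x)
  have harc : ∀ x, HasDerivAt (fun x => K * Real.arctan x) (K / (1 + x ^ 2)) x := fun x => by
    have := (Real.hasDerivAt_arctan x).const_mul K
    rwa [mul_one_div] at this
  have h1 : Monotone fun x => K * Real.arctan x - f x :=
    monotone_of_hasDerivAt_nonneg (fun x => (harc x).sub (hf x)) fun x =>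
      sub_nonneg.2 ((le_abs_self _).trans (hK' x))
  have h2 : Monotone fun x => K * Real.arctan x + f x :=
    monotone_of_hasDerivAt_nonneg (fun x => (harc x).add (hf x)) fun x => by
      have := neg_le_of_abs_le (hK' x)
      change 0 ≤ K / (1 + x ^ 2) + f' x
      linarith
  have key : ∀ x y : ℝ, x ≤ y → |f x - f y| ≤ K * |Real.arctan x - Real.arctan y| := by
    intro x y hxy
    have e1 := h1 hxy
    have e2 := h2 hxy
    have e3 : Real.arctan x ≤ Real.arctan y := Real.arctan_strictMono.monotone hxy
    rw [abs_of_nonpos (sub_nonpos.2 e3), abs_le]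
    simp only at e1 e2
    constructor <;> linarith
  refine ⟨⟨M, hM⟩, K, fun x y => ?_⟩
  rcases le_total (show ℝ from x) y with h | h
  · exact key x y h
  · rw [abs_sub_comm, dist_comm]
    exact key y x h

/-- The map `x ↦ (x, 1)`. -/
def lift (x : ℝ) : Rd (1 + 1) := liftOne (WithLp.toLp 2 (fun _ : Fin 1 => x) : Rd 1)

theorem measurable_toLp :
    Measurable fun x : ℝ => (WithLp.toLp 2 (fun _ : Fin 1 => x) : Rd 1) :=
  ((PiLp.continuous_toLp 2 _).comp (continuous_pi fun _ => continuous_id)).measurable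

theorem measurable_lift : Measurable lift := measurable_liftOne.comp measurable_toLp

theorem isBL_inv : IsBL (E := ArctanLine) fun x : ℝ => 1 / (2 + x ^ 2) := by
  refine isBL_of_deriv (M := 1) (K := 2) (f' := fun x => -(2 * x) / (2 + x ^ 2) ^ 2)
    (fun x => ?_) (fun x => ?_) fun x => ?_
  · rw [abs_of_nonneg (by positivity), div_le_one (by positivity)]
    nlinarith [sq_nonneg x]
  · have h : HasDerivAt (fun x : ℝ => 2 + x ^ 2) (2 * x) x := by
      simpa using (hasDerivAt_pow 2 x).const_add 2
    have h2 := h.inv (by positivity)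
    simp only [one_div]
    exact h2
  · rw [abs_div, abs_of_pos (show (0 : ℝ) < (2 + x ^ 2) ^ 2 by positivity), abs_neg, abs_mul,
      abs_two, div_mul_eq_mul_div, div_le_iff₀ (by positivity)]
    have h1 : |x| ≤ 2 + x ^ 2 := by nlinarith [sq_abs x, sq_nonneg (|x| - 1)]
    have h2 : 1 + x ^ 2 ≤ 2 + x ^ 2 := by linarith
    have := mul_le_mul h1 h2 (by positivity) (by positivity)
    nlinarith

theorem isBL_div : IsBL (E := ArctanLine) fun x : ℝ => x / (2 + x ^ 2) := by
  refine isBL_of_deriv (M := 1) (K := 1) (f' := fun x => (2 - x ^ 2) / (2 + x ^ 2) ^ 2)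
    (fun x => ?_) (fun x => ?_) fun x => ?_
  · rw [abs_div, abs_of_pos (show (0 : ℝ) < 2 + x ^ 2 by positivity), div_le_one (by positivity)]
    nlinarith [sq_abs x, sq_nonneg (|x| - 1)]
  · have h : HasDerivAt (fun x : ℝ => 2 + x ^ 2) (2 * x) x := by
      simpa using (hasDerivAt_pow 2 x).const_add 2
    have h2 := (hasDerivAt_id x).div h (by positivity)
    convert! h2 using 2
    simp only [id]
    ring
  · rw [abs_div, abs_of_pos (show (0 : ℝ) < (2 + x ^ 2) ^ 2 by positivity),
      div_mul_eq_mul_div, div_le_iff₀ (by positivity), one_mul, pow_two (2 + x ^ 2)]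
    refine mul_le_mul (abs_le.2 ⟨?_, ?_⟩) (by linarith) (by positivity) (by positivity) <;>
      nlinarith [sq_nonneg x]

theorem isBL_congr {f g : ℝ → ℝ} (h : ∀ x, f x = g x) (hg : IsBL (E := ArctanLine) g) :
    IsBL (E := ArctanLine) f := by
  obtain rfl : f = g := funext h
  exact hg

/-- The ratios are `1/(2 + x²)`, `x/(2 + x²)` and `x²/(2 + x²) = 1 - 2/(2 + x²)`. -/
theorem blRatio_lift : BLRatio (E := ArctanLine) lift := by
  have hnorm : ∀ x : ℝ, 1 + ‖lift x‖ ^ 2 = 2 + x ^ 2 := fun x => by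
    rw [lift, norm_liftOne_sq, EuclideanSpace.norm_sq_eq]
    simp
    ring
  have h0 : ∀ x : ℝ, lift x (Fin.castSucc 0) = x := fun x => liftOne_castSucc _ 0
  have h1 : ∀ x : ℝ, lift x (Fin.last 1) = 1 := fun x => liftOne_last _
  intro k l
  refine Fin.lastCases ?_ (fun k => ?_) k <;> refine Fin.lastCases ?_ (fun l => ?_) l
  · exact isBL_congr (fun x => by rw [h1, mul_one, hnorm]) isBL_inv
  · exact isBL_congr (fun x => by rw [Subsingleton.elim l 0, h1, h0, one_mul, hnorm]) isBL_div
  · exact isBL_congr (fun x => by rw [Subsingleton.elim k 0, h1, h0, mul_one, hnorm]) isBL_div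
  · have h2 : IsBL (E := ArctanLine) fun x : ℝ => 1 + (-2) * (1 / (2 + x ^ 2)) :=
      (blSubmodule ArctanLine).add_mem (isBL_const 1)
        ((blSubmodule ArctanLine).smul_mem (-2) isBL_inv)
    refine isBL_congr (fun x => ?_) h2
    rw [Subsingleton.elim k 0, Subsingleton.elim l 0, h0, hnorm]
    have : (2 : ℝ) + x ^ 2 ≠ 0 := by positivity
    field_simp
    ring

end ArctanLine

/-! ### Integration against signed measures -/

section StepSum

/-- The grid points `i / (N + 1) - (N + 1)`. -/
def gridPoint (N i : ℕ) : ℝ := i / (N + 1) - (N + 1)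

theorem le_gridPoint_iff (N i : ℕ) (x : ℝ) :
    x ≤ gridPoint N i ↔ ⌈(x + (N + 1)) * (N + 1)⌉₊ ≤ i := by
  rw [Nat.ceil_le, gridPoint, le_sub_iff_add_le, le_div_iff₀ (by positivity)]

theorem monotone_gridPoint (N : ℕ) : Monotone (gridPoint N) := fun i j h => by
  unfold gridPoint
  gcongr

/-- An Abel sum: the integral of a step function that approximates `f`, with respect to a measure
with distribution function `F` and total mass `m`. -/
def stepSum (N : ℕ) (f : ℝ → ℝ) (m : ℝ) (F : ℝ → ℝ) : ℝ :=
  f (gridPoint N (2 * (N + 1) ^ 2)) * m +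
    ∑ i ∈ Finset.range (2 * (N + 1) ^ 2),
      (f (gridPoint N i) - f (gridPoint N (i + 1))) * F (gridPoint N i)

/-- For a point mass the Abel sum telescopes to the value of `f` at the first grid point to the
right of `x`. -/
theorem stepSum_indicator (N : ℕ) (f : ℝ → ℝ) {x : ℝ} (hx : x ≤ N + 1) :
    stepSum N f 1 (fun t => (Iic t).indicator (fun _ => (1 : ℝ)) x) =
      f (gridPoint N ⌈(x + (N + 1)) * (N + 1)⌉₊) := by
  -- The natural-number ceiling gives `j = 0` for points to the left of the grid; `hx` keeps `j`
  -- within the grid.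
  set j := ⌈(x + (N + 1)) * (N + 1)⌉₊ with hj
  have hjM : j ≤ 2 * (N + 1) ^ 2 := by
    rw [hj, Nat.ceil_le]
    push_cast
    have : (0 : ℝ) < N + 1 := by positivity
    nlinarith
  have h : ∀ i, (f (gridPoint N i) - f (gridPoint N (i + 1))) *
      (Iic (gridPoint N i)).indicator (fun _ => (1 : ℝ)) x =
        if j ≤ i then f (gridPoint N i) - f (gridPoint N (i + 1)) else 0 := fun i => by
    simp only [Set.indicator_apply, Set.mem_Iic, le_gridPoint_iff, ← hj, mul_ite, mul_one, mul_zero]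
  rw [stepSum, Finset.sum_congr rfl fun i _ => h i, ← Finset.sum_filter]
  have h2 : (Finset.range (2 * (N + 1) ^ 2)).filter (fun i => j ≤ i) =
      Finset.Ico j (2 * (N + 1) ^ 2) := by
    ext i
    simp only [Finset.mem_filter, Finset.mem_range, Finset.mem_Ico]
    tauto
  have h3 := Finset.sum_Ico_sub (fun i => f (gridPoint N i)) hjM
  have h4 : ∑ i ∈ Finset.Ico j (2 * (N + 1) ^ 2), (f (gridPoint N i) - f (gridPoint N (i + 1))) =
      -∑ i ∈ Finset.Ico j (2 * (N + 1) ^ 2), (f (gridPoint N (i + 1)) - f (gridPoint N i)) := by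
    rw [← Finset.sum_neg_distrib]
    exact Finset.sum_congr rfl fun i _ => by ring
  rw [h2, h4, h3]
  ring

theorem stepSum_add_left (N : ℕ) (f g : ℝ → ℝ) (m : ℝ) (F : ℝ → ℝ) :
    stepSum N (fun x => f x + g x) m F = stepSum N f m F + stepSum N g m F := by
  simp only [stepSum, add_sub_add_comm, add_mul, Finset.sum_add_distrib]
  ring

theorem stepSum_mul_left (N : ℕ) (c : ℝ) (f : ℝ → ℝ) (m : ℝ) (F : ℝ → ℝ) :
    stepSum N (fun x => c * f x) m F = c * stepSum N f m F := by
  simp only [stepSum, ← mul_sub, mul_assoc, mul_add, Finset.mul_sum]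

theorem stepSum_sub_right (N : ℕ) (f : ℝ → ℝ) (m m' : ℝ) (F F' : ℝ → ℝ) :
    stepSum N f (m - m') (fun t => F t - F' t) = stepSum N f m F - stepSum N f m' F' := by
  simp only [stepSum, mul_sub, Finset.sum_sub_distrib]
  ring

theorem tendsto_gridPoint_ceil (x : ℝ) :
    Filter.Tendsto (fun N : ℕ => gridPoint N ⌈(x + (N + 1)) * (N + 1)⌉₊) Filter.atTop (nhds x) := by
  have h0 : Filter.Tendsto (fun N : ℕ => x + 1 / ((N : ℝ) + 1)) Filter.atTop (nhds x) := by
    simpa using tendsto_one_div_add_atTop_nhds_zero_nat.const_add x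
  refine tendsto_of_tendsto_of_tendsto_of_le_of_le' tendsto_const_nhds h0
    (Filter.Eventually.of_forall fun N => (le_gridPoint_iff N _ x).2 le_rfl) ?_
  obtain ⟨N₀, hN₀⟩ := exists_nat_ge (-x)
  filter_upwards [Filter.eventually_ge_atTop N₀] with N hN
  have hc : (0 : ℝ) < N + 1 := by positivity
  have hN' : (N₀ : ℝ) ≤ N := by exact_mod_cast hN
  have h1 := (Nat.ceil_lt_add_one (show 0 ≤ (x + ((N : ℝ) + 1)) * (N + 1) from
    mul_nonneg (by linarith) hc.le)).le
  rw [gridPoint, sub_le_iff_le_add, div_le_iff₀ hc]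
  refine h1.trans (le_of_eq ?_)
  field_simp
  ring

/-- The increments of `f` are dominated by those of `arctan`, which telescope to at most `π`. The
bound is uniform in the mesh and involves the measure only through its mass and distribution
function. -/
theorem abs_stepSum_le {f F : ℝ → ℝ} {S L c m : ℝ} (N : ℕ) (hS : ∀ x, |f x| ≤ S) (hL0 : 0 ≤ L)
    (hL : ∀ x y, |f x - f y| ≤ L * |Real.arctan x - Real.arctan y|) (hm : |m| ≤ c)
    (hF : ∀ x, |F x| ≤ c) : |stepSum N f m F| ≤ (S + L * Real.pi) * c := by
  have hc : 0 ≤ c := (abs_nonneg _).trans hm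
  set M := 2 * (N + 1) ^ 2 with hM
  have h1 : ∀ i ∈ Finset.range M,
      |(f (gridPoint N i) - f (gridPoint N (i + 1))) * F (gridPoint N i)| ≤
        (L * c) * (Real.arctan (gridPoint N (i + 1)) - Real.arctan (gridPoint N i)) := by
    intro i _
    have hmono : Real.arctan (gridPoint N i) ≤ Real.arctan (gridPoint N (i + 1)) :=
      Real.arctan_strictMono.monotone (monotone_gridPoint N (Nat.le_succ i))
    have := hL (gridPoint N i) (gridPoint N (i + 1))
    rw [abs_of_nonpos (sub_nonpos.2 hmono)] at this
    rw [abs_mul]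
    calc _ ≤ (L * -(Real.arctan (gridPoint N i) - Real.arctan (gridPoint N (i + 1)))) * c :=
          mul_le_mul this (hF _) (abs_nonneg _) ((abs_nonneg _).trans this)
      _ = _ := by ring
  have h2 : |∑ i ∈ Finset.range M,
      (f (gridPoint N i) - f (gridPoint N (i + 1))) * F (gridPoint N i)| ≤ L * c * Real.pi := by
    refine (Finset.abs_sum_le_sum_abs _ _).trans ((Finset.sum_le_sum h1).trans ?_)
    rw [← Finset.mul_sum, Finset.sum_range_sub (fun i => Real.arctan (gridPoint N i))]
    refine mul_le_mul_of_nonneg_left ?_ (by positivity)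
    have := Real.arctan_lt_pi_div_two (gridPoint N M)
    have := Real.neg_pi_div_two_lt_arctan (gridPoint N 0)
    linarith
  rw [stepSum]
  refine (abs_add_le _ _).trans ?_
  have h3 : |f (gridPoint N M) * m| ≤ S * c := by
    rw [abs_mul]
    exact mul_le_mul (hS _) hm (abs_nonneg _) ((abs_nonneg _).trans (hS 0))
  calc _ ≤ S * c + L * c * Real.pi := add_le_add h3 h2
    _ = _ := by ring

/-- The Abel sum of `μ` is the `μ`-integral of the Abel sums of point masses, which converge to `f`
pointwise and boundedly. -/
theorem tendsto_stepSum (f : BL ArctanLine) (μ : Measure ℝ) [IsFiniteMeasure μ] :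
    Filter.Tendsto (fun N => stepSum N (fun x : ℝ => f.toFun x) (μ.real univ)
      fun t => μ.real (Iic t)) Filter.atTop (nhds (∫ x : ℝ, f.toFun x ∂μ)) := by
  have hS : ∀ x : ℝ, |f.toFun x| ≤ f.supNorm := fun x => f.abs_le_supNorm x
  have hInt : ∀ N, stepSum N (fun x : ℝ => f.toFun x) (μ.real univ) (fun t => μ.real (Iic t)) =
      ∫ x : ℝ, stepSum N (fun x : ℝ => f.toFun x) 1
        (fun t => (Iic t).indicator (fun _ => (1 : ℝ)) x) ∂μ := by
    intro N
    have hi : ∀ t : ℝ, Integrable (fun x : ℝ => (Iic t).indicator (fun _ => (1 : ℝ)) x) μ :=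
      fun t => (integrable_const 1).indicator measurableSet_Iic
    simp only [stepSum]
    rw [integral_add (integrable_const _)
      (integrable_finsetSum _ fun i _ => (hi _).const_mul _), integral_const,
      integral_finsetSum _ fun i _ => (hi _).const_mul _]
    congr 1
    · rw [smul_eq_mul, mul_one, mul_comm]
    · refine Finset.sum_congr rfl fun i _ => ?_
      rw [integral_const_mul]
      congr 1
      exact (integral_indicator_one measurableSet_Iic).symm
  simp only [hInt]
  refine tendsto_integral_of_dominated_convergence
    (fun _ => (f.supNorm + f.lipNorm * Real.pi) * 1) (fun N => ?_) (integrable_const _)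
    (fun N => Filter.Eventually.of_forall fun x => ?_) (Filter.Eventually.of_forall fun x => ?_)
  · simp only [stepSum]
    refine Measurable.aestronglyMeasurable ?_
    refine measurable_const.add (Finset.measurable_sum _ fun i _ => ?_)
    exact (measurable_const.indicator measurableSet_Iic).const_mul _
  · rw [Real.norm_eq_abs]
    refine abs_stepSum_le N hS f.lipNorm_nonneg (ArctanLine.abs_sub_le f) (by simp) fun t => ?_
    rw [Set.indicator_apply]
    split_ifs <;> simp
  · obtain ⟨N₀, hN₀⟩ := exists_nat_ge x
    have h1 := ((ArctanLine.continuous_toFun f).tendsto x).comp (tendsto_gridPoint_ceil x)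
    refine h1.congr' ?_
    filter_upwards [Filter.eventually_ge_atTop N₀] with N hN
    have hN' : (N₀ : ℝ) ≤ N := by exact_mod_cast hN
    exact (stepSum_indicator N _ (by linarith)).symm

end StepSum

/-! ### The Kolmogorov norm controls integration of bounded arctan-Lipschitz functions -/

namespace KMeas

/-- The total mass. -/
def mass (τ : KMeas) : ℝ := (show SignedMeasure ℝ from τ) univ

theorem mass_eq (τ : KMeas) :
    τ.mass =
      (SignedMeasure.toJordanDecomposition (show SignedMeasure ℝ from τ)).posPart.real univ -
      (SignedMeasure.toJordanDecomposition (show SignedMeasure ℝ from τ)).negPart.real univ := by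
  conv_lhs => rw [mass, ← SignedMeasure.toSignedMeasure_toJordanDecomposition
    (show SignedMeasure ℝ from τ)]
  rw [JordanDecomposition.toSignedMeasure, sub_apply,
    Measure.toSignedMeasure_apply_measurable MeasurableSet.univ,
    Measure.toSignedMeasure_apply_measurable MeasurableSet.univ]

theorem tendsto_real_Iic_nat (μ : Measure ℝ) [IsFiniteMeasure μ] :
    Filter.Tendsto (fun n : ℕ => μ.real (Iic (n : ℝ))) Filter.atTop (nhds (μ.real univ)) := by
  have h : ⋃ n : ℕ, Iic (n : ℝ) = univ := Set.eq_univ_of_forall fun x => by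
    obtain ⟨n, hn⟩ := exists_nat_ge x
    exact Set.mem_iUnion.2 ⟨n, hn⟩
  have h2 := tendsto_measure_iUnion_atTop (μ := μ) (s := fun n : ℕ => Iic (n : ℝ))
    fun i j hij => Iic_subset_Iic.2 (by exact_mod_cast hij)
  rw [h] at h2
  exact (ENNReal.tendsto_toReal (measure_ne_top μ univ)).comp h2

/-- The total mass is the limit of the distribution function at infinity. -/
theorem abs_mass_le (τ : KMeas) : |τ.mass| ≤ ‖τ‖ := by
  have h : Filter.Tendsto (fun n : ℕ => |τ.cdf n|) Filter.atTop (nhds |τ.mass|) := by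
    simp only [cdf_eq, mass_eq]
    exact ((tendsto_real_Iic_nat _).sub (tendsto_real_Iic_nat _)).abs
  exact le_of_tendsto' h fun n => τ.abs_cdf_le n

/-- The integral of `f` with respect to `τ`. -/
def integral (τ : KMeas) (f : BL ArctanLine) : ℝ :=
  ∫ x : ℝ, f.toFun x ∂(SignedMeasure.toJordanDecomposition (show SignedMeasure ℝ from τ)).posPart -
    ∫ x : ℝ, f.toFun x ∂(SignedMeasure.toJordanDecomposition (show SignedMeasure ℝ from τ)).negPart

theorem tendsto_integral (τ : KMeas) (f : BL ArctanLine) :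
    Filter.Tendsto (fun N => stepSum N (fun x : ℝ => f.toFun x) τ.mass τ.cdf) Filter.atTop
      (nhds (τ.integral f)) := by
  have h : τ.cdf = fun t =>
      (SignedMeasure.toJordanDecomposition (show SignedMeasure ℝ from τ)).posPart.real (Iic t) -
      (SignedMeasure.toJordanDecomposition (show SignedMeasure ℝ from τ)).negPart.real (Iic t) :=
    funext fun t => cdf_eq τ t
  simp only [h, mass_eq, stepSum_sub_right]
  exact (tendsto_stepSum f _).sub (tendsto_stepSum f _)

theorem abs_integral_le (τ : KMeas) (f : BL ArctanLine) :
    |τ.integral f| ≤ (1 + Real.pi) * ‖τ‖ * ‖f‖ := by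
  refine le_of_tendsto' (tendsto_integral τ f).abs fun N => ?_
  refine (abs_stepSum_le N (fun x => f.abs_le_supNorm x) f.lipNorm_nonneg
    (ArctanLine.abs_sub_le f) τ.abs_mass_le τ.abs_cdf_le).trans ?_
  have h1 := f.supNorm_nonneg
  have h2 := f.lipNorm_nonneg
  have h3 := Real.pi_pos
  rw [mul_right_comm, BL.norm_def]
  refine mul_le_mul_of_nonneg_right ?_ (norm_nonneg τ)
  nlinarith [mul_nonneg h3.le h1]

/-- Integration as a continuous linear map from signed measures to the dual of `BL`. -/
def toDual : KMeas →L[ℝ] StrongDual ℝ (BL ArctanLine) :=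
  LinearMap.mkContinuous₂
    -- The Jordan decomposition is not additive in the measure. Linearity is read off from the Abel
    -- sums instead, which are bilinear in the function and in the pair (mass, distribution
    -- function), and passes to the limit.
    (LinearMap.mk₂ ℝ integral
      (fun σ τ f => tendsto_nhds_unique (tendsto_integral (σ + τ) f)
        (((tendsto_integral σ f).add (tendsto_integral τ f)).congr fun N => by
          simp only [stepSum, show (σ + τ).mass = σ.mass + τ.mass from rfl, cdf_add, mul_add,
            Finset.sum_add_distrib]
          ring))
      (fun c τ f => tendsto_nhds_unique (tendsto_integral (c • τ) f)
        (((tendsto_integral τ f).const_mul c).congr fun N => by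
          simp only [stepSum, show (c • τ).mass = c * τ.mass from rfl, cdf_smul, mul_add,
            Finset.mul_sum, mul_left_comm]))
      (fun τ f g => tendsto_nhds_unique (tendsto_integral τ (f + g))
        (((tendsto_integral τ f).add (tendsto_integral τ g)).congr fun N =>
          (stepSum_add_left N f.toFun g.toFun τ.mass τ.cdf).symm))
      (fun c τ f => tendsto_nhds_unique (tendsto_integral τ (c • f))
        (((tendsto_integral τ f).const_mul c).congr fun N =>
          (stepSum_mul_left N c f.toFun τ.mass τ.cdf).symm)))
    (1 + Real.pi) abs_integral_le

theorem toDual_apply (τ : KMeas) (f : BL ArctanLine) : toDual τ f = τ.integral f := rfl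

/-- Both sides are limits of the same Abel sums, so the Jordan parts of a law need not be
identified. -/
theorem toDual_lawToKMeas (P : ProbabilityMeasure ℝ) :
    toDual (lawToKMeas P) = probToDual (show ProbabilityMeasure ArctanLine from P) := by
  ext f
  rw [toDual_apply]
  refine tendsto_nhds_unique (tendsto_integral _ f) ?_
  have h1 : (lawToKMeas P).cdf = fun t => (P : Measure ℝ).real (Iic t) := funext fun t =>
    Measure.toSignedMeasure_apply_measurable measurableSet_Iic
  have h2 : (lawToKMeas P).mass = (P : Measure ℝ).real univ :=
    Measure.toSignedMeasure_apply_measurable MeasurableSet.univ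
  rw [h1, h2]
  exact tendsto_stepSum f _

end KMeas

/-- The scatter theorem on the arctan line is pulled back along `KMeas.toDual`; the functional is
then an analytic function of the scatter matrix of the lifted law. -/
theorem analyticOnLaws_tLocScatterOne {ν : ℝ} (hν : 1 < ν) :
    AnalyticOnLaws lawToKMeas (tLocScatterOne ν) {P | lawOne P ∈ locScatterDomain 1 (ν + 1)} := by
  have hm : Measurable fun x : ArctanLine => ArctanLine.lift x := ArctanLine.measurable_lift
  have h := ArctanLine.blRatio_lift.analyticOnLaws_tScatter hm (sub_pos.2 hν)
  have hmap : ∀ P : ProbabilityMeasure ℝ, (show ProbabilityMeasure ArctanLine from P).map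
      hm.aemeasurable = liftLaw (lawOne P) := fun P =>
    Subtype.ext (Measure.map_map measurable_liftOne ArctanLine.measurable_toLp).symm
  have h1 := h.pullback (ι := fun P : ProbabilityMeasure ℝ =>
    (show ProbabilityMeasure ArctanLine from P)) KMeas.toDual KMeas.toDual_lawToKMeas
  have hD : (fun P : ProbabilityMeasure ℝ => (show ProbabilityMeasure ArctanLine from P)) ⁻¹'
      {μ | μ.map hm.aemeasurable ∈ scatterDomain (1 + 1) (ν - 1 + (1 + 1 : ℕ))} =
      {P | lawOne P ∈ locScatterDomain 1 (ν + 1)} := by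
    ext P
    have := liftLaw_mem_scatterDomain_iff hν (lawOne P)
    rw [Nat.cast_one, ← hmap] at this
    exact this
  rw [hD] at h1
  have h2 := h1.postcomp isOpen_univ (fun _ _ => Set.mem_univ _) (h := unblock)
    fun A _ => analyticAt_unblock A
  let L : Rd 1 × SymMat 1 →ₗ[ℝ] ℝ × ℝ :=
    { toFun := fun θ => (θ.1 0, (θ.2 : Matrix (Fin 1) (Fin 1) ℝ) 0 0)
      map_add' := fun _ _ => rfl
      map_smul' := fun _ _ => rfl }
  have h3 := h2.postcomp isOpen_univ (fun _ _ => Set.mem_univ _)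
    (h := LinearMap.toContinuousLinearMap L)
    fun θ _ => (LinearMap.toContinuousLinearMap L).analyticAt θ
  refine h3.congr fun P hP => ?_
  have hP' : lawOne P ∈ locScatterDomain 1 (ν + (1 : ℕ)) := by
    rw [Nat.cast_one]
    exact hP
  have h4 := tLocScatter_eq hν hP'
  rw [← hmap] at h4
  exact congrArg L h4.symm

end

theorem theorem5p3 (d : ℕ) (hd : 1 ≤ d) (ν : ℝ) (hν : 0 < ν) :
    -- the score is the gradient of `H_ν` in `C = A⁻¹` for the Frobenius inner product,
    -- and it is bounded and Lipschitz in `y`, so that `F` is well defined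
    (∀ C ∈ PosMat d, ∀ y : Rd d, ∃ L : SymMat d →L[ℝ] ℝ,
      (∀ Δ : SymMat d,
        L Δ = (score ν y (symInv C) * (Δ : Matrix (Fin d) (Fin d) ℝ)).trace) ∧
      HasFDerivAt (fun B : SymMat d => scatterH ν y (symInv B)) L C) ∧
    (∀ A ∈ PosMat d, ∀ i j : Fin d, IsBL fun y : Rd d => score ν y A i j) ∧
    -- (a)
    AnalyticOnNhd ℝ (scoreMap (d := d) ν) (Set.univ ×ˢ PosMat d) ∧
    -- (b)
    (∀ Q ∈ scatterDomain d (ν + d),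
      IsTScatter ν Q (tScatter ν Q) ∧
      ∃ D : SymMat d ≃L[ℝ] SymMat d,
        HasFDerivAt (fun C : SymMat d => scoreMap ν (lawToDual Q, symInv C))
          (D : SymMat d →L[ℝ] SymMat d) (symInv (tScatter ν Q))) ∧
    -- (c)
    AnalyticOnLaws lawToDual (tScatter ν) (scatterDomain d (ν + d)) ∧
    IsOpen (scatterDomain d (ν + d)) ∧
    -- (d)
    (1 < ν →
      (∀ P ∈ locScatterDomain d (ν + d),
        IsTLocScatter ν P (tLocScatter ν P) ∧
        (tScatter (ν - 1) (liftLaw P) : Matrix (Fin (d + 1)) (Fin (d + 1)) ℝ) =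
          locScatterBlock (tLocScatter ν P)) ∧
      AnalyticOnLaws lawToDual (tLocScatter ν) (locScatterDomain d (ν + d))) ∧
    -- (e)
    (1 < ν →
      AnalyticOnLaws lawToKMeas (tLocScatterOne ν)
        {P | lawOne P ∈ locScatterDomain 1 (ν + 1)}) := by
  refine ⟨fun C hC y => hasFDerivAt_scatterH hν hC y, fun A hA i j => isBL_score hν hA i j,
    analyticOnNhd_scoreMap hν,
    fun Q hQ => ⟨isTScatter_tScatter hν hQ, exists_equiv_hasFDerivAt_scoreMap hν hQ⟩,
    analyticOnLaws_tScatter hν, isOpen_scatterDomain d _, fun h => ⟨fun P hP =>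
      ⟨isTLocScatter_tLocScatter h hP, tScatter_liftLaw_eq h hP⟩, analyticOnLaws_tLocScatter h⟩,
    fun h => analyticOnLaws_tLocScatterOne h⟩
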